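/- All graphs are finite and simple. A hole is an induced cycle of length at least four; a graph is $\ell$-holed if all its holes have length exactly $\ell$. A threshold graph is a graph with no induced $P_4$ (four-vertex path), $C_4$ or $\overline{C_4}$. For disjoint vertex sets $X,Y$ of $G$, $G[X,Y]$ is the bipartite graph of the edges of $G$ between $X$ and $Y$; it is a half-graph if it has no induced two-edge matching, and it obeys orderings $x_1,\dots,x_m$ of $X$ and $y_1,\dots,y_n$ of $Y$ if whenever $i\le i'$, $j\le j'$ and $x_{i'}y_{j'}$ is an edge, $x_iy_j$ is an edge. Two-connected means connected, with at least three vertices and no cut-vertex. **Apexed $\ell$-frames.** Let $k\ge 3$ and $\ell\ge 7$. Take $k$ pairwise vertex-disjoint paths $P_1,\dots,P_k$ (the bars), where $P_i$ has ends $a_i,b_i$, and let $A,B$ be graphs with vertex sets $\{a_1,\dots,a_k\}$ and $\{b_1,\dots,b_k\}$ respectively, such that: - if $\ell$ is odd: every $P_i$ has length $(\ell-3)/2$; $A,B$ are threshold graphs; for $i\ne j$, $b_i,b_j$ are adjacent if and only if $a_i,a_j$ are nonadjacent; and each of $A,B$ is either disconnected or two-connected; - if $\ell$ is even: there is $I\subseteq\{1,\dots,k\}$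 with $|I|\ge 2$ such that $P_i$ has length $\ell/2-2$ for $i\in I$ and $\ell/2-1$ for $i\notin I$; the sets $\{a_i:i\in I\}$, $\{b_i:i\in I\}$ are stable; the sets $\{a_i:i\notin I\}$, $\{b_i:i\notin I\}$ are cliques; $A[\{a_i:i\in I\},\{a_j:j\notin I\}]$ is a half-graph; for $i\in I$ and $j\notin I$, $b_i,b_j$ are adjacent if and only if $a_i,a_j$ are nonadjacent; some $a_i$ $(i\in I)$ has degree zero in $A$, and some $b_i$ $(i\in I)$ has degree zero in $B$. The union of $A,B,P_1,\dots,P_k$ is an $\ell$-frame. If $A$ is disconnected, add a new vertex $a_0$ (an apex) adjacent to $a_1,\dots,a_k$ and to nothing else; if $B$ is disconnected, add a new vertex $b_0$ (an apex) adjacent to $b_1,\dots,b_k$ and to nothing else. (For even $\ell$ both apexes always exist.) The result $F$ is an apexed $\ell$-frame. Let $A^+$ be $A$ together with $a_0$ if it exists, and define $B^+$ similarly. **Blow-ups.** Let $G$ be a graph and for each $t\in V(F)$ let $W_t$ be a nonempty clique of $G$ with a fixed ordering, such that for all distinct $s,t\in V(F)$: (i) $W_s\cap W_t=\emptyset$;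 (ii) if $s,t$ are nonadjacent in $F$, there are no edges of $G$ between $W_s$ and $W_t$; (iii) if $s,t$ are adjacent in $F$, then $G[W_s,W_t]$ is a half-graph that obeys the orderings of $W_s,W_t$, and each of its vertices has positive degree; (iv) if $s,t$ are adjacent in $F$ and both have degree at least three in $F$, then every vertex of $W_s$ is adjacent to every vertex of $W_t$. The subgraph $H$ of $G$ induced on $\bigcup_{t\in V(F)}W_t$ is a blow-up of $F$ in $G$, with bags $W_t$. It is maximal if no blow-up of $F$ in $G$ has a vertex set properly containing $V(H)$. For a set or subgraph $C$ of $F$, $W(C)$ denotes the union of the bags $W_t$ over the vertices $t$ of $C$. **Theorem.** Let $\ell\ge 7$ and $k\ge 3$, let $F$ be an apexed $\ell$-frame with bars $P_1,\dots,P_k$ as above, let $G$ be an $\ell$-holed graph, and let $H$ be a maximal blow-up of $F$ in $G$, with bags $W_t$ $(t\in V(F))$. For every $x\in V(G)\setminus V(H)$, let $N$ be the set of neighbours of $x$ in $V(H)$. Then at least one of the following holds: - $N$ is a clique; - $N=V(H)$; - $N\subseteq W(A^+)$, and if $a_0$ exists then $N\cap W_{a_i}=\emptyset$ for some $i\in\{1,\dots,k\}$;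 - $N\subseteq W(B^+)$, and if $b_0$ exists then $N\cap W_{b_i}=\emptyset$ for some $i\in\{1,\dots,k\}$. -/

import Mathlib

/-- `G` is `ℓ`-holed: every hole (induced cycle of length at least four) has length exactly `ℓ`. -/
def IsHoled {V : Type*} (ℓ : ℕ) (G : SimpleGraph V) : Prop :=
  ∀ n : ℕ, 4 ≤ n → (SimpleGraph.cycleGraph n).IsIndContained G → n = ℓ

/-- A threshold graph: no induced four-vertex path, four-cycle, or complement of a four-cycle. -/
def IsThreshold {V : Type*} (G : SimpleGraph V) : Prop :=
  ¬ (SimpleGraph.pathGraph 4).IsIndContained G ∧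
  ¬ (SimpleGraph.cycleGraph 4).IsIndContained G ∧
  ¬ ((SimpleGraph.cycleGraph 4)ᶜ).IsIndContained G

/-- Two-connected: at least three vertices, connected, and without cut-vertices. -/
def IsTwoConnected {V : Type*} (G : SimpleGraph V) : Prop :=
  3 ≤ ENat.card V ∧ G.Connected ∧ ∀ v : V, (G.induce {v}ᶜ).Connected

/-- The bipartite graph `G[X, Y]` is a half-graph: it has no induced two-edge matching. -/
def IsHalfGraphBetween {V : Type*} (G : SimpleGraph V) (X Y : Set V) : Prop :=
  ∀ x ∈ X, ∀ x' ∈ X, ∀ y ∈ Y, ∀ y' ∈ Y,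
    G.Adj x y → G.Adj x' y' → G.Adj x y' ∨ G.Adj x' y

/-- `G[X, Y]` obeys the orderings of `X` and `Y` (given as lists). -/
def ObeysOrder {V : Type*} (G : SimpleGraph V) (X Y : List V) : Prop :=
  ∀ (i i' : Fin X.length) (j j' : Fin Y.length), i ≤ i' → j ≤ j' →
    G.Adj (X.get i') (Y.get j') → G.Adj (X.get i) (Y.get j)

/-- The data from which a frame with `k` bars is built: the adjacency `A` between the ends
`a_1, …, a_k`, the adjacency `B` between the ends `b_1, …, b_k`, and the lengths of the bars. -/
structure FrameData (k : ℕ) where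
  A : SimpleGraph (Fin k)
  B : SimpleGraph (Fin k)
  len : Fin k → ℕ

namespace FrameData

variable {k : ℕ}

/-- The conditions defining an `ℓ`-frame, for `ℓ` odd. -/
structure IsOddFrame (D : FrameData k) (ℓ : ℕ) : Prop where
  odd : Odd ℓ
  three_le : 3 ≤ k
  len_eq : ∀ i, 2 * D.len i + 3 = ℓ
  thresholdA : IsThreshold D.A
  thresholdB : IsThreshold D.B
  adj_iff : ∀ i j, i ≠ j → (D.B.Adj i j ↔ ¬ D.A.Adj i j)
  connA : ¬ D.A.Connected ∨ IsTwoConnected D.A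
  connB : ¬ D.B.Connected ∨ IsTwoConnected D.B

/-- The conditions defining an `ℓ`-frame, for `ℓ` even. Here `I` is the set of indices of the
`n` bars of length `ℓ/2 - 2`; the other `m = k - n` bars have length `ℓ/2 - 1`. -/
structure IsEvenFrameWith (D : FrameData k) (ℓ : ℕ) (I : Finset (Fin k)) : Prop where
  even : Even ℓ
  three_le : 3 ≤ k
  two_le : 2 ≤ I.card
  len_short : ∀ i ∈ I, 2 * D.len i + 4 = ℓ
  len_long : ∀ i ∉ I, 2 * D.len i + 2 = ℓ
  stableA : ∀ i ∈ I, ∀ j ∈ I, ¬ D.A.Adj i j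
  stableB : ∀ i ∈ I, ∀ j ∈ I, ¬ D.B.Adj i j
  cliqueA : ∀ i ∉ I, ∀ j ∉ I, i ≠ j → D.A.Adj i j
  cliqueB : ∀ i ∉ I, ∀ j ∉ I, i ≠ j → D.B.Adj i j
  half : IsHalfGraphBetween D.A {i | i ∈ I} {j | j ∉ I}
  adj_iff : ∀ i ∈ I, ∀ j ∉ I, (D.B.Adj i j ↔ ¬ D.A.Adj i j)
  isolatedA : ∃ i ∈ I, ∀ j, ¬ D.A.Adj i j
  isolatedB : ∃ i ∈ I, ∀ j, ¬ D.B.Adj i j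

/-- `D` is the data of an `ℓ`-frame. -/
def IsFrame (D : FrameData k) (ℓ : ℕ) : Prop :=
  D.IsOddFrame ℓ ∨ ∃ I, D.IsEvenFrameWith ℓ I

/-- The apex `a₀` exists if and only if the side `A` is disconnected. (For `ℓ` even both sides are
always disconnected, so both apexes exist: see `IsEvenFrameWith.hasApexes`.) -/
def HasApexA (D : FrameData k) : Prop := ¬ D.A.Connected

/-- The apex `b₀` exists if and only if the side `B` is disconnected. -/
def HasApexB (D : FrameData k) : Prop := ¬ D.B.Connected

theorem not_connected_of_isolated {n : ℕ} (hn : 3 ≤ n) (H : SimpleGraph (Fin n)) (i : Fin n)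
    (hi : ∀ j, ¬ H.Adj i j) : ¬ H.Connected := by
  intro h
  have : Nontrivial (Fin n) := Fin.nontrivial_iff_two_le.2 (by omega)
  obtain ⟨j, hj⟩ := h.preconnected.exists_adj_of_nontrivial i
  exact hi j hj

theorem IsEvenFrameWith.hasApexes {D : FrameData k} {ℓ : ℕ} {I : Finset (Fin k)}
    (h : D.IsEvenFrameWith ℓ I) : D.HasApexA ∧ D.HasApexB := by
  obtain ⟨i, -, hi⟩ := h.isolatedA
  obtain ⟨j, -, hj⟩ := h.isolatedB
  exact ⟨not_connected_of_isolated h.three_le _ i hi, not_connected_of_isolated h.three_le _ j hj⟩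

/-- The vertices of the apexed frame: the bar `P_i` has vertices `bar i 0, …, bar i (len i)`, and
there are at most two further vertices, the apexes. -/
inductive Vertex (D : FrameData k) : Type
  | bar (i : Fin k) (j : Fin (D.len i + 1)) : Vertex D
  | apexA (h : D.HasApexA) : Vertex D
  | apexB (h : D.HasApexB) : Vertex D

/-- The end `a_i` of the bar `P_i`. -/
def a (D : FrameData k) (i : Fin k) : D.Vertex := .bar i 0

/-- The end `b_i` of the bar `P_i`. -/
def b (D : FrameData k) (i : Fin k) : D.Vertex := .bar i (Fin.last _)

/-- The edges of the apexed frame, up to orientation. -/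
inductive Edge (D : FrameData k) : D.Vertex → D.Vertex → Prop
  | bar (i : Fin k) (j : Fin (D.len i)) : Edge D (.bar i j.castSucc) (.bar i j.succ)
  | sideA (i j : Fin k) (h : D.A.Adj i j) : Edge D (D.a i) (D.a j)
  | sideB (i j : Fin k) (h : D.B.Adj i j) : Edge D (D.b i) (D.b j)
  | apexA (h : D.HasApexA) (i : Fin k) : Edge D (.apexA h) (D.a i)
  | apexB (h : D.HasApexB) (i : Fin k) : Edge D (.apexB h) (D.b i)

/-- The apexed frame: the union of the sides and the bars, with the apexes added. -/
def apexedFrame (D : FrameData k) : SimpleGraph D.Vertex := SimpleGraph.fromRel D.Edge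

/-- The vertex set of the side `A⁺`. -/
def sideAPlus (D : FrameData k) : Set D.Vertex :=
  {t | (∃ i, t = D.a i) ∨ ∃ h, t = .apexA h}

/-- The vertex set of the side `B⁺`. -/
def sideBPlus (D : FrameData k) : Set D.Vertex :=
  {t | (∃ i, t = D.b i) ∨ ∃ h, t = .apexB h}

end FrameData

/-- `W(S)`, the union of the bags `W_t` over `t ∈ S`. -/
def bagUnion {T V : Type*} (W : T → List V) (S : Set T) : Set V :=
  {y | ∃ t ∈ S, y ∈ W t}

/-- The ordered cliques `W_t` of `G`, for `t` a vertex of `F`, are the bags of a blow-up of `F` in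
`G`. The blow-up itself is the subgraph of `G` induced on `bagUnion W Set.univ`. -/
structure IsBlowUp {T V : Type*} (F : SimpleGraph T) (G : SimpleGraph V) (W : T → List V) :
    Prop where
  nonnull : ∀ t, W t ≠ []
  nodup : ∀ t, (W t).Nodup
  clique : ∀ t, G.IsClique {y | y ∈ W t}
  disjoint : ∀ s t, s ≠ t → (W s).Disjoint (W t)
  anticomplete : ∀ s t, s ≠ t → ¬ F.Adj s t → ∀ x ∈ W s, ∀ y ∈ W t, ¬ G.Adj x y
  halfGraph : ∀ s t, F.Adj s t → IsHalfGraphBetween G {x | x ∈ W s} {y | y ∈ W t}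
  obeys : ∀ s t, F.Adj s t → ObeysOrder G (W s) (W t)
  posDegree : ∀ s t, F.Adj s t → ∀ x ∈ W s, ∃ y ∈ W t, G.Adj x y
  complete : ∀ s t, F.Adj s t → 3 ≤ (F.neighborSet s).encard → 3 ≤ (F.neighborSet t).encard →
    ∀ x ∈ W s, ∀ y ∈ W t, G.Adj x y

/-- `W` is the family of bags of a maximal blow-up of `F` in `G`: no blow-up of `F` in `G` has a
strictly larger vertex set. -/
def IsMaximalBlowUp {T V : Type*} (F : SimpleGraph T) (G : SimpleGraph V) (W : T → List V) :
    Prop :=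
  IsBlowUp F G W ∧
    ∀ W' : T → List V, IsBlowUp F G W' → ¬ bagUnion W Set.univ ⊂ bagUnion W' Set.univ

/-! Call a bag met if `x` has a neighbour in it. A transversal picks one vertex per bag so that all
edges of `F` are realised; it is an induced copy of `F`, so each hole of `F` has many copies in `G`.
The basic fact is `between_of_not_full`: if `x` is not complete to an `ℓ`-hole avoiding it, two
nonadjacent neighbours of `x` on the hole are at distance two, and the vertex between them is a
neighbour too. Otherwise a gap between neighbours of `x` would close through `x` to a hole of the
wrong length.

Two bars of `F`, joined at each side directly or by a link vertex, form an `ℓ`-hole (a ring), and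
any two vertices of `F` lie in a ring (`exists_ring_pair`). If `x` is complete to some copy of a
ring, this spreads: a hole through two far vertices (distinct, nonadjacent, without common
neighbour) that are already neighbours of `x` is wholly in its neighbourhood. The spreading reaches
all of `F` (`mem_of_isFarClosed`) and then all of every bag (`complete_of_transversal`), so `x` is
complete to the blow-up.

Otherwise, any two distinct nonadjacent met bags have a common neighbour in `F` that is also met.
This leaves few shapes for the set of met bags (`shape_of_common_neighbors`): inside one side,
inside an edge, around a vertex of degree two, or around a bar end and reaching both into the bar
and into the side. Inside an edge the neighbourhood is a clique, since two nonadjacent neighbours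
would lengthen an `ℓ`-hole by one. In the last two shapes `x` attaches like a vertex of one bag, and
`isBlowUpFamily_insert` adds it there, against maximality. The same insertion, at the apex, shows
that a vertex attaching only to `A⁺` must miss the bag of some `a_i` when `a₀` exists.

The device behind the insertion and the clique argument is `no_long_hole`: in a copy of an `ℓ`-hole,
one vertex cannot be replaced by an edge. -/

/-- `p 0, …, p (n - 1)` are, in this order, the vertices of a cycle of `G` without chords. -/
def IsCyclePattern {V : Type*} (G : SimpleGraph V) (n : ℕ) (p : ℕ → V) : Prop :=
  ∀ i j, i < j → j < n → (G.Adj (p i) (p j) ↔ j = i + 1 ∨ (i = 0 ∧ j + 1 = n))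

/-! ### Chordless cycles: distinctness, rotation and reflection. -/

namespace IsCyclePattern

variable {V : Type*} {G : SimpleGraph V} {n : ℕ} {p : ℕ → V}

/-- Equal vertices would have the same neighbours, but on a cycle of length at least five distinct
positions are separated by the neighbours of one of them. Hence injectivity need not be part of
`IsCyclePattern`. -/
theorem ne (h : IsCyclePattern G n p) (hn : 5 ≤ n) {i j : ℕ} (hij : i < j) (hj : j < n) :
    p i ≠ p j := by
  intro he
  have key : ∀ t, t < i ∨ i < t → t < j ∨ j < t → t < n →
      (((t = i + 1 ∨ i = t + 1) ∨ (i = 0 ∧ t + 1 = n) ∨ (t = 0 ∧ i + 1 = n)) ↔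
       ((t = j + 1 ∨ j = t + 1) ∨ (j = 0 ∧ t + 1 = n) ∨ (t = 0 ∧ j + 1 = n))) := by
    intro t hti htj htn
    have h1 : G.Adj (p t) (p i) ↔
        ((t = i + 1 ∨ i = t + 1) ∨ (i = 0 ∧ t + 1 = n) ∨ (t = 0 ∧ i + 1 = n)) := by
      rcases hti with hti | hti
      · rw [h t i hti (by omega)]; omega
      · rw [G.adj_comm, h i t hti (by omega)]; omega
    have h2 : G.Adj (p t) (p j) ↔
        ((t = j + 1 ∨ j = t + 1) ∨ (j = 0 ∧ t + 1 = n) ∨ (t = 0 ∧ j + 1 = n)) := by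
      rcases htj with htj | htj
      · rw [h t j htj (by omega)]; omega
      · rw [G.adj_comm, h j t htj (by omega)]; omega
    rw [← h1, ← h2, he]
  have hadj : ¬ G.Adj (p i) (p j) := by rw [he]; exact G.irrefl
  rw [h i j hij hj] at hadj
  have h1 := key (i + 1) (by omega) (by omega) (by omega)
  rcases Nat.eq_zero_or_pos i with h0 | h0
  · have h2 := key (n - 1) (by omega) (by omega) (by omega)
    have h3 := key (j + 1)
    omega
  · have h2 := key (i - 1) (by omega) (by omega) (by omega)
    omega

theorem isIndContained (h : IsCyclePattern G n p) (hn : 4 ≤ n)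
    (hne : ∀ i j, i < j → j < n → p i ≠ p j) : (SimpleGraph.cycleGraph n).IsIndContained G := by
  obtain ⟨m, rfl⟩ : ∃ m, n = m + 2 := ⟨n - 2, by omega⟩
  have hinj : Function.Injective (fun i : Fin (m + 2) => p i) := by
    intro i j hij
    rcases lt_trichotomy i j with hl | hl | hl
    · exact absurd hij (hne i j hl j.2)
    · exact hl
    · exact absurd hij.symm (hne j i hl i.2)
  have aux : ∀ i j : Fin (m + 2), i < j →
      (G.Adj (p i) (p j) ↔ (SimpleGraph.cycleGraph (m + 2)).Adj i j) := by
    intro i j hij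
    rw [h i j hij j.2, SimpleGraph.cycleGraph_adj']
    have h1 : (j - i).val = j.val - i.val := Fin.sub_val_of_le hij.le
    have h2 : (i - j).val = m + 2 + i.val - j.val := by
      rw [Fin.coe_sub_iff_lt.2 hij]
    have := i.2
    have := j.2
    have : i.val < j.val := hij
    omega
  refine ⟨⟨⟨fun i => p i, hinj⟩, ?_⟩⟩
  intro i j
  rcases lt_trichotomy i j with hl | hl | hl
  · exact aux i j hl
  · subst hl; simp
  · rw [SimpleGraph.adj_comm, SimpleGraph.adj_comm (SimpleGraph.cycleGraph (m + 2))]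
    exact aux j i hl

theorem eq_of_isHoled {ℓ : ℕ} (h : IsCyclePattern G n p) (hG : IsHoled ℓ G) (hn : 5 ≤ n) : n = ℓ :=
  hG n (by omega) (h.isIndContained (by omega) fun _ _ h1 h2 => h.ne hn h1 h2)

theorem rotate (h : IsCyclePattern G n p) {r : ℕ} (hr : r < n) :
    IsCyclePattern G n (fun k => if k + r < n then p (k + r) else p (k + r - n)) := by
  intro i j hij hj
  dsimp only
  split_ifs with h1 h2 h2
  · rw [h _ _ (by omega) (by omega)]; omega
  · rw [G.adj_comm, h _ _ (by omega) (by omega)]; omega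
  · omega
  · rw [h _ _ (by omega) (by omega)]; omega

theorem reverse (h : IsCyclePattern G n p) :
    IsCyclePattern G n (fun k => if k = 0 then p 0 else p (n - k)) := by
  intro i j hij hj
  dsimp only
  split_ifs with h1 h2 h2
  · omega
  · rw [h _ _ (by omega) (by omega)]; omega
  · omega
  · rw [G.adj_comm, h _ _ (by omega) (by omega)]; omega

/-- A chordless cycle may be started at any of its vertices. -/
theorem exists_start (h : IsCyclePattern G n p) {r : ℕ} (hr : r < n) :
    ∃ q : ℕ → V, IsCyclePattern G n q ∧ q 0 = p r ∧ (∀ k < n, ∃ k' < n, q k = p k') ∧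
      (∀ k < n, ∃ k' < n, p k = q k') := by
  refine ⟨_, h.rotate hr, by simp [hr], ?_, ?_⟩
  · intro k hk
    by_cases h1 : k + r < n
    · exact ⟨k + r, h1, by simp [h1]⟩
    · exact ⟨k + r - n, by omega, by simp [h1]⟩
  · intro k hk
    by_cases h1 : r ≤ k
    · exact ⟨k - r, by omega, by simp [h1, hk]⟩
    · refine ⟨k + n - r, by omega, ?_⟩
      have e : k + n - r + r = k + n := by omega
      simp [e]

/-- A chordless cycle may be started at any three consecutive vertices. -/
theorem exists_start_three (h : IsCyclePattern G n p) (hn : 5 ≤ n) {s m t : V}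
    (hs : ∃ k < n, p k = s) (hm : ∃ k < n, p k = m) (ht : ∃ k < n, p k = t)
    (hsm : G.Adj s m) (hmt : G.Adj m t) (hst : s ≠ t) :
    ∃ q : ℕ → V, IsCyclePattern G n q ∧ q 0 = m ∧ q 1 = t ∧ q (n - 1) = s ∧
      ∀ k < n, ∃ k' < n, q k = p k' := by
  obtain ⟨r, hr, rfl⟩ := hm
  obtain ⟨q, hq, hq0, hqp, hpq⟩ := h.exists_start hr
  obtain ⟨a, ha, rfl⟩ := hs
  obtain ⟨b, hb, rfl⟩ := ht
  obtain ⟨a', ha', hae⟩ := hpq a ha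
  obtain ⟨b', hb', hbe⟩ := hpq b hb
  rw [hae, ← hq0] at hsm
  rw [hbe, ← hq0] at hmt
  rw [hae, hbe] at hst
  have ha0 : 0 < a' := Nat.pos_of_ne_zero fun h0 => by rw [h0] at hsm; exact G.irrefl hsm
  have hb0 : 0 < b' := Nat.pos_of_ne_zero fun h0 => by rw [h0] at hmt; exact G.irrefl hmt
  have h1 := (hq 0 a' ha0 ha').1 hsm.symm
  have h2 := (hq 0 b' hb0 hb').1 hmt
  have hab : a' ≠ b' := fun h => hst (by rw [h])
  by_cases hb1 : b' = 1
  · refine ⟨q, hq, hq0, by rw [hbe, hb1], ?_, hqp⟩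
    rw [hae]; congr 1; omega
  · refine ⟨_, hq.reverse, by simp [hq0], ?_, ?_, ?_⟩
    · rw [hbe]; simp only [one_ne_zero, if_false]; congr 1; omega
    · rw [hae, if_neg (by omega)]; congr 1; omega
    · intro k hk
      by_cases hk0 : k = 0
      · simpa [hk0] using hqp 0 (by omega)
      · simpa [hk0] using hqp (n - k) (by omega)

end IsCyclePattern

/-! ### Excluding holes of length four, five and six. -/

section SmallHoles

variable {V : Type*} {G : SimpleGraph V} {ℓ : ℕ}

theorem SimpleGraph.cycleGraph_four_isIndContained {a b c d : V} (hab : G.Adj a b)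
    (hbc : G.Adj b c) (hcd : G.Adj c d) (hda : G.Adj d a) (hac : ¬ G.Adj a c) (hbd : ¬ G.Adj b d)
    (nac : a ≠ c) (nbd : b ≠ d) : (SimpleGraph.cycleGraph 4).IsIndContained G := by
  refine IsCyclePattern.isIndContained (p := fun k => if k = 0 then a else if k = 1 then b else
      if k = 2 then c else d) ?_ le_rfl ?_
  · intro i j hij hj
    interval_cases j <;> interval_cases i <;> simp_all [G.adj_comm]
  · intro i j hij hj
    have := hab.ne
    have := hbc.ne
    have := hcd.ne
    have := hda.ne'
    interval_cases j <;> interval_cases i <;> simp_all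

theorem IsHoled.no_four (hG : IsHoled ℓ G) (hℓ : 7 ≤ ℓ) {a b c d : V} (hab : G.Adj a b)
    (hbc : G.Adj b c) (hcd : G.Adj c d) (hda : G.Adj d a) (hac : ¬ G.Adj a c) (hbd : ¬ G.Adj b d)
    (nac : a ≠ c) (nbd : b ≠ d) : False := by
  have := hG 4 le_rfl
    (SimpleGraph.cycleGraph_four_isIndContained hab hbc hcd hda hac hbd nac nbd)
  omega

theorem IsHoled.no_five (hG : IsHoled ℓ G) (hℓ : 7 ≤ ℓ) {a b c d e : V} (hab : G.Adj a b)
    (hbc : G.Adj b c) (hcd : G.Adj c d) (hde : G.Adj d e) (hea : G.Adj e a) (hac : ¬ G.Adj a c)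
    (had : ¬ G.Adj a d) (hbd : ¬ G.Adj b d) (hbe : ¬ G.Adj b e) (hce : ¬ G.Adj c e) : False := by
  have hp : IsCyclePattern G 5 (fun k => if k = 0 then a else if k = 1 then b else
      if k = 2 then c else if k = 3 then d else e) := by
    intro i j hij hj
    interval_cases j <;> interval_cases i <;> simp_all [G.adj_comm]
  have := hp.eq_of_isHoled hG le_rfl
  omega

theorem IsHoled.no_six (hG : IsHoled ℓ G) (hℓ : 7 ≤ ℓ) {a b c d e f : V} (hab : G.Adj a b)
    (hbc : G.Adj b c) (hcd : G.Adj c d) (hde : G.Adj d e) (hef : G.Adj e f) (hfa : G.Adj f a)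
    (hac : ¬ G.Adj a c) (had : ¬ G.Adj a d) (hae : ¬ G.Adj a e) (hbd : ¬ G.Adj b d)
    (hbe : ¬ G.Adj b e) (hbf : ¬ G.Adj b f) (hce : ¬ G.Adj c e) (hcf : ¬ G.Adj c f)
    (hdf : ¬ G.Adj d f) : False := by
  have hp : IsCyclePattern G 6 (fun k => if k = 0 then a else if k = 1 then b else
      if k = 2 then c else if k = 3 then d else if k = 4 then e else f) := by
    intro i j hij hj
    interval_cases j <;> interval_cases i <;> simp_all [G.adj_comm]
  have := hp.eq_of_isHoled hG (by norm_num)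
  omega

end SmallHoles

/-! ### The neighbours of an outside vertex on an `ℓ`-hole. -/

namespace IsCyclePattern

variable {V : Type*} {G : SimpleGraph V} {n ℓ : ℕ} {p : ℕ → V} {x : V}

/-- A chordless cycle may be started at either end of any of its edges. -/
theorem exists_start_two (h : IsCyclePattern G n p) (hn : 5 ≤ n) {m t : V}
    (hm : ∃ k < n, p k = m) (ht : ∃ k < n, p k = t) (hmt : G.Adj m t) :
    ∃ q : ℕ → V, IsCyclePattern G n q ∧ q 0 = m ∧ q 1 = t ∧ ∀ k < n, ∃ k' < n, q k = p k' := by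
  obtain ⟨r, hr, rfl⟩ := hm
  obtain ⟨q, hq, hq0, hqp, hpq⟩ := h.exists_start hr
  have h1 : G.Adj (q 0) (q 1) := (hq 0 1 (by omega) (by omega)).2 (by omega)
  have h2 : G.Adj (q 0) (q (n - 1)) := (hq 0 (n - 1) (by omega) (by omega)).2 (by omega)
  have h3 : q 1 ≠ q (n - 1) := hq.ne hn (by omega) (by omega)
  obtain ⟨k1, hk1, e1⟩ := hqp 1 (by omega)
  obtain ⟨k2, hk2, e2⟩ := hqp (n - 1) (by omega)
  rw [hq0] at h1 h2
  have : ∃ s, (∃ k < n, p k = s) ∧ G.Adj s (p r) ∧ s ≠ t := by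
    by_cases h4 : q 1 = t
    · exact ⟨q (n - 1), ⟨k2, hk2, e2.symm⟩, h2.symm, fun h5 => h3 (h4.trans h5.symm)⟩
    · exact ⟨q 1, ⟨k1, hk1, e1.symm⟩, h1.symm, h4⟩
  obtain ⟨s, hs, hsm, hst⟩ := this
  obtain ⟨q', h1', h2', h3', -, h4'⟩ :=
    h.exists_start_three hn hs ⟨r, hr, rfl⟩ ht hsm hmt hst
  exact ⟨q', h1', h2', h3', h4'⟩

theorem exists_gap {i j q : ℕ} (hiq : i < q) (hqj : q < j) (hi : G.Adj x (p i))
    (hj : G.Adj x (p j)) (hq : ¬ G.Adj x (p q)) :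
    ∃ a b, i ≤ a ∧ a < q ∧ q < b ∧ b ≤ j ∧ G.Adj x (p a) ∧ G.Adj x (p b) ∧
      ∀ k, a < k → k < b → ¬ G.Adj x (p k) := by
  by_cases h : ∃ r, i < r ∧ r < j ∧ G.Adj x (p r)
  · obtain ⟨r, h1, h2, h3⟩ := h
    rcases lt_trichotomy r q with hr | hr | hr
    · obtain ⟨a, b, h⟩ := exists_gap hr hqj h3 hj hq
      exact ⟨a, b, by omega, h.2⟩
    · exact absurd (hr ▸ h3) hq
    · obtain ⟨a, b, h4, h5, h6, h7, h⟩ := exists_gap hiq hr hi h3 hq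
      exact ⟨a, b, h4, h5, h6, by omega, h⟩
  · push Not at h
    exact ⟨i, j, le_rfl, hiq, hqj, le_rfl, hi, hj, h⟩
termination_by j - i

/-- The segment from `p a` to `p b` closes through `x` to a chordless cycle of length `b - a + 2`,
which must be `ℓ`. The bound `hba` keeps the closing edge of the original cycle out of the segment.
-/
theorem gap_length (h : IsCyclePattern G ℓ p) (hG : IsHoled ℓ G) (hℓ : 7 ≤ ℓ)
    (hx : ∀ k < ℓ, p k ≠ x) {a b : ℕ} (hab : a + 2 ≤ b) (hb : b < ℓ) (hba : b ≤ a + (ℓ - 2))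
    (ha' : G.Adj x (p a)) (hb' : G.Adj x (p b))
    (hgap : ∀ k, a < k → k < b → ¬ G.Adj x (p k)) : b = a + (ℓ - 2) := by
  rcases Nat.lt_or_ge (a + 2) b with h2 | h2
  · have hq : IsCyclePattern G (b - a + 2) (fun k => if k = 0 then x else p (a + k - 1)) := by
      intro i j hij hj
      dsimp only
      split_ifs with h1 h3 h3
      · omega
      · rcases Nat.lt_trichotomy (a + j - 1) a with h4 | h4 | h4
        · omega
        · rw [h4]; exact iff_of_true ha' (by omega)
        · rcases Nat.lt_or_ge (a + j - 1) b with h5 | h5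
          · exact iff_of_false (hgap _ h4 h5) (by omega)
          · have : a + j - 1 = b := by omega
            rw [this]; exact iff_of_true hb' (by omega)
      · omega
      · rw [h _ _ (by omega) (by omega)]; omega
    have := hq.eq_of_isHoled hG (by omega)
    omega
  -- A gap with a single inner vertex would give a four-hole.
  · obtain rfl : b = a + 2 := by omega
    exfalso
    refine hG.no_four hℓ ha' ((h a (a + 1) (by omega) (by omega)).2 (by omega))
      ((h (a + 1) (a + 2) (by omega) (by omega)).2 (by omega)) hb'.symm
      (hgap _ (by omega) (by omega)) ?_ (hx _ (by omega)).symm (h.ne (by omega) (by omega) hb)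
    rw [h _ _ (by omega) hb]; omega

/-- A nonneighbour inside the arc lies in a gap spanning `ℓ - 2` edges, so the gap is the whole arc.
The one vertex outside the arc must then be a neighbour, or it would form a four-hole with `x` and
the two ends. -/
theorem arc_full_or (h : IsCyclePattern G ℓ p) (hG : IsHoled ℓ G) (hℓ : 7 ≤ ℓ)
    (hx : ∀ k < ℓ, p k ≠ x) {j : ℕ} (hj : j + 2 ≤ ℓ) (h0 : G.Adj x (p 0)) (hxj : G.Adj x (p j))
    {q : ℕ} (hq0 : 0 < q) (hqj : q < j) (hq : ¬ G.Adj x (p q)) :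
    j = ℓ - 2 ∧ G.Adj x (p (ℓ - 1)) := by
  obtain ⟨a, b, h1, h2, h3, h4, h5, h6, h7⟩ := exists_gap hq0 hqj h0 hxj hq
  have h8 := h.gap_length hG hℓ hx (by omega) (by omega) (by omega) h5 h6 h7
  obtain rfl : a = 0 := by omega
  obtain rfl : b = j := by omega
  refine ⟨by omega, ?_⟩
  by_contra h9
  refine hG.no_four hℓ h6 ((h b (ℓ - 1) (by omega) (by omega)).2 (by omega))
    ((h 0 (ℓ - 1) (by omega) (by omega)).2 (by omega)).symm h0.symm h9 ?_
    (hx _ (by omega)).symm (h.ne (by omega) (by omega) (by omega)).symm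
  rw [G.adj_comm, h _ _ (by omega) (by omega)]; omega

/-- Two nonadjacent neighbours of `x` in a hole which is not contained in the neighbourhood of `x`
have distance two in the hole, and the vertex between them is a neighbour of `x` as well. -/
theorem between_of_not_full (h : IsCyclePattern G ℓ p) (hG : IsHoled ℓ G) (hℓ : 7 ≤ ℓ)
    (hx : ∀ k < ℓ, p k ≠ x) {j : ℕ} (hj2 : 2 ≤ j) (hj : j + 2 ≤ ℓ) (h0 : G.Adj x (p 0))
    (hxj : G.Adj x (p j)) (hn : ¬ ∀ k < ℓ, G.Adj x (p k)) :
    (j = 2 ∧ G.Adj x (p 1)) ∨ (j = ℓ - 2 ∧ G.Adj x (p (ℓ - 1))) := by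
  push Not at hn
  obtain ⟨q, hql, hq⟩ := hn
  have hq0 : q ≠ 0 := fun e => hq (e ▸ h0)
  have hqj : q ≠ j := fun e => hq (e ▸ hxj)
  rcases Nat.lt_or_ge q j with hlt | hge
  · exact Or.inr (h.arc_full_or hG hℓ hx hj h0 hxj (by omega) hlt hq)
  · left
    -- The nonneighbour lies on the complementary arc; reversing the cycle turns this into the arc
    -- from `0` to `ℓ - j`.
    have := h.reverse.arc_full_or (x := x) hG hℓ ?_ (j := ℓ - j) (by omega) (by simpa using h0) ?_
      (q := ℓ - q) (by omega) (by omega) ?_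
    · rw [if_neg (by omega)] at this
      refine ⟨by omega, ?_⟩
      convert this.2 using 2
      omega
    · intro k hk
      split_ifs with hk0
      · exact hx 0 (by omega)
      · exact hx _ (by omega)
    · rw [if_neg (by omega)]
      convert hxj using 2
      omega
    · rw [if_neg (by omega)]
      convert hq using 3
      omega

end IsCyclePattern

/-! ### Bags as sets, transversals, and the attachment of an outside vertex. -/

/-- The sets `X t` are the bags of a blow-up of `F` in `G`. The orderings of the bags are replaced
by the condition that the neighbourhoods of the vertices of a bag are nested. -/
structure IsBlowUpFamily {T V : Type*} (F : SimpleGraph T) (G : SimpleGraph V) (X : T → Set V) :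
    Prop where
  nonempty : ∀ t, (X t).Nonempty
  clique : ∀ t, G.IsClique (X t)
  disjoint : ∀ s t, s ≠ t → Disjoint (X s) (X t)
  anticomplete : ∀ s t, s ≠ t → ¬ F.Adj s t → ∀ x ∈ X s, ∀ y ∈ X t, ¬ G.Adj x y
  posDegree : ∀ s t, F.Adj s t → ∀ x ∈ X s, ∃ y ∈ X t, G.Adj x y
  complete : ∀ s t, F.Adj s t → 3 ≤ (F.neighborSet s).encard → 3 ≤ (F.neighborSet t).encard →
    ∀ x ∈ X s, ∀ y ∈ X t, G.Adj x y
  nested : ∀ t, ∀ y ∈ X t, ∀ y' ∈ X t,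
    (∀ s, F.Adj t s → ∀ z ∈ X s, G.Adj y z → G.Adj y' z) ∨
    (∀ s, F.Adj t s → ∀ z ∈ X s, G.Adj y' z → G.Adj y z)

/-- The vertex `x` lies outside of the blow-up with bags `X t`, in an `ℓ`-holed graph; the vertex
`f t` of the bag `X t` is adjacent to all vertices of the neighbouring bags. -/
structure IsAttachment {T V : Type*} (F : SimpleGraph T) (G : SimpleGraph V) (ℓ : ℕ)
    (X : T → Set V) (f : T → V) (x : V) : Prop where
  holed : IsHoled ℓ G
  seven_le : 7 ≤ ℓ
  family : IsBlowUpFamily F G X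
  first_mem : ∀ t, f t ∈ X t
  first_adj : ∀ s t, F.Adj s t → ∀ z ∈ X s, G.Adj z (f t)
  notMem : ∀ t, x ∉ X t

/-- The vertex `x` has a neighbour in the bag `X t`. -/
def Meets {T V : Type*} (G : SimpleGraph V) (X : T → Set V) (x : V) (t : T) : Prop :=
  ∃ y ∈ X t, G.Adj x y

/-- The vertices `g t` of the bags form an induced copy of `F`. -/
structure IsTransversal {T V : Type*} (F : SimpleGraph T) (G : SimpleGraph V) (X : T → Set V)
    (g : T → V) : Prop where
  mem : ∀ t, g t ∈ X t
  adj : ∀ s t, F.Adj s t → G.Adj (g s) (g t)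

namespace IsTransversal

variable {T V : Type*} {F : SimpleGraph T} {G : SimpleGraph V} {X : T → Set V} {g : T → V}

open Classical in
-- This is how prescribed neighbours of `x` are placed on a copy of a hole, one bag at a time.
theorem update (hg : IsTransversal F G X g) {t : T} {y : V} (hy : y ∈ X t)
    (h : ∀ s, F.Adj s t → G.Adj y (g s)) : IsTransversal F G X (Function.update g t y) where
  mem s := by
    by_cases hs : s = t
    · subst hs; simpa using hy
    · simpa [hs] using hg.mem s
  adj s r hsr := by
    by_cases hs : s = t
    · subst hs
      have : r ≠ s := hsr.ne'
      simpa [this] using h r hsr.symm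
    · by_cases hr : r = t
      · subst hr
        simpa [hs] using (h s hsr).symm
      · simpa [hs, hr] using hg.adj s r hsr

theorem isCyclePattern (hg : IsTransversal F G X g) (hX : IsBlowUpFamily F G X) {n : ℕ}
    {c : ℕ → T} (hn : 5 ≤ n) (hc : IsCyclePattern F n c) :
    IsCyclePattern G n (fun k => g (c k)) := by
  intro i j hij hj
  rw [← hc i j hij hj]
  refine ⟨fun h => ?_, hg.adj _ _⟩
  by_contra h'
  exact hX.anticomplete _ _ (hc.ne hn hij hj) h' _ (hg.mem _) _ (hg.mem _) h

end IsTransversal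

namespace IsAttachment

variable {T V : Type*} {F : SimpleGraph T} {G : SimpleGraph V} {ℓ : ℕ} {X : T → Set V}
  {f : T → V} {x : V}

theorem isTransversal (H : IsAttachment F G ℓ X f x) : IsTransversal F G X f where
  mem := H.first_mem
  adj s t h := H.first_adj s t h _ (H.first_mem s)

theorem ne_of_mem (H : IsAttachment F G ℓ X f x) {t : T} {y : V} (hy : y ∈ X t) : y ≠ x :=
  fun h => H.notMem t (h ▸ hy)

theorem not_adj (H : IsAttachment F G ℓ X f x) {s t : T} (hst : s ≠ t) (h : ¬ F.Adj s t) {y z : V}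
    (hy : y ∈ X s) (hz : z ∈ X t) : ¬ G.Adj y z :=
  H.family.anticomplete s t hst h y hy z hz

/-- There is no hole which results from replacing the vertex `c 0` of a hole of `F` by an edge. -/
theorem no_long_hole (H : IsAttachment F G ℓ X f x) {c : ℕ → T} (hc : IsCyclePattern F ℓ c)
    {y y' z e : V} (hy : y ∈ X (c 1)) (hy' : y' ∈ X (c (ℓ - 1))) (hz : z ∈ X (c (ℓ - 2)))
    (hzy' : G.Adj z y') (hey' : G.Adj e y') (hez : ¬ G.Adj e z) (hey : ¬ G.Adj e y)
    (hef : ∀ k, 2 ≤ k → k + 3 ≤ ℓ → ¬ G.Adj e (f (c k))) (hxe : G.Adj x e) (hxy : G.Adj x y)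
    (hxy' : ¬ G.Adj x y') (hxz : ¬ G.Adj x z)
    (hxf : ∀ k, 2 ≤ k → k + 3 ≤ ℓ → ¬ G.Adj x (f (c k))) : False := by
  have hℓ := H.seven_le
  -- Along the hole `g` follows `f`, except for the prescribed vertices in positions `1`, `ℓ - 2`
  -- and `ℓ - 1`. The cycle below has `x` in position `0` and `e` in the extra position `ℓ`, so its
  -- length is `ℓ + 1`.
  obtain ⟨g, hg⟩ : ∃ g : ℕ → V, g = fun k => if k = 1 then y else if k = ℓ - 2 then z else
    if k = ℓ - 1 then y' else f (c k) := ⟨_, rfl⟩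
  have g1 : g 1 = y := by simp [hg]
  have g2 : g (ℓ - 2) = z := by simp only [hg]; split_ifs <;> first | rfl | omega
  have g3 : g (ℓ - 1) = y' := by simp only [hg]; split_ifs <;> first | rfl | omega
  have g4 : ∀ k, 2 ≤ k → k + 3 ≤ ℓ → g k = f (c k) := by
    intro k h1 h2; simp only [hg]; split_ifs <;> first | rfl | omega
  have hcases : ∀ k, 1 ≤ k → k < ℓ → k = 1 ∨ (2 ≤ k ∧ k + 3 ≤ ℓ) ∨ k = ℓ - 2 ∨ k = ℓ - 1 := by
    omega
  have gmem : ∀ k, 1 ≤ k → k < ℓ → g k ∈ X (c k) := by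
    intro k h1 h2
    rcases hcases k h1 h2 with rfl | ⟨h3, h4⟩ | rfl | rfl
    · rwa [g1]
    · rw [g4 k h3 h4]; exact H.first_mem _
    · rwa [g2]
    · rwa [g3]
  have gadj : ∀ k, 1 ≤ k → k + 1 < ℓ → G.Adj (g k) (g (k + 1)) := by
    intro k h1 h2
    have hF : F.Adj (c k) (c (k + 1)) := (hc k (k + 1) (by omega) h2).2 (by omega)
    rcases hcases (k + 1) (by omega) h2 with h | ⟨h3, h4⟩ | h | h
    · omega
    · rw [g4 _ h3 h4]; exact H.first_adj _ _ hF _ (gmem k h1 (by omega))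
    · rw [g4 k (by omega) (by omega)]
      exact (H.first_adj _ _ hF.symm _ (gmem _ (by omega) h2)).symm
    · have : k = ℓ - 2 := by omega
      rw [h, g3, this, g2]; exact hzy'
  have gnadj : ∀ i j, 1 ≤ i → i < j → j < ℓ → (G.Adj (g i) (g j) ↔ j = i + 1) := by
    intro i j h1 h2 h3
    refine ⟨fun h => ?_, fun h => by subst h; exact gadj i h1 h3⟩
    by_contra h4
    exact H.not_adj (hc.ne (by omega) h2 h3) (by rw [hc i j h2 h3]; omega) (gmem i h1 (by omega))
      (gmem j (by omega) h3) h
  have hp : IsCyclePattern G (ℓ + 1) (fun k => if k = 0 then x else if k = ℓ then e else g k) := by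
    intro i j hij hj
    dsimp only
    rw [if_neg (show j ≠ 0 by omega), if_neg (show i ≠ ℓ by omega)]
    by_cases hjl : j = ℓ
    · rw [if_pos hjl]
      by_cases hi : i = 0
      · rw [if_pos hi]; exact iff_of_true hxe (by omega)
      · rw [if_neg hi, G.adj_comm]
        rcases hcases i (by omega) (by omega) with h | ⟨h3, h4⟩ | h | h
        · rw [h, g1]; exact iff_of_false hey (by omega)
        · rw [g4 i h3 h4]; exact iff_of_false (hef i h3 h4) (by omega)
        · rw [h, g2]; exact iff_of_false hez (by omega)
        · rw [h, g3]; exact iff_of_true hey' (by omega)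
    · rw [if_neg hjl]
      by_cases hi : i = 0
      · rw [if_pos hi]
        rcases hcases j (by omega) (by omega) with h | ⟨h3, h4⟩ | h | h
        · rw [h, g1]; exact iff_of_true hxy (by omega)
        · rw [g4 j h3 h4]; exact iff_of_false (hxf j h3 h4) (by omega)
        · rw [h, g2]; exact iff_of_false hxz (by omega)
        · rw [h, g3]; exact iff_of_false hxy' (by omega)
      · rw [if_neg hi, gnadj i j (by omega) hij (by omega)]; omega
  have := hp.eq_of_isHoled H.holed (by omega)
  omega

open Classical in
/-- Two bags of a hole of `F` which are both met by the neighbourhood of `x` have distance at most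
two, unless some copy of the hole is contained in the neighbourhood of `x`. -/
theorem common_neighbor (H : IsAttachment F G ℓ X f x) {c : ℕ → T} (hc : IsCyclePattern F ℓ c)
    (hnf : ∀ g, IsTransversal F G X g → ¬ ∀ k < ℓ, G.Adj x (g (c k))) {i j : ℕ} (hi : i < ℓ)
    (hj : j < ℓ) (hs : Meets G X x (c i)) (ht : Meets G X x (c j)) :
    c i = c j ∨ F.Adj (c i) (c j) ∨ ∃ m, Meets G X x m ∧ F.Adj (c i) m ∧ F.Adj m (c j) := by
  have hℓ := H.seven_le
  obtain ⟨q, hq, hq0, hqp, hpq⟩ := hc.exists_start hi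
  obtain ⟨j', hj', hjj⟩ := hpq j hj
  rw [← hq0] at hs ⊢
  rw [hjj] at ht ⊢
  by_cases h0 : j' = 0
  · exact Or.inl (by rw [h0])
  by_cases h1 : j' = 1 ∨ j' + 1 = ℓ
  · exact Or.inr (Or.inl ((hq 0 j' (by omega) hj').2 (by omega)))
  right; right
  obtain ⟨ys, hys, hxs⟩ := hs
  obtain ⟨yt, hyt, hxt⟩ := ht
  have hne : q 0 ≠ q j' := hq.ne (by omega) (by omega) hj'
  have hnadj : ¬ F.Adj (q 0) (q j') := by rw [hq 0 j' (by omega) hj']; omega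
  have hT1 : IsTransversal F G X (Function.update f (q 0) ys) :=
    H.isTransversal.update hys fun s hs => H.first_adj _ _ hs.symm _ hys
  -- Both replacements can be made at once because the two bags are nonadjacent: the neighbours of
  -- the second bag still carry their vertices `f s`.
  have hT2 : IsTransversal F G X (Function.update (Function.update f (q 0) ys) (q j') yt) := by
    refine hT1.update hyt fun s hs => ?_
    have : s ≠ q 0 := fun h => hnadj (h ▸ hs)
    rw [Function.update_of_ne this]
    exact H.first_adj _ _ hs.symm _ hyt
  have hpat := hT2.isCyclePattern H.family (by omega) hq
  have hfull := hnf _ hT2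
  have := hpat.between_of_not_full (x := x) H.holed hℓ
    (fun k hk => H.ne_of_mem (hT2.mem _)) (j := j') (by omega) (by omega)
    (by simpa [Function.update_of_ne hne] using hxs) (by simpa using hxt) (by
      intro h
      refine hfull fun k hk => ?_
      obtain ⟨k', hk', e⟩ := hpq k hk
      rw [e]; exact h k' hk')
  rcases this with ⟨h2, h3⟩ | ⟨h2, h3⟩
  · exact ⟨q 1, ⟨_, hT2.mem _, h3⟩, (hq 0 1 (by omega) (by omega)).2 (by omega),
      (hq 1 j' (by omega) hj').2 (by omega)⟩
  · exact ⟨q (ℓ - 1), ⟨_, hT2.mem _, h3⟩, (hq 0 (ℓ - 1) (by omega) (by omega)).2 (by omega),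
      ((hq j' (ℓ - 1) (by omega) (by omega)).2 (by omega)).symm⟩

/-- With no common neighbour in `F`, the middle vertex demanded by `between_of_not_full` cannot
exist, so the copy of the hole must be full. -/
theorem full_of_far (H : IsAttachment F G ℓ X f x) {c : ℕ → T} (hc : IsCyclePattern F ℓ c)
    {g : T → V} (hg : IsTransversal F G X g) {i j : ℕ} (hi : i < ℓ) (hj : j < ℓ)
    (hxi : G.Adj x (g (c i))) (hxj : G.Adj x (g (c j))) (hne : c i ≠ c j)
    (hadj : ¬ F.Adj (c i) (c j)) (hm : ∀ m, F.Adj (c i) m → ¬ F.Adj m (c j)) :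
    ∀ k < ℓ, G.Adj x (g (c k)) := by
  have hℓ := H.seven_le
  obtain ⟨q, hq, hq0, hqp, hpq⟩ := hc.exists_start hi
  obtain ⟨j', hj', hjj⟩ := hpq j hj
  rw [← hq0] at hxi hne hadj hm
  rw [hjj] at hxj hne hadj hm
  have h0 : j' ≠ 0 := fun h => hne (by rw [h])
  rw [hq 0 j' (by omega) hj'] at hadj
  have hpat := hg.isCyclePattern H.family (by omega) hq
  by_contra hcon
  have := hpat.between_of_not_full (x := x) H.holed hℓ
    (fun k hk => H.ne_of_mem (hg.mem _)) (j := j') (by omega) (by omega) hxi hxj (by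
      intro h
      refine hcon fun k hk => ?_
      obtain ⟨k', hk', e⟩ := hpq k hk
      rw [e]; exact h k' hk')
  rcases this with ⟨h2, h3⟩ | ⟨h2, h3⟩
  · exact hm (q 1) ((hq 0 1 (by omega) (by omega)).2 (by omega))
      ((hq 1 j' (by omega) hj').2 (by omega))
  · exact hm (q (ℓ - 1)) ((hq 0 (ℓ - 1) (by omega) (by omega)).2 (by omega))
      ((hq j' (ℓ - 1) (by omega) (by omega)).2 (by omega)).symm

theorem adj_of_adj_others (H : IsAttachment F G ℓ X f x) {c : ℕ → T} (hc : IsCyclePattern F ℓ c)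
    {g : T → V} (hg : IsTransversal F G X g) {r : ℕ} (hr : r < ℓ)
    (h : ∀ s, s ≠ c r → G.Adj x (g s)) : G.Adj x (g (c r)) := by
  have hℓ := H.seven_le
  obtain ⟨q, hq, hq0, hqp, hpq⟩ := hc.exists_start hr
  rw [← hq0] at h ⊢
  -- After this rotation the vertex in question is last, and the neighbours `q 1`, `q 4` of `x` sit
  -- at positions `0` and `3`. Since `3` is neither `2` nor `ℓ - 2`, the hole is full.
  have hrot := hq.rotate (r := 1) (by omega)
  have hpat := hg.isCyclePattern H.family (by omega) hrot
  by_contra hcon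
  have h1 : G.Adj x (g (q 1)) := h _ (hq.ne (by omega) (by omega) (by omega)).symm
  have h4 : G.Adj x (g (q 4)) := h _ (hq.ne (by omega) (by omega) (by omega)).symm
  have := hpat.between_of_not_full (x := x) H.holed hℓ
    (fun k hk => H.ne_of_mem (hg.mem _)) (j := 3) (by omega) (by omega)
    (by simpa [show 1 < ℓ by omega] using h1) (by simpa [show 4 < ℓ by omega] using h4) (by
      intro h
      apply hcon
      have := h (ℓ - 1) (by omega)
      simpa [show ℓ - 1 + 1 = ℓ by omega] using this)
  omega

open Classical in
/-- If every vertex of `F` lies in a hole, then `x` is complete to the blow-up as soon as it is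
complete to a transversal. -/
theorem complete_of_transversal (H : IsAttachment F G ℓ X f x)
    (hcov : ∀ t, ∃ c, IsCyclePattern F ℓ c ∧ ∃ k < ℓ, c k = t) {g : T → V}
    (hg : IsTransversal F G X g) (h : ∀ t, G.Adj x (g t)) (t : T) (y : V) (hy : y ∈ X t) :
    G.Adj x y := by
  -- The passage to an arbitrary vertex goes through `f`: in `g` one vertex may be replaced by `f
  -- t`, and in `f` one vertex by any `y` of its bag, whereas `y` need not be adjacent to the
  -- vertices of `g`.
  have hf : ∀ t, G.Adj x (f t) := by
    intro t
    obtain ⟨c, hc, k, hk, rfl⟩ := hcov t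
    have hT := hg.update (t := c k) (H.first_mem _)
      fun s hs => (H.first_adj s _ hs _ (hg.mem s)).symm
    have := H.adj_of_adj_others hc hT hk fun s hs => by
      rw [Function.update_of_ne hs]; exact h s
    simpa using this
  obtain ⟨c, hc, k, hk, rfl⟩ := hcov t
  have hT := H.isTransversal.update hy fun s hs => H.first_adj _ s hs.symm _ hy
  have := H.adj_of_adj_others hc hT hk fun s hs => by
    rw [Function.update_of_ne hs]; exact hf s
  simpa using this

/-- Nonadjacent neighbours `y` and `z` of `x` in the two bags would give an `(ℓ + 1)`-hole: a copy
of a hole through the edge `m s` in which `y` represents `s` and the vertex representing `m` is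
replaced by the edge from `x` to `z`. -/
theorem isClique_of_meets_edge (H : IsAttachment F G ℓ X f x) {s m : T}
    (hsm : ∀ t, Meets G X x t → t = s ∨ t = m) (hadj : s = m ∨ F.Adj s m)
    (hcov : F.Adj m s → ∃ c, IsCyclePattern F ℓ c ∧ c 0 = m ∧ c 1 = s) :
    G.IsClique {y | G.Adj x y ∧ ∃ t, y ∈ X t} := by
  have hℓ := H.seven_le
  have key : F.Adj m s → ∀ y ∈ X s, G.Adj x y → ∀ z ∈ X m, G.Adj x z → G.Adj y z := by
    intro hms y hy hxy z hz hxz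
    obtain ⟨c, hc, rfl, rfl⟩ := hcov hms
    by_contra hyz
    have hF : F.Adj (c 0) (c (ℓ - 1)) := (hc 0 (ℓ - 1) (by omega) (by omega)).2 (by omega)
    have hF' : F.Adj (c (ℓ - 2)) (c (ℓ - 1)) :=
      (hc (ℓ - 2) (ℓ - 1) (by omega) (by omega)).2 (by omega)
    have hnm : ∀ k, 2 ≤ k → k < ℓ → ∀ w ∈ X (c k), ¬ G.Adj x w := by
      intro k h1 h2 w hw hxw
      rcases hsm _ ⟨w, hw, hxw⟩ with h | h
      · exact hc.ne (by omega) (show 1 < k by omega) h2 h.symm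
      · exact hc.ne (by omega) (show 0 < k by omega) h2 h.symm
    refine H.no_long_hole hc hy (H.first_mem _) (H.first_mem _)
      (H.first_adj _ _ hF' _ (H.first_mem _)) (H.first_adj _ _ hF z hz) ?_ (fun h => hyz h.symm) ?_
      hxz hxy (hnm _ (by omega) (by omega) _ (H.first_mem _))
      (hnm _ (by omega) (by omega) _ (H.first_mem _))
      (fun k h1 h2 => hnm _ h1 (by omega) _ (H.first_mem _))
    · exact H.not_adj (hc.ne (by omega) (by omega) (by omega))
        (by rw [hc _ _ (by omega) (by omega)]; omega) hz (H.first_mem _)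
    · intro k h1 h2
      exact H.not_adj (hc.ne (by omega) (by omega) (by omega))
        (by rw [hc _ _ (by omega) (by omega)]; omega) hz (H.first_mem _)
  rintro y ⟨hxy, t, hy⟩ z ⟨hxz, r, hz⟩ hne
  by_cases htr : t = r
  · subst htr
    exact H.family.clique t hy hz hne
  have ht := hsm t ⟨y, hy, hxy⟩
  have hr := hsm r ⟨z, hz, hxz⟩
  have hms : F.Adj m s := by
    rcases hadj with rfl | h
    · exact absurd ((or_self_iff.1 ht).trans (or_self_iff.1 hr).symm) htr
    · exact h.symm
  rcases ht with rfl | rfl <;> rcases hr with rfl | rfl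
  · exact absurd rfl htr
  · exact key hms y hy hxy z hz hxz
  · exact (key hms z hz hxz y hy hxy).symm
  · exact absurd rfl htr

/-- The neighbourhood of `x` extends from the bag of `r` to the bag of `r'`. -/
theorem complete_step (H : IsAttachment F G ℓ X f x) {m s r r' : T}
    (hsupp : ∀ t, Meets G X x t → t = m ∨ F.Adj m t) (hs : Meets G X x s) (hr : Meets G X x r)
    (hrr' : ∀ u ∈ X r, ∀ v ∈ X r', G.Adj u v)
    {c : ℕ → T} (hc : IsCyclePattern F ℓ c) (h0 : c 0 = m) (h1 : c 1 = s) (h2 : c (ℓ - 1) = r')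
    (hr0 : ∀ k, 1 ≤ k → k + 2 ≤ ℓ → r ≠ c k ∧ ¬ F.Adj r (c k)) : ∀ v ∈ X r', G.Adj x v := by
  have hℓ := H.seven_le
  intro v hv
  by_contra hxv
  subst h0 h1 h2
  obtain ⟨y, hy, hxy⟩ := hs
  obtain ⟨u, hu, hxu⟩ := hr
  have hF' : F.Adj (c (ℓ - 1)) (c (ℓ - 2)) :=
      ((hc (ℓ - 2) (ℓ - 1) (by omega) (by omega)).2 (by omega)).symm
  have hnm : ∀ k, 2 ≤ k → k + 2 ≤ ℓ → ∀ w ∈ X (c k), ¬ G.Adj x w := by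
    intro k h1 h2 w hw hxw
    rcases hsupp _ ⟨w, hw, hxw⟩ with h | h
    · exact hc.ne (by omega) (show 0 < k by omega) (by omega) h.symm
    · rw [hc 0 k (by omega) (by omega)] at h; omega
  have hnu : ∀ k, 1 ≤ k → k + 2 ≤ ℓ → ∀ w ∈ X (c k), ¬ G.Adj u w := by
    intro k h1 h2 w hw
    exact H.not_adj (hr0 k h1 h2).1 (hr0 k h1 h2).2 hu hw
  exact H.no_long_hole hc hy hv (H.first_mem _) (H.first_adj _ _ hF' v hv).symm (hrr' u hu v hv)
    (hnu _ (by omega) (by omega) _ (H.first_mem _)) (hnu 1 (by omega) (by omega) _ hy)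
    (fun k h3 h4 => hnu k (by omega) (by omega) _ (H.first_mem _)) hxu hxy hxv
    (hnm _ (by omega) (by omega) _ (H.first_mem _))
    (fun k h3 h4 => hnm k h3 (by omega) _ (H.first_mem _))

end IsAttachment

/-! ### Adding an outside vertex to a bag. -/

namespace IsAttachment

variable {T V : Type*} {F : SimpleGraph T} {G : SimpleGraph V} {ℓ : ℕ} {X : T → Set V}
  {f : T → V} {x : V}

/-- If `x` has neighbours in two bags at distance two, then `x` is complete to the bag between
them. -/
theorem complete_middle (H : IsAttachment F G ℓ X f x) {s m t : T} (hsm : F.Adj s m)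
    (hmt : F.Adj m t) (hst : s ≠ t) (hst' : ¬ F.Adj s t) (hs : Meets G X x s)
    (ht : Meets G X x t) : ∀ z ∈ X m, G.Adj x z := by
  intro z hz
  by_contra hxz
  -- On each side, `x` and `z` are joined through the bag by an induced path of length two or three.
  -- Two such paths through the nonadjacent bags of `s` and `t` form a hole of length at most six.
  have hnear : ∀ r, F.Adj r m → Meets G X x r → (∃ y ∈ X r, G.Adj x y ∧ G.Adj z y) ∨
      ∃ y ∈ X r, ∃ y' ∈ X r, G.Adj x y ∧ ¬ G.Adj z y ∧ ¬ G.Adj x y' ∧ G.Adj z y' ∧ G.Adj y y' := by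
    rintro r hr ⟨y, hy, hxy⟩
    by_cases hzy : G.Adj z y
    · exact Or.inl ⟨y, hy, hxy, hzy⟩
    · have hzf := H.first_adj m r hr.symm z hz
      by_cases hxf : G.Adj x (f r)
      · exact Or.inl ⟨f r, H.first_mem r, hxf, hzf⟩
      · refine Or.inr ⟨y, hy, f r, H.first_mem r, hxy, hzy, hxf, hzf,
          H.family.clique r hy (H.first_mem r) ?_⟩
        rintro rfl
        exact hzy hzf
  have hna : ∀ {y y'}, y ∈ X s → y' ∈ X t → ¬ G.Adj y y' := fun h h' => H.not_adj hst hst' h h'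
  have hnem : x ≠ z := (H.ne_of_mem hz).symm
  have hnest : ∀ {y y'}, y ∈ X s → y' ∈ X t → y ≠ y' := by
    rintro y _ h h' rfl
    exact (Set.disjoint_left.1 (H.family.disjoint s t hst)) h h'
  rcases hnear s hsm hs with ⟨y, hy, hxy, hzy⟩ | ⟨y, hy, y', hy', hxy, hzy, hxy', hzy', hyy'⟩ <;>
  rcases hnear t hmt.symm ht with ⟨w, hw, hxw, hzw⟩ | ⟨w, hw, w', hw', hxw, hzw, hxw', hzw', hww'⟩
  · exact H.holed.no_four H.seven_le hxy hzy.symm hzw hxw.symm hxz (hna hy hw) hnem (hnest hy hw)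
  · exact H.holed.no_five H.seven_le hxy hzy.symm hzw' hww'.symm hxw.symm hxz hxw' (hna hy hw')
      (hna hy hw) hzw
  · exact H.holed.no_five H.seven_le hxw hzw.symm hzy' hyy'.symm hxy.symm hxz hxy'
      (fun h => hna hy' hw h.symm) (fun h => hna hy hw h.symm) hzy
  · exact H.holed.no_six H.seven_le hxy hyy' hzy'.symm hzw' hww'.symm hxw.symm hxy' hxz hxw'
      (fun h => hzy h.symm) (hna hy hw') (hna hy hw) (hna hy' hw') (hna hy' hw) hzw

open Classical in
/-- A vertex which attaches to the blow-up like a vertex of the bag `X m` may be added to that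
bag. -/
theorem isBlowUpFamily_insert (H : IsAttachment F G ℓ X f x)
    (hP : ∀ s m t, F.Adj s m → F.Adj m t → s ≠ t → ¬ F.Adj s t →
      ∃ c, IsCyclePattern F ℓ c ∧ c 0 = m ∧ c 1 = t ∧ c (ℓ - 1) = s)
    (htri : ∀ s m t, F.Adj s m → F.Adj m t → F.Adj s t → 3 ≤ (F.neighborSet s).encard)
    {m : T} (hsupp : ∀ t, Meets G X x t → t = m ∨ F.Adj m t)
    (hmeets : ∀ t, F.Adj m t → Meets G X x t)
    (hnon : ∃ s t, F.Adj s m ∧ F.Adj m t ∧ s ≠ t ∧ ¬ F.Adj s t)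
    (hcompl : ∀ r, F.Adj m r → 3 ≤ (F.neighborSet m).encard → 3 ≤ (F.neighborSet r).encard →
      ∀ z ∈ X r, G.Adj x z) :
    IsBlowUpFamily F G (Function.update X m (insert x (X m))) := by
  have hℓ := H.seven_le
  have hX := H.family
  obtain ⟨s0, t0, hs0, ht0, hne0, hnadj0⟩ := hnon
  have hxm : ∀ z ∈ X m, G.Adj x z :=
    H.complete_middle hs0 ht0 hne0 hnadj0 (hmeets _ hs0.symm) (hmeets _ ht0)
  have hfar : ∀ t, t ≠ m → ¬ F.Adj m t → ∀ y ∈ X t, ¬ G.Adj x y := by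
    intro t h1 h2 y hy hxy
    exact (hsupp t ⟨y, hy, hxy⟩).elim h1 h2
  have Xm : Function.update X m (insert x (X m)) m = insert x (X m) := by simp
  have Xo : ∀ t, t ≠ m → Function.update X m (insert x (X m)) t = X t := fun t ht => by simp [ht]
  have hcyc : ∀ s t, F.Adj m s → F.Adj s t → t ≠ m → ¬ F.Adj m t →
      ∃ c, IsCyclePattern F ℓ c ∧ c 0 = m ∧ c (ℓ - 1) = s ∧ c (ℓ - 2) = t := by
    intro s t hms hst htm hmt
    obtain ⟨c, hc, h0, h1, h2⟩ := hP m s t hms hst htm.symm hmt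
    -- `hP` centres the hole at `s`; reversal and a shift by one centre it at `m`, with `s` and `t`
    -- in the last two positions.
    refine ⟨_, (hc.reverse).rotate (r := 1) (by omega), ?_, ?_, ?_⟩
    · simp [show 1 < ℓ by omega, h2]
    · simp [show ℓ - 1 + 1 = ℓ by omega, h0]
    · simp [show ℓ - 2 + 1 < ℓ by omega, show ℓ - (ℓ - 2 + 1) = 1 by omega, h1]
  -- a vertex of a neighbouring bag which is adjacent to `x` dominates those which are not
  have hdom : ∀ s, F.Adj m s → ∀ y ∈ X s, ∀ y' ∈ X s, G.Adj x y → ¬ G.Adj x y' →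
      ∀ r, F.Adj s r → ∀ z ∈ X r, G.Adj y' z → G.Adj y z := by
    intro s hms y hy y' hy' hxy hxy' r hsr z hz hy'z
    by_contra hyz
    have hyy' : y ≠ y' := by rintro rfl; exact hxy' hxy
    have hadj : G.Adj y y' := hX.clique s hy hy' hyy'
    -- For `r = m` there is a four-hole. If `r` is another neighbour of `m`, then `m`, `s`, `r` form
    -- a triangle, whose vertices have degree at least three, so the bags are completely joined.
    -- Otherwise `x`–`y` replaces `m` in a hole through `m`, `s`, `r`.
    by_cases hrm : r = m
    · subst hrm
      exact H.holed.no_four hℓ hxy hadj hy'z (hxm z hz).symm hxy' hyz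
        (H.ne_of_mem hy').symm (by
          rintro rfl; exact Set.disjoint_left.1 (hX.disjoint _ _ hms.ne) hz hy)
    · by_cases hmr : F.Adj m r
      · exact hyz (hX.complete s r hsr (htri s m r hms.symm hmr hsr)
          (htri r m s hmr.symm hms hsr.symm) y hy z hz)
      · obtain ⟨c, hc, rfl, rfl, rfl⟩ := hcyc s r hms hsr hrm hmr
        have h1 : F.Adj (c 0) (c 1) := (hc 0 1 (by omega) (by omega)).2 (by omega)
        obtain ⟨y1, hy1, hxy1⟩ := hmeets _ h1
        have hn1 : ∀ k, 1 ≤ k → k + 3 ≤ ℓ → ∀ w ∈ X (c k), ¬ G.Adj y w := by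
          intro k h1 h2 w hw
          exact H.not_adj (hc.ne (by omega) (show k < ℓ - 1 by omega) (by omega)).symm
            (by rw [F.adj_comm, hc _ _ (by omega) (by omega)]; omega) hy hw
        have hn2 : ∀ k, 2 ≤ k → k + 2 ≤ ℓ → ∀ w ∈ X (c k), ¬ G.Adj x w := by
          intro k h1 h2
          exact hfar _ (hc.ne (by omega) (by omega) (by omega)).symm
            (by rw [hc _ _ (by omega) (by omega)]; omega)
        exact H.no_long_hole hc hy1 hy' hz hy'z.symm hadj hyz
          (hn1 1 (by omega) (by omega) _ hy1)
          (fun k h1 h2 => hn1 k (by omega) h2 _ (H.first_mem _)) hxy hxy1 hxy'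
          (hn2 _ (by omega) (by omega) _ hz)
          (fun k h1 h2 => hn2 k h1 (by omega) _ (H.first_mem _))
  -- If `x` and `z` each have a private neighbour, either the two private neighbours are in one bag
  -- and give a four-hole, or their bags are joined completely, or the edge from `x` to `z`
  -- lengthens a hole.
  have hcompare : ∀ z ∈ X m, (∀ s, F.Adj m s → ∀ y ∈ X s, G.Adj x y → G.Adj z y) ∨
      (∀ s, F.Adj m s → ∀ y ∈ X s, G.Adj z y → G.Adj x y) := by
    intro z hz
    by_contra hcon
    push Not at hcon
    obtain ⟨⟨s, hms, y, hy, hxy, hzy⟩, t, hmt, q, hq, hzq, hxq⟩ := hcon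
    by_cases hst : s = t
    · subst hst
      have hyq : y ≠ q := by rintro rfl; exact hxq hxy
      exact H.holed.no_four hℓ hxy (hX.clique s hy hq hyq) hzq.symm (hxm z hz).symm hxq
        (fun h => hzy h.symm) (H.ne_of_mem hq).symm (by
          rintro rfl; exact Set.disjoint_left.1 (hX.disjoint _ _ hms.ne) hz hy)
    by_cases hadj : F.Adj s t
    · exact hzy (hX.complete m s hms (htri m s t hms hadj hmt) (htri s m t hms.symm hmt hadj)
        z hz y hy)
    obtain ⟨c, hc, rfl, rfl, rfl⟩ := hP t m s hmt.symm hms (Ne.symm hst) fun h => hadj h.symm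
    have hF : F.Adj (c (ℓ - 2)) (c (ℓ - 1)) := (hc _ _ (by omega) (by omega)).2 (by omega)
    have hn1 : ∀ k, 2 ≤ k → k + 2 ≤ ℓ → ∀ w ∈ X (c k), ¬ G.Adj z w := by
      intro k h1 h2 w hw
      exact H.not_adj (hc.ne (by omega) (show 0 < k by omega) (by omega))
        (by rw [hc _ _ (by omega) (by omega)]; omega) hz hw
    have hn2 : ∀ k, 2 ≤ k → k + 2 ≤ ℓ → ∀ w ∈ X (c k), ¬ G.Adj x w := by
      intro k h1 h2
      exact hfar _ (hc.ne (by omega) (by omega) (by omega)).symm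
        (by rw [hc _ _ (by omega) (by omega)]; omega)
    exact H.no_long_hole hc hy hq (H.first_mem _) (H.first_adj _ _ hF.symm _ hq).symm hzq
      (hn1 _ (by omega) (by omega) _ (H.first_mem _)) hzy
      (fun k h1 h2 => hn1 k h1 (by omega) _ (H.first_mem _)) (hxm z hz) hxy hxq
      (hn2 _ (by omega) (by omega) _ (H.first_mem _))
      (fun k h1 h2 => hn2 k h1 (by omega) _ (H.first_mem _))
  refine ⟨?_, ?_, ?_, ?_, ?_, ?_, ?_⟩
  · intro t
    by_cases ht : t = m
    · subst ht; rw [Xm]; exact Set.insert_nonempty _ _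
    · rw [Xo t ht]; exact hX.nonempty t
  · intro t
    by_cases ht : t = m
    · subst ht; rw [Xm]
      exact SimpleGraph.isClique_insert.2 ⟨hX.clique t, fun b hb _ => hxm b hb⟩
    · rw [Xo t ht]; exact hX.clique t
  · intro s t hst
    by_cases hs : s = m
    · subst hs
      rw [Xm, Xo t hst.symm]
      exact Set.disjoint_insert_left.2 ⟨H.notMem t, hX.disjoint s t hst⟩
    · rw [Xo s hs]
      by_cases ht : t = m
      · subst ht; rw [Xm]
        exact Set.disjoint_insert_right.2 ⟨H.notMem s, hX.disjoint s t hst⟩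
      · rw [Xo t ht]; exact hX.disjoint s t hst
  · intro s t hst hadj y hy z hz
    by_cases hs : s = m
    · subst hs
      rw [Xm] at hy
      rw [Xo t hst.symm] at hz
      rcases hy with rfl | hy
      · exact hfar t hst.symm hadj z hz
      · exact hX.anticomplete s t hst hadj y hy z hz
    · rw [Xo s hs] at hy
      by_cases ht : t = m
      · subst ht
        rw [Xm] at hz
        rcases hz with rfl | hz
        · exact fun h => hfar s hst (fun h => hadj h.symm) y hy h.symm
        · exact hX.anticomplete s t hst hadj y hy z hz
      · rw [Xo t ht] at hz
        exact hX.anticomplete s t hst hadj y hy z hz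
  · intro s t hadj y hy
    by_cases hs : s = m
    · subst hs
      rw [Xm] at hy
      rw [Xo t hadj.ne']
      rcases hy with rfl | hy
      · exact hmeets t hadj
      · exact hX.posDegree s t hadj y hy
    · rw [Xo s hs] at hy
      obtain ⟨z, hz, hyz⟩ := hX.posDegree s t hadj y hy
      refine ⟨z, ?_, hyz⟩
      by_cases ht : t = m
      · subst ht; rw [Xm]; exact Or.inr hz
      · rwa [Xo t ht]
  · intro s t hadj h3 h3' y hy z hz
    by_cases hs : s = m
    · subst hs
      rw [Xm] at hy
      rw [Xo t hadj.ne'] at hz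
      rcases hy with rfl | hy
      · exact hcompl t hadj h3 h3' z hz
      · exact hX.complete s t hadj h3 h3' y hy z hz
    · rw [Xo s hs] at hy
      by_cases ht : t = m
      · subst ht
        rw [Xm] at hz
        rcases hz with rfl | hz
        · exact (hcompl s hadj.symm h3' h3 y hy).symm
        · exact hX.complete s t hadj h3 h3' y hy z hz
      · rw [Xo t ht] at hz
        exact hX.complete s t hadj h3 h3' y hy z hz
  · intro t y hy y' hy'
    by_cases ht : t = m
    · subst ht
      have hXs : ∀ s, F.Adj t s → Function.update X t (insert x (X t)) s = X s :=
        fun s hs => Xo s hs.ne'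
      rw [Xm] at hy hy'
      have hgoal : (∀ s, F.Adj t s → ∀ z ∈ X s, G.Adj y z → G.Adj y' z) ∨
          (∀ s, F.Adj t s → ∀ z ∈ X s, G.Adj y' z → G.Adj y z) := by
        rcases hy with rfl | hy <;> rcases hy' with rfl | hy'
        · exact Or.inl fun _ _ _ _ h => h
        · exact hcompare y' hy'
        · exact (hcompare y hy).symm
        · exact hX.nested t y hy y' hy'
      exact hgoal.imp (fun h s hs z hz => h s hs z (hXs s hs ▸ hz))
        (fun h s hs z hz => h s hs z (hXs s hs ▸ hz))
    · rw [Xo t ht] at hy hy'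
      have hlift : ∀ w ∈ X t, ∀ w' ∈ X t, (∀ s, F.Adj t s → ∀ z ∈ X s, G.Adj w z → G.Adj w' z) →
          (F.Adj m t → G.Adj x w → G.Adj x w') → ∀ s, F.Adj t s →
          ∀ z ∈ Function.update X m (insert x (X m)) s, G.Adj w z → G.Adj w' z := by
        intro w hw w' hw' h1 h2 s hs z hz hwz
        by_cases hsm : s = m
        · subst hsm
          rw [Xm] at hz
          rcases hz with rfl | hz
          · exact (h2 hs.symm hwz.symm).symm
          · exact h1 s hs z hz hwz
        · rw [Xo s hsm] at hz
          exact h1 s hs z hz hwz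
      by_cases h1 : F.Adj m t ∧ G.Adj x y ∧ ¬ G.Adj x y'
      · exact Or.inr (hlift y' hy' y hy (hdom t h1.1 y hy y' hy' h1.2.1 h1.2.2)
          fun _ _ => h1.2.1)
      by_cases h2 : F.Adj m t ∧ G.Adj x y' ∧ ¬ G.Adj x y
      · exact Or.inl (hlift y hy y' hy' (hdom t h2.1 y' hy' y hy h2.2.1 h2.2.2)
          fun _ _ => h2.2.1)
      · rcases hX.nested t y hy y' hy' with h | h
        · exact Or.inl (hlift y hy y' hy' h fun h3 h4 => by tauto)
        · exact Or.inr (hlift y' hy' y hy h fun h3 h4 => by tauto)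

end IsAttachment

/-! ### Passing between ordered bags and nested families. -/

section OrderedBags

variable {T V : Type*} {F : SimpleGraph T} {G : SimpleGraph V} {W : T → List V}

theorem IsBlowUp.adj_of_le (h : IsBlowUp F G W) {s t : T} (hst : F.Adj s t)
    {i j : Fin (W s).length} (hij : i ≤ j) {z : V} (hz : z ∈ W t)
    (hadj : G.Adj ((W s).get j) z) : G.Adj ((W s).get i) z := by
  obtain ⟨k, rfl⟩ := List.get_of_mem hz
  exact h.obeys s t hst i j k k hij le_rfl hadj

theorem IsBlowUp.isBlowUpFamily (h : IsBlowUp F G W) :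
    IsBlowUpFamily F G (fun t => {y | y ∈ W t}) where
  nonempty t := List.exists_mem_of_ne_nil _ (h.nonnull t)
  clique := h.clique
  disjoint s t hst := Set.disjoint_left.2 fun _ hy hy' => h.disjoint s t hst hy hy'
  anticomplete := h.anticomplete
  posDegree := h.posDegree
  complete := h.complete
  nested t y hy y' hy' := by
    obtain ⟨i, rfl⟩ := List.get_of_mem (show y ∈ W t from hy)
    obtain ⟨j, rfl⟩ := List.get_of_mem (show y' ∈ W t from hy')
    rcases le_total i j with hij | hij
    · exact Or.inr fun s hs z hz => h.adj_of_le hs hij hz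
    · exact Or.inl fun s hs z hz => h.adj_of_le hs hij hz

/-- Positive degree supplies some neighbour in each adjacent bag, and obeying the orderings moves
this neighbour to the first position. -/
theorem IsBlowUp.exists_first (h : IsBlowUp F G W) :
    ∃ f : T → V, (∀ t, f t ∈ W t) ∧ ∀ s t, F.Adj s t → ∀ z ∈ W s, G.Adj z (f t) := by
  have hpos : ∀ t, 0 < (W t).length := fun t => List.length_pos_iff.2 (h.nonnull t)
  refine ⟨fun t => (W t).get ⟨0, hpos t⟩, fun t => List.get_mem _ _, fun s t hst z hz => ?_⟩
  obtain ⟨y, hy, hzy⟩ := h.posDegree s t hst z hz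
  obtain ⟨j, rfl⟩ := List.get_of_mem hy
  exact (h.adj_of_le hst.symm (Fin.mk_le_of_le_val (Nat.zero_le _)) hz hzy.symm).symm

open Classical in
/-- The bags of a blow-up may be ordered if the neighbourhoods of their vertices are nested. -/
theorem IsBlowUpFamily.exists_isBlowUp [Finite V] {X : T → Set V} (h : IsBlowUpFamily F G X) :
    ∃ W : T → List V, IsBlowUp F G W ∧ ∀ t y, y ∈ W t ↔ y ∈ X t := by
  -- The neighbours in all adjacent bags are collected in one set, so that a single ordering of a
  -- bag serves all its neighbours. These sets form a chain, so sorting by decreasing cardinality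
  -- sorts by inclusion.
  have hnb : ∀ t, ∃ d : V → Set V, ∀ y z, z ∈ d y ↔ ∃ s, F.Adj t s ∧ z ∈ X s ∧ G.Adj y z :=
    fun t => ⟨fun y => {z | ∃ s, F.Adj t s ∧ z ∈ X s ∧ G.Adj y z}, fun _ _ => Iff.rfl⟩
  choose d hd using hnb
  have hmono : ∀ t, ∀ y ∈ X t, ∀ y' ∈ X t, (d t y').ncard ≤ (d t y).ncard →
      d t y' ⊆ d t y := by
    intro t y hy y' hy' hle
    rcases h.nested t y hy y' hy' with h1 | h1
    · have hsub : d t y ⊆ d t y' := by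
        intro z hz
        obtain ⟨s, hs, hzs, hyz⟩ := (hd t y z).1 hz
        exact (hd t y' z).2 ⟨s, hs, hzs, h1 s hs z hzs hyz⟩
      exact (Set.eq_of_subset_of_ncard_le hsub hle (Set.toFinite _)).ge
    · intro z hz
      obtain ⟨s, hs, hzs, hyz⟩ := (hd t y' z).1 hz
      exact (hd t y z).2 ⟨s, hs, hzs, h1 s hs z hzs hyz⟩
  have hlist : ∀ t, ∃ L : List V, L.Nodup ∧ (∀ y, y ∈ L ↔ y ∈ X t) ∧
      L.Pairwise fun y y' => (d t y').ncard ≤ (d t y).ncard := by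
    intro t
    let r : V → V → Prop := fun y y' => (d t y').ncard ≤ (d t y).ncard
    have : Std.Total r := ⟨fun a b => le_total _ _⟩
    have : IsTrans V r := ⟨fun a b c h1 h2 => le_trans h2 h1⟩
    refine ⟨(Set.toFinite (X t)).toFinset.toList.insertionSort r, ?_, fun y => ?_, ?_⟩
    · exact (List.perm_insertionSort r _).nodup_iff.2 (Finset.nodup_toList _)
    · rw [(List.perm_insertionSort r _).mem_iff]; simp
    · exact List.pairwise_insertionSort r _
  choose W hnodup hmem hsort using hlist
  have hobey : ∀ s t, F.Adj s t → ∀ i i' : Fin (W s).length, i ≤ i' → ∀ z ∈ W t,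
      G.Adj ((W s).get i') z → G.Adj ((W s).get i) z := by
    intro s t hst i i' hii z hz hadj
    have hle : (d s ((W s).get i')).ncard ≤ (d s ((W s).get i)).ncard := by
      rcases hii.lt_or_eq with hlt | rfl
      · exact List.pairwise_iff_get.1 (hsort s) i i' hlt
      · exact le_rfl
    have hX : ∀ i, (W s).get i ∈ X s := fun i => (hmem s _).1 (List.get_mem _ _)
    obtain ⟨r, hr, hzr, hz'⟩ := (hd s _ z).1 (hmono s _ (hX i) _ (hX i') hle
      ((hd s _ z).2 ⟨t, hst, (hmem t z).1 hz, hadj⟩))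
    exact hz'
  have hset : ∀ t, {y | y ∈ W t} = X t := fun t => Set.ext (hmem t)
  refine ⟨W, ⟨?_, hnodup, ?_, ?_, ?_, ?_, ?_, ?_, ?_⟩, hmem⟩
  · intro t ht
    obtain ⟨y, hy⟩ := h.nonempty t
    rw [← hmem, ht] at hy
    exact absurd hy List.not_mem_nil
  · intro t; rw [hset]; exact h.clique t
  · intro s t hst y hy hy'
    exact Set.disjoint_left.1 (h.disjoint s t hst) ((hmem s y).1 hy) ((hmem t y).1 hy')
  · intro s t hst hadj y hy z hz
    exact h.anticomplete s t hst hadj y ((hmem s y).1 hy) z ((hmem t z).1 hz)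
  · intro s t hst y hy y' hy' z hz z' hz' hyz hy'z'
    rw [hset] at hy hy' hz hz'
    rcases h.nested s y hy y' hy' with h1 | h1
    · exact Or.inr (h1 t hst z hz hyz)
    · exact Or.inl (h1 t hst z' hz' hy'z')
  · intro s t hst i i' j j' hii hjj hadj
    refine hobey s t hst i i' hii _ (List.get_mem _ _) ?_
    -- The two indices are lowered one after the other, each by the ordering of its own bag.
    exact (hobey t s hst.symm j j' hjj _ (List.get_mem _ _) hadj.symm).symm
  · intro s t hst y hy
    obtain ⟨z, hz, hyz⟩ := h.posDegree s t hst y ((hmem s y).1 hy)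
    exact ⟨z, (hmem t z).2 hz, hyz⟩
  · intro s t hst h3 h3' y hy z hz
    exact h.complete s t hst h3 h3' y ((hmem s y).1 hy) z ((hmem t z).1 hz)

open Classical in
theorem IsMaximalBlowUp.not_isBlowUpFamily_insert [Finite V] (h : IsMaximalBlowUp F G W) {x : V}
    (hx : x ∉ bagUnion W Set.univ) (m : T) :
    ¬ IsBlowUpFamily F G (Function.update (fun t => {y | y ∈ W t}) m
      (insert x {y | y ∈ W m})) := by
  intro hX
  obtain ⟨W', hW', hmem⟩ := hX.exists_isBlowUp
  refine h.2 W' hW' ⟨?_, fun hsub => hx (hsub ⟨m, trivial, (hmem m x).2 (by simp)⟩)⟩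
  rintro y ⟨t, -, hy⟩
  refine ⟨t, trivial, (hmem t y).2 ?_⟩
  by_cases ht : t = m
  · subst ht; simpa using Or.inr hy
  · simpa [ht] using hy

end OrderedBags

/-! ### A presentation of frames that is symmetric in the two sides and uniform in the parity of
`ℓ`. -/

/-- The properties of an apexed `ℓ`-frame `F` with `k` bars which matter for the holes of `F`. The
vertices of the `i`-th bar are `p i 0, …, p i (len i)`; the apexes `α` and `β` exist if `hasA` and
`hasB` hold. -/
structure FramePresentation {T : Type*} (F : SimpleGraph T) (k ℓ : ℕ) where
  len : Fin k → ℕ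
  p : Fin k → ℕ → T
  A : SimpleGraph (Fin k)
  B : SimpleGraph (Fin k)
  hasA : Prop
  hasB : Prop
  α : T
  β : T
  three_le : 3 ≤ k
  seven_le : 7 ≤ ℓ
  two_le_len : ∀ i, 2 ≤ len i
  cover : ∀ t, (∃ i c, c ≤ len i ∧ t = p i c) ∨ (hasA ∧ t = α) ∨ (hasB ∧ t = β)
  p_inj : ∀ {i j c d}, c ≤ len i → d ≤ len j → p i c = p j d → i = j ∧ c = d
  p_ne_α : hasA → ∀ i c, c ≤ len i → p i c ≠ α
  p_ne_β : hasB → ∀ i c, c ≤ len i → p i c ≠ β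
  α_ne_β : hasA → hasB → α ≠ β
  adj_p : ∀ {i j c d}, c ≤ len i → d ≤ len j → (F.Adj (p i c) (p j d) ↔
    (i = j ∧ (d = c + 1 ∨ c = d + 1)) ∨ (c = 0 ∧ d = 0 ∧ A.Adj i j) ∨
      (c = len i ∧ d = len j ∧ B.Adj i j))
  adj_α : hasA → ∀ {i c}, c ≤ len i → (F.Adj α (p i c) ↔ c = 0)
  adj_β : hasB → ∀ {i c}, c ≤ len i → (F.Adj β (p i c) ↔ c = len i)
  not_adj_αβ : hasA → hasB → ¬ F.Adj α β
  -- The ring through two bars has all vertices of both bars, and one link vertex at each side where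
  -- their ends are nonadjacent; `u` and `v` count these links.
  length : ∀ i j, i ≠ j → ∀ u v : ℕ, (A.Adj i j ∧ u = 0) ∨ (¬ A.Adj i j ∧ u = 1) →
    (B.Adj i j ∧ v = 0) ∨ (¬ B.Adj i j ∧ v = 1) → len i + len j + 2 + u + v = ℓ
  domA : ¬ hasA → ∀ i, ∃ d, d ≠ i ∧ ∀ h, h ≠ d → A.Adj d h
  domB : ¬ hasB → ∀ i, ∃ d, d ≠ i ∧ ∀ h, h ≠ d → B.Adj d h
  isoA : hasA → ∃ e, ∀ h, ¬ A.Adj e h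
  isoB : hasB → ∃ e, ∀ h, ¬ B.Adj e h
  hasA_or_hasB : hasA ∨ hasB
  both : hasA → hasB → ∃ i j, i ≠ j ∧ ¬ A.Adj i j ∧ ¬ B.Adj i j
  -- On a bar of length two the two ends have a common neighbour and so are not far; such a bar is
  -- handled through a side where another bar is not adjacent to it.
  short : ∀ i, 3 ≤ len i ∨ ∀ h, h ≠ i → ¬ A.Adj i h ∨ ¬ B.Adj i h

namespace FramePresentation

variable {T : Type*} {F : SimpleGraph T} {k ℓ : ℕ}

/-- The presentation of the same frame with the two sides exchanged. -/
def swap (P : FramePresentation F k ℓ) : FramePresentation F k ℓ where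
  len := P.len
  p i c := P.p i (P.len i - c)
  A := P.B
  B := P.A
  hasA := P.hasB
  hasB := P.hasA
  α := P.β
  β := P.α
  three_le := P.three_le
  seven_le := P.seven_le
  two_le_len := P.two_le_len
  cover t := by
    rcases P.cover t with ⟨i, c, hc, rfl⟩ | h | h
    · exact Or.inl ⟨i, P.len i - c, by omega, by congr 1; omega⟩
    · exact Or.inr (Or.inr h)
    · exact Or.inr (Or.inl h)
  p_inj {i j c d} hc hd h := by
    obtain ⟨rfl, h'⟩ := P.p_inj (by omega) (by omega) h
    exact ⟨rfl, by omega⟩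
  p_ne_α h i c _ := P.p_ne_β h i _ (by omega)
  p_ne_β h i c _ := P.p_ne_α h i _ (by omega)
  α_ne_β h h' := (P.α_ne_β h' h).symm
  adj_p {i j c d} hc hd := by
    rw [P.adj_p (by omega) (by omega)]
    constructor
    · rintro (⟨rfl, h⟩ | ⟨h1, h2, h3⟩ | ⟨h1, h2, h3⟩)
      · exact Or.inl ⟨rfl, by omega⟩
      · exact Or.inr (Or.inr ⟨by omega, by omega, h3⟩)
      · exact Or.inr (Or.inl ⟨by omega, by omega, h3⟩)
    · rintro (⟨rfl, h⟩ | ⟨h1, h2, h3⟩ | ⟨h1, h2, h3⟩)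
      · exact Or.inl ⟨rfl, by omega⟩
      · exact Or.inr (Or.inr ⟨by omega, by omega, h3⟩)
      · exact Or.inr (Or.inl ⟨by omega, by omega, h3⟩)
  adj_α h {i c} hc := by rw [P.adj_β h (by omega)]; omega
  adj_β h {i c} hc := by rw [P.adj_α h (by omega)]; omega
  not_adj_αβ h h' := fun h'' => P.not_adj_αβ h' h h''.symm
  length i j hij u v hu hv := by
    have := P.length i j hij v u hv hu
    omega
  domA := P.domB
  domB := P.domA
  isoA := P.isoB
  isoB := P.isoA
  hasA_or_hasB := P.hasA_or_hasB.symm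
  both h h' := by
    obtain ⟨i, j, h1, h2, h3⟩ := P.both h' h
    exact ⟨i, j, h1, h3, h2⟩
  short i := (P.short i).imp_right fun h j hj => (h j hj).symm

/-- The vertices of the side `A⁺`. -/
def sideA (P : FramePresentation F k ℓ) : Set T := {t | (∃ i, t = P.p i 0) ∨ (P.hasA ∧ t = P.α)}

/-- The vertices of the side `B⁺`. -/
def sideB (P : FramePresentation F k ℓ) : Set T :=
  {t | (∃ i, t = P.p i (P.len i)) ∨ (P.hasB ∧ t = P.β)}

variable (P : FramePresentation F k ℓ)

theorem swap_sideA : P.swap.sideA = P.sideB := rfl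

theorem swap_p_sub {i : Fin k} {c : ℕ} (hc : c ≤ P.len i) :
    P.swap.p i (P.len i - c) = P.p i c := by
  change P.p i (P.len i - (P.len i - c)) = _
  congr 1; omega

theorem p_zero_mem (i : Fin k) : P.p i 0 ∈ P.sideA := Or.inl ⟨i, rfl⟩

theorem p_len_mem (i : Fin k) : P.p i (P.len i) ∈ P.sideB := Or.inl ⟨i, rfl⟩

variable {P}

theorem adj_zero {i j : Fin k} : F.Adj (P.p i 0) (P.p j 0) ↔ P.A.Adj i j := by
  have := P.two_le_len i
  rw [P.adj_p (by omega) (by omega)]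
  refine ⟨fun h => ?_, fun h => Or.inr (Or.inl ⟨rfl, rfl, h⟩)⟩
  rcases h with ⟨_, h⟩ | ⟨_, _, h⟩ | ⟨h, _⟩
  · omega
  · exact h
  · omega

theorem eq_of_adj_sideA {u : T} (hu : u ∈ P.sideA) {i : Fin k} {c : ℕ} (hc : c ≤ P.len i)
    (h : F.Adj u (P.p i c)) : c = 0 ∨ (c = 1 ∧ u = P.p i 0) := by
  rcases hu with ⟨j, rfl⟩ | ⟨hA, rfl⟩
  · have := P.two_le_len j
    rcases (P.adj_p (by omega) hc).1 h with ⟨rfl, h⟩ | ⟨_, h, _⟩ | ⟨h, _⟩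
    · exact Or.inr ⟨by omega, rfl⟩
    · exact Or.inl h
    · omega
  · exact Or.inl ((P.adj_α hA hc).1 h)

theorem eq_of_adj_sideB {u : T} (hu : u ∈ P.sideB) {i : Fin k} {c : ℕ} (hc : c ≤ P.len i)
    (h : F.Adj u (P.p i c)) : c = P.len i ∨ (c + 1 = P.len i ∧ u = P.p i (P.len i)) := by
  rw [← P.swap_p_sub hc] at h
  rcases P.swap.eq_of_adj_sideA (c := P.len i - c) (by rwa [swap_sideA]) (Nat.sub_le _ _) h with h | ⟨h, h'⟩
  · exact Or.inl (by omega)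
  · exact Or.inr ⟨by omega, h'⟩

theorem ne_of_sides {u v : T} (hu : u ∈ P.sideA) (hv : v ∈ P.sideB) : u ≠ v := by
  rintro rfl
  rcases hu with ⟨i, rfl⟩ | ⟨hA, rfl⟩ <;> rcases hv with ⟨j, h⟩ | ⟨hB, h⟩
  · have := P.two_le_len j
    have := P.p_inj (by omega) (by omega) h
    omega
  · exact P.p_ne_β hB i 0 (by omega) h
  · exact P.p_ne_α hA j _ le_rfl h.symm
  · exact P.α_ne_β hA hB h

theorem not_adj_sides {u v : T} (hu : u ∈ P.sideA) (hv : v ∈ P.sideB) : ¬ F.Adj u v := by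
  intro h
  rcases hv with ⟨j, rfl⟩ | ⟨hB, rfl⟩
  · have := P.two_le_len j
    have := P.eq_of_adj_sideA hu le_rfl h
    omega
  · rcases hu with ⟨i, rfl⟩ | ⟨hA, rfl⟩
    · have := P.two_le_len i
      have := (P.adj_β hB (Nat.zero_le _)).1 h.symm
      omega
    · exact P.not_adj_αβ hA hB h

/-- The sides meet only through the bars, and each bar has an interior vertex, so only a bar of
length two brings them to distance two. All far pairs used later come from this. -/
theorem eq_of_common_neighbor {u v m : T} (hu : u ∈ P.sideA) (hv : v ∈ P.sideB) (hum : F.Adj u m)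
    (hmv : F.Adj m v) : ∃ i, P.len i = 2 ∧ u = P.p i 0 ∧ v = P.p i (P.len i) ∧ m = P.p i 1 := by
  rcases P.cover m with ⟨i, c, hc, rfl⟩ | ⟨hA, rfl⟩ | ⟨hB, rfl⟩
  · have := P.two_le_len i
    rcases P.eq_of_adj_sideA hu hc hum with h | ⟨h, h'⟩ <;>
    rcases P.eq_of_adj_sideB hv hc hmv.symm with h2 | ⟨h2, h2'⟩
    · omega
    · omega
    · omega
    · subst h; exact ⟨i, by omega, h', h2', rfl⟩
  · exact absurd hmv (P.not_adj_sides (Or.inr ⟨hA, rfl⟩) hv)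
  · exact absurd hum (P.not_adj_sides hu (Or.inr ⟨hB, rfl⟩))

/-- Nonadjacent distinct vertices without a common neighbour. -/
def IsFar (F : SimpleGraph T) (s t : T) : Prop :=
  s ≠ t ∧ ¬ F.Adj s t ∧ ∀ m, F.Adj s m → ¬ F.Adj m t

theorem isFar_sides {u v : T} (hu : u ∈ P.sideA) (hv : v ∈ P.sideB)
    (h : ∀ i, P.len i = 2 → u = P.p i 0 → v ≠ P.p i (P.len i)) : IsFar F u v := by
  refine ⟨P.ne_of_sides hu hv, P.not_adj_sides hu hv, fun m h1 h2 => ?_⟩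
  obtain ⟨i, h3, h4, h5, -⟩ := P.eq_of_common_neighbor hu hv h1 h2
  exact h i h3 h4 h5

theorem isFar_of_ne {u : T} (hu : u ∈ P.sideA) {j : Fin k} (h : u ≠ P.p j 0) :
    IsFar F u (P.p j (P.len j)) := by
  refine P.isFar_sides hu (P.p_len_mem j) fun i h1 h2 h3 => ?_
  obtain ⟨rfl, -⟩ := P.p_inj le_rfl le_rfl h3
  exact h h2

theorem isFar_of_three_le {i : Fin k} (h : 3 ≤ P.len i) :
    IsFar F (P.p i 0) (P.p i (P.len i)) := by
  refine P.isFar_sides (P.p_zero_mem i) (P.p_len_mem i) fun j h1 h2 h3 => ?_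
  obtain ⟨rfl, -⟩ := P.p_inj le_rfl le_rfl h3
  omega

/-- The vertex `u` of `A⁺` links the ends `p i 0` and `p j 0` of two bars. -/
structure IsLinkA (P : FramePresentation F k ℓ) (i j : Fin k) (u : T) : Prop where
  mem : u ∈ P.sideA
  left : F.Adj u (P.p i 0)
  right : F.Adj u (P.p j 0)

theorem IsLinkA.adj_left {i j : Fin k} {u : T} (h : P.IsLinkA i j u) {c : ℕ} (hc : c ≤ P.len i) :
    F.Adj u (P.p i c) ↔ c = 0 := by
  refine ⟨fun h' => ?_, fun h' => h' ▸ h.left⟩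
  rcases P.eq_of_adj_sideA h.mem hc h' with h1 | ⟨_, h1⟩
  · exact h1
  · exact absurd h1 h.left.ne

theorem IsLinkA.symm {i j : Fin k} {u : T} (h : P.IsLinkA i j u) : P.IsLinkA j i u :=
  ⟨h.mem, h.right, h.left⟩

theorem isLinkA_α (hA : P.hasA) (i j : Fin k) : P.IsLinkA i j P.α :=
  ⟨Or.inr ⟨hA, rfl⟩, (P.adj_α hA (Nat.zero_le _)).2 rfl, (P.adj_α hA (Nat.zero_le _)).2 rfl⟩

/-- The link is the apex if there is one, and otherwise a dominating vertex of `A` other than `i`.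
-/
theorem exists_isLinkA {i j : Fin k} (h : ¬ P.A.Adj i j) : ∃ u, P.IsLinkA i j u := by
  by_cases hA : P.hasA
  · exact ⟨P.α, isLinkA_α hA i j⟩
  · obtain ⟨d, hdi, hd⟩ := P.domA hA i
    have hdj : d ≠ j := fun e => h (e ▸ hd i hdi.symm).symm
    exact ⟨P.p d 0, P.p_zero_mem d, adj_zero.2 (hd i hdi.symm), adj_zero.2 (hd j hdj.symm)⟩

/-- The hole through two bars, with given links. -/
theorem exists_ring {i j : Fin k} (hij : i ≠ j) {u v : T} (hu : ¬ P.A.Adj i j → P.IsLinkA i j u)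
    (hv : ¬ P.B.Adj i j → P.swap.IsLinkA i j v) :
    ∃ c, IsCyclePattern F ℓ c ∧ (∀ d ≤ P.len i, ∃ n < ℓ, c n = P.p i d) ∧
      (∀ d ≤ P.len j, ∃ n < ℓ, c n = P.p j d) ∧ (¬ P.A.Adj i j → ∃ n < ℓ, c n = u) ∧
      (¬ P.B.Adj i j → ∃ n < ℓ, c n = v) ∧
      ∀ n < ℓ, (∃ d ≤ P.len i, c n = P.p i d) ∨ (∃ d ≤ P.len j, c n = P.p j d) ∨
        (¬ P.A.Adj i j ∧ c n = u) ∨ (¬ P.B.Adj i j ∧ c n = v) := by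
  obtain ⟨eu, heu⟩ : ∃ e : ℕ, (P.A.Adj i j ∧ e = 0) ∨ (¬ P.A.Adj i j ∧ e = 1) := by
    by_cases h : P.A.Adj i j
    · exact ⟨0, Or.inl ⟨h, rfl⟩⟩
    · exact ⟨1, Or.inr ⟨h, rfl⟩⟩
  obtain ⟨ev, hev⟩ : ∃ e : ℕ, (P.B.Adj i j ∧ e = 0) ∨ (¬ P.B.Adj i j ∧ e = 1) := by
    by_cases h : P.B.Adj i j
    · exact ⟨0, Or.inl ⟨h, rfl⟩⟩
    · exact ⟨1, Or.inr ⟨h, rfl⟩⟩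
  have hL := P.length i j hij eu ev heu hev
  have hi2 := P.two_le_len i
  have hj2 := P.two_le_len j
  -- The cycle runs along bar `i` to its `B`-end, through `v` if `ev = 1`, back along bar `j`, and
  -- through `u` if `eu = 1`.
  obtain ⟨c, hc⟩ : ∃ c : ℕ → T, c = fun n => if n ≤ P.len i then P.p i n else
    if n < P.len i + 1 + ev then v else
      if n ≤ P.len i + 1 + ev + P.len j then P.p j (P.len i + 1 + ev + P.len j - n) else u :=
    ⟨_, rfl⟩
  have c1 : ∀ n, n ≤ P.len i → c n = P.p i n := by
    intro n h; simp only [hc]; split_ifs; rfl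
  have c2 : ∀ n, P.len i < n → n < P.len i + 1 + ev → c n = v := by
    intro n h h'; simp only [hc]; split_ifs <;> first | rfl | omega
  have c3 : ∀ n, P.len i + 1 + ev ≤ n → n ≤ P.len i + 1 + ev + P.len j →
      c n = P.p j (P.len i + 1 + ev + P.len j - n) := by
    intro n h h'; simp only [hc]; split_ifs <;> first | rfl | omega
  have c4 : ∀ n, P.len i + 1 + ev + P.len j < n → c n = u := by
    intro n h; simp only [hc]; split_ifs <;> first | rfl | omega
  have hcases : ∀ n < ℓ, n ≤ P.len i ∨ (n = P.len i + 1 ∧ ¬ P.B.Adj i j ∧ ev = 1) ∨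
      (P.len i + 1 + ev ≤ n ∧ n ≤ P.len i + 1 + ev + P.len j) ∨
      (n = P.len i + 1 + ev + P.len j + 1 ∧ ¬ P.A.Adj i j ∧ eu = 1) := by
    intro n hn
    rcases heu with ⟨h1, h2⟩ | ⟨h1, h2⟩ <;> rcases hev with ⟨h3, h4⟩ | ⟨h3, h4⟩
    all_goals
      by_cases h5 : n ≤ P.len i
      · exact Or.inl h5
      by_cases h6 : P.len i + 1 + ev ≤ n ∧ n ≤ P.len i + 1 + ev + P.len j
      · exact Or.inr (Or.inr (Or.inl h6))
    · omega
    · exact Or.inr (Or.inl ⟨by omega, h3, h4⟩)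
    · exact Or.inr (Or.inr (Or.inr ⟨by omega, h1, h2⟩))
    · by_cases h7 : n = P.len i + 1
      · exact Or.inr (Or.inl ⟨h7, h3, h4⟩)
      · exact Or.inr (Or.inr (Or.inr ⟨by omega, h1, h2⟩))
  have hA : P.A.Adj i j ↔ eu = 0 := by
    rcases heu with ⟨h1, h2⟩ | ⟨h1, h2⟩
    · exact iff_of_true h1 h2
    · exact iff_of_false h1 (by omega)
  have hB : P.B.Adj i j ↔ ev = 0 := by
    rcases hev with ⟨h1, h2⟩ | ⟨h1, h2⟩
    · exact iff_of_true h1 h2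
    · exact iff_of_false h1 (by omega)
  have hvi : ¬ P.B.Adj i j → ∀ d ≤ P.len i, (F.Adj (P.p i d) v ↔ d = P.len i) := by
    intro h d hd
    rw [← P.swap_p_sub hd, F.adj_comm, (hv h).adj_left (c := P.len i - d) (Nat.sub_le _ _)]; omega
  have hvj : ¬ P.B.Adj i j → ∀ d ≤ P.len j, (F.Adj v (P.p j d) ↔ d = P.len j) := by
    intro h d hd
    rw [← P.swap_p_sub hd, (hv h).symm.adj_left (c := P.len j - d) (Nat.sub_le _ _)]; omega
  have hvu : ¬ P.A.Adj i j → ¬ P.B.Adj i j → ¬ F.Adj v u := fun h h' h'' =>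
    P.not_adj_sides (hu h).mem (hv h').mem h''.symm
  refine ⟨c, ?_, ?_, ?_, ?_, ?_, ?_⟩
  · intro a b hab hb
    rcases hcases a (by omega) with ha' | ⟨ha', hnB, hev1⟩ | ha' | ⟨ha', hnA, heu1⟩ <;>
    rcases hcases b hb with hb' | ⟨hb', hnB', hev1'⟩ | hb' | ⟨hb', hnA', heu1'⟩
    · rw [c1 a ha', c1 b hb', P.adj_p ha' hb']
      simp only [true_and, SimpleGraph.irrefl, and_false, or_false]
      omega
    · rw [c1 a ha', c2 b (by omega) (by omega), hvi hnB' a ha']; omega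
    · rw [c1 a ha', c3 b hb'.1 hb'.2, P.adj_p ha' (by omega), hA, hB]
      simp only [hij, false_and, false_or]
      omega
    · rw [c1 a ha', c4 b (by omega), F.adj_comm, (hu hnA').adj_left ha']; omega
    · omega
    · omega
    · rw [c2 a (by omega) (by omega), c3 b hb'.1 hb'.2, hvj hnB _ (by omega)]; omega
    · rw [c2 a (by omega) (by omega), c4 b (by omega)]
      exact iff_of_false (hvu hnA' hnB) (by omega)
    · omega
    · omega
    · rw [c3 a ha'.1 ha'.2, c3 b hb'.1 hb'.2, P.adj_p (by omega) (by omega)]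
      simp only [true_and, SimpleGraph.irrefl, and_false, or_false]
      omega
    · rw [c3 a ha'.1 ha'.2, c4 b (by omega), F.adj_comm, (hu hnA').symm.adj_left (by omega)]; omega
    · omega
    · omega
    · omega
    · omega
  · exact fun d hd => ⟨d, by omega, c1 d hd⟩
  · intro d hd
    refine ⟨P.len i + 1 + ev + P.len j - d, by omega, ?_⟩
    rw [c3 _ (by omega) (by omega)]; congr 1; omega
  · intro h
    have : eu = 1 := by rw [hA] at h; omega
    exact ⟨ℓ - 1, by omega, c4 _ (by omega)⟩
  · intro h
    have : ev = 1 := by rw [hB] at h; omega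
    exact ⟨P.len i + 1, by omega, c2 _ (by omega) (by omega)⟩
  · intro n hn
    rcases hcases n hn with h | ⟨h, h', h''⟩ | h | ⟨h, h', h''⟩
    · exact Or.inl ⟨n, h, c1 n h⟩
    · exact Or.inr (Or.inr (Or.inr ⟨h', c2 n (by omega) (by omega)⟩))
    · exact Or.inr (Or.inl ⟨_, by omega, c3 n h.1 h.2⟩)
    · exact Or.inr (Or.inr (Or.inl ⟨h', c4 n (by omega)⟩))

end FramePresentation

/-! ### Rings through prescribed vertices and paths. -/

namespace FramePresentation

variable {T : Type*} {F : SimpleGraph T} {k ℓ : ℕ} {P : FramePresentation F k ℓ}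

theorem exists_ne_of_three_le (P : FramePresentation F k ℓ) (i : Fin k) : ∃ j, i ≠ j := by
  have := P.three_le
  have : Nontrivial (Fin k) := Fin.nontrivial_iff_two_le.2 (by omega)
  obtain ⟨j, hj⟩ := exists_ne i
  exact ⟨j, hj.symm⟩

theorem exists_not_adj (hA : P.hasA) (i : Fin k) : ∃ j, i ≠ j ∧ ¬ P.A.Adj i j := by
  obtain ⟨e, he⟩ := P.isoA hA
  by_cases h : i = e
  · subst h
    obtain ⟨j, hj⟩ := P.exists_ne_of_three_le i
    exact ⟨j, hj, he j⟩
  · exact ⟨e, h, fun h' => he i h'.symm⟩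

/-- All vertices of the `i`-th bar are among `c 0, …, c (ℓ - 1)`. -/
def Through (P : FramePresentation F k ℓ) (c : ℕ → T) (i : Fin k) : Prop :=
  ∀ d ≤ P.len i, ∃ n < ℓ, c n = P.p i d

/-- The chordless cycles which contain two bars. -/
def IsRing (P : FramePresentation F k ℓ) (c : ℕ → T) : Prop :=
  IsCyclePattern F ℓ c ∧ ∃ i j, i ≠ j ∧ P.Through c i ∧ P.Through c j

theorem Through.of_swap {c : ℕ → T} {i : Fin k} (h : P.swap.Through c i) : P.Through c i := by
  intro d hd
  rw [← P.swap_p_sub hd]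
  exact h (P.len i - d) (Nat.sub_le _ _)

theorem IsRing.of_swap {c : ℕ → T} (h : P.swap.IsRing c) : P.IsRing c := by
  obtain ⟨hc, i, j, hij, hi, hj⟩ := h
  exact ⟨hc, i, j, hij, hi.of_swap, hj.of_swap⟩

theorem exists_ring_link {i j : Fin k} (hij : i ≠ j) {u : T}
    (hu : ¬ P.A.Adj i j → P.IsLinkA i j u) :
    ∃ c, IsCyclePattern F ℓ c ∧ P.Through c i ∧ P.Through c j ∧
      (¬ P.A.Adj i j → ∃ n < ℓ, c n = u) ∧
      ∀ n < ℓ, (∃ d ≤ P.len i, c n = P.p i d) ∨ (∃ d ≤ P.len j, c n = P.p j d) ∨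
        (¬ P.A.Adj i j ∧ c n = u) ∨ c n ∈ P.sideB := by
  have : ∃ v, ¬ P.B.Adj i j → P.swap.IsLinkA i j v := by
    by_cases hB : P.B.Adj i j
    · exact ⟨u, fun h => absurd hB h⟩
    · obtain ⟨v, hv⟩ := P.swap.exists_isLinkA hB
      exact ⟨v, fun _ => hv⟩
  obtain ⟨v, hv⟩ := this
  obtain ⟨c, h1, h2, h3, h4, -, h6⟩ := exists_ring hij hu hv
  refine ⟨c, h1, h2, h3, h4, fun n hn => ?_⟩
  rcases h6 n hn with h | h | h | ⟨h, h'⟩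
  · exact Or.inl h
  · exact Or.inr (Or.inl h)
  · exact Or.inr (Or.inr (Or.inl h))
  · exact Or.inr (Or.inr (Or.inr (h' ▸ (hv h).mem)))

theorem exists_ring_bars (P : FramePresentation F k ℓ) {i j : Fin k} (hij : i ≠ j) :
    ∃ c, IsCyclePattern F ℓ c ∧ P.Through c i ∧ P.Through c j := by
  have : ∃ u, ¬ P.A.Adj i j → P.IsLinkA i j u := by
    by_cases hA : P.A.Adj i j
    · exact ⟨P.p i 0, fun h => absurd hA h⟩
    · obtain ⟨v, hv⟩ := P.exists_isLinkA hA
      exact ⟨v, fun _ => hv⟩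
  obtain ⟨u, hu⟩ := this
  obtain ⟨c, h1, h2, h3, -⟩ := exists_ring_link hij hu
  exact ⟨c, h1, h2, h3⟩

theorem exists_ring_linkA {i j : Fin k} {u : T} (hij : i ≠ j) (h : ¬ P.A.Adj i j)
    (hu : P.IsLinkA i j u) :
    ∃ c, IsCyclePattern F ℓ c ∧ P.Through c i ∧ P.Through c j ∧ ∃ n < ℓ, c n = u := by
  obtain ⟨c, h1, h2, h3, h4, -⟩ := exists_ring_link hij fun _ => hu
  exact ⟨c, h1, h2, h3, h4 h⟩

theorem exists_ring_bar_α (hA : P.hasA) (i : Fin k) :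
    ∃ c, P.IsRing c ∧ P.Through c i ∧ ∃ n < ℓ, c n = P.α := by
  obtain ⟨j, hij, hadj⟩ := P.exists_not_adj hA i
  obtain ⟨c, h1, h2, h3, h4⟩ := exists_ring_linkA hij hadj (isLinkA_α hA i j)
  exact ⟨c, ⟨h1, i, j, hij, h2, h3⟩, h2, h4⟩

theorem exists_ring_α_β (hA : P.hasA) (hB : P.hasB) :
    ∃ c, P.IsRing c ∧ (∃ n < ℓ, c n = P.α) ∧ ∃ n < ℓ, c n = P.β := by
  obtain ⟨i, j, hij, h1, h2⟩ := P.both hA hB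
  obtain ⟨c, h3, h4, h5, h6, h7, -⟩ := exists_ring hij (fun _ => isLinkA_α hA i j)
    (fun _ => P.swap.isLinkA_α hB i j)
  exact ⟨c, ⟨h3, i, j, hij, h4, h5⟩, h6 h1, h7 h2⟩

/-- Any two vertices lie in a common ring. -/
theorem exists_ring_pair (P : FramePresentation F k ℓ) (s t : T) :
    ∃ c, P.IsRing c ∧ (∃ n < ℓ, c n = s) ∧ ∃ n < ℓ, c n = t := by
  have h0 : 0 < k := by have := P.three_le; omega
  have hαα : P.hasA → ∃ c, P.IsRing c ∧ ∃ n < ℓ, c n = P.α := fun hA => by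
    obtain ⟨c, h1, -, h2⟩ := P.exists_ring_bar_α hA ⟨0, h0⟩
    exact ⟨c, h1, h2⟩
  have hββ : P.hasB → ∃ c, P.IsRing c ∧ ∃ n < ℓ, c n = P.β := fun hB => by
    obtain ⟨c, h1, -, h2⟩ := P.swap.exists_ring_bar_α hB ⟨0, h0⟩
    exact ⟨c, h1.of_swap, h2⟩
  rcases P.cover s with ⟨i, d, hd, rfl⟩ | ⟨hA, rfl⟩ | ⟨hB, rfl⟩ <;>
  rcases P.cover t with ⟨j, e, he, rfl⟩ | ⟨hA', rfl⟩ | ⟨hB', rfl⟩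
  · by_cases hij : i = j
    · subst hij
      obtain ⟨j, hj⟩ := P.exists_ne_of_three_le i
      obtain ⟨c, h1, h2, h3⟩ := P.exists_ring_bars hj
      exact ⟨c, ⟨h1, i, j, hj, h2, h3⟩, h2 d hd, h2 e he⟩
    · obtain ⟨c, h1, h2, h3⟩ := P.exists_ring_bars hij
      exact ⟨c, ⟨h1, i, j, hij, h2, h3⟩, h2 d hd, h3 e he⟩
  · obtain ⟨c, h1, h2, h3⟩ := P.exists_ring_bar_α hA' i
    exact ⟨c, h1, h2 d hd, h3⟩
  · obtain ⟨c, h1, h2, h3⟩ := P.swap.exists_ring_bar_α hB' i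
    exact ⟨c, h1.of_swap, h2.of_swap d hd, h3⟩
  · obtain ⟨c, h1, h2, h3⟩ := P.exists_ring_bar_α hA j
    exact ⟨c, h1, h3, h2 e he⟩
  · obtain ⟨c, h1, h2⟩ := hαα hA
    exact ⟨c, h1, h2, h2⟩
  · exact exists_ring_α_β hA hB'
  · obtain ⟨c, h1, h2, h3⟩ := P.swap.exists_ring_bar_α hB j
    exact ⟨c, h1.of_swap, h3, h2.of_swap e he⟩
  · obtain ⟨c, h1, h2, h3⟩ := exists_ring_α_β hA' hB
    exact ⟨c, h1, h3, h2⟩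
  · obtain ⟨c, h1, h2⟩ := hββ hB
    exact ⟨c, h1, h2, h2⟩

theorem eq_of_adj_interior {i : Fin k} {c : ℕ} (h0 : 0 < c) (hc : c < P.len i) {t : T}
    (h : F.Adj (P.p i c) t) : t = P.p i (c - 1) ∨ t = P.p i (c + 1) := by
  rcases P.cover t with ⟨j, d, hd, rfl⟩ | ⟨hA, rfl⟩ | ⟨hB, rfl⟩
  · rcases (P.adj_p hc.le hd).1 h with ⟨rfl, rfl | h⟩ | ⟨h, _⟩ | ⟨h, _⟩
    · exact Or.inr rfl
    · exact Or.inl (by congr 1; omega)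
    · omega
    · omega
  · have := (P.adj_α hA hc.le).1 h.symm
    omega
  · have := (P.adj_β hB hc.le).1 h.symm
    omega

theorem eq_of_adj_zero {i : Fin k} {t : T} (h : F.Adj (P.p i 0) t) :
    t = P.p i 1 ∨ t ∈ P.sideA := by
  have hi := P.two_le_len i
  rcases P.cover t with ⟨j, d, hd, rfl⟩ | ⟨hA, rfl⟩ | ⟨hB, rfl⟩
  · rcases P.eq_of_adj_sideA (P.p_zero_mem i) hd h with rfl | ⟨rfl, h'⟩
    · exact Or.inr (P.p_zero_mem j)
    · obtain ⟨rfl, -⟩ := P.p_inj (by omega) (by omega) h'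
      exact Or.inl rfl
  · exact Or.inr (Or.inr ⟨hA, rfl⟩)
  · have := (P.adj_β hB (Nat.zero_le _)).1 h.symm
    omega

theorem eq_of_adj_α (hA : P.hasA) {t : T} (h : F.Adj P.α t) : ∃ i, t = P.p i 0 := by
  rcases P.cover t with ⟨j, d, hd, rfl⟩ | ⟨hA, rfl⟩ | ⟨hB, rfl⟩
  · exact ⟨j, by rw [(P.adj_α hA hd).1 h]⟩
  · exact absurd h F.irrefl
  · exact absurd h (P.not_adj_αβ hA hB)

theorem p_notMem_sideA {i : Fin k} {c : ℕ} (hc : c ≤ P.len i) (h0 : c ≠ 0) :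
    P.p i c ∉ P.sideA := by
  rintro (⟨j, h⟩ | ⟨hA, h⟩)
  · exact h0 (P.p_inj hc (Nat.zero_le _) h).2
  · exact P.p_ne_α hA i c hc h

theorem adj_bar {i : Fin k} {c : ℕ} (hc : c + 1 ≤ P.len i) :
    F.Adj (P.p i c) (P.p i (c + 1)) :=
  (P.adj_p (by omega) hc).2 (Or.inl ⟨rfl, Or.inl rfl⟩)

/-- If one end of the path is inside the bar of its middle `p i 0`, a ring through that bar and the
other end will do. If both ends are in `A⁺`, they are ends of nonadjacent bars (the apex is adjacent
to all of these), and the middle is itself a link between those bars. -/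
theorem exists_ring_path_sideA {s m t : T} (hm : m ∈ P.sideA) (hs : F.Adj s m) (ht : F.Adj m t)
    (hne : s ≠ t) (hst : ¬ F.Adj s t) :
    ∃ c, IsCyclePattern F ℓ c ∧ (∃ n < ℓ, c n = s) ∧ (∃ n < ℓ, c n = m) ∧ ∃ n < ℓ, c n = t := by
  rcases hm with ⟨i, rfl⟩ | ⟨hA, rfl⟩
  · have hi := P.two_le_len i
    have key : ∀ t, t ∈ P.sideA → F.Adj (P.p i 0) t → ∃ c, IsCyclePattern F ℓ c ∧
        (∃ n < ℓ, c n = P.p i 1) ∧ (∃ n < ℓ, c n = P.p i 0) ∧ ∃ n < ℓ, c n = t := by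
      rintro t (⟨j, rfl⟩ | ⟨hA, rfl⟩) hadj
      · obtain ⟨c, h1, h2, h3⟩ := P.exists_ring_bars (adj_zero.1 hadj).ne
        exact ⟨c, h1, h2 1 (by omega), h2 0 (by omega), h3 0 (by omega)⟩
      · obtain ⟨c, h1, h2, h3⟩ := exists_ring_bar_α hA i
        exact ⟨c, h1.1, h2 1 (by omega), h2 0 (by omega), h3⟩
    rcases P.eq_of_adj_zero hs.symm with rfl | hs' <;> rcases P.eq_of_adj_zero ht with rfl | ht'
    · exact absurd rfl hne
    · exact key t ht' ht
    · obtain ⟨c, h1, h2, h3, h4⟩ := key s hs' hs.symm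
      exact ⟨c, h1, h4, h3, h2⟩
    · rcases hs' with ⟨j, rfl⟩ | ⟨hA, rfl⟩
      · rcases ht' with ⟨h, rfl⟩ | ⟨hA, rfl⟩
        · obtain ⟨c, h1, h2, h3, h4⟩ := exists_ring_linkA (u := P.p i 0)
            (fun e : j = h => hne (by rw [e])) (fun e => hst (adj_zero.2 e))
            ⟨P.p_zero_mem i, hs.symm, ht⟩
          exact ⟨c, h1, h2 0 (by omega), h4, h3 0 (by omega)⟩
        · exact absurd ((P.adj_α hA (Nat.zero_le _)).2 rfl).symm hst
      · rcases ht' with ⟨h, rfl⟩ | ⟨hA', rfl⟩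
        · exact absurd ((P.adj_α hA (Nat.zero_le _)).2 rfl) hst
        · exact absurd rfl hne
  · obtain ⟨i, rfl⟩ := eq_of_adj_α hA hs.symm
    obtain ⟨j, rfl⟩ := eq_of_adj_α hA ht
    obtain ⟨c, h1, h2, h3, h4⟩ := exists_ring_linkA (fun e : i = j => hne (by rw [e]))
      (fun e => hst (adj_zero.2 e)) (isLinkA_α hA i j)
    exact ⟨c, h1, h2 0 (by omega), h4, h3 0 (by omega)⟩

/-- Every induced three-vertex path lies in a hole of length `ℓ`. -/
theorem exists_hole_through_path (P : FramePresentation F k ℓ) {s m t : T} (hs : F.Adj s m)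
    (ht : F.Adj m t) (hne : s ≠ t) (hst : ¬ F.Adj s t) :
    ∃ c, IsCyclePattern F ℓ c ∧ c 0 = m ∧ c 1 = t ∧ c (ℓ - 1) = s := by
  have hℓ := P.seven_le
  have : ∃ c, IsCyclePattern F ℓ c ∧ (∃ n < ℓ, c n = s) ∧ (∃ n < ℓ, c n = m) ∧
      ∃ n < ℓ, c n = t := by
    rcases P.cover m with ⟨i, d, hd, rfl⟩ | ⟨hA, rfl⟩ | ⟨hB, rfl⟩
    · by_cases h0 : d = 0
      · subst h0
        exact exists_ring_path_sideA (P.p_zero_mem i) hs ht hne hst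
      by_cases hl : d = P.len i
      · subst hl
        exact P.swap.exists_ring_path_sideA (P.p_len_mem i) hs ht hne hst
      obtain ⟨j, hij⟩ := P.exists_ne_of_three_le i
      obtain ⟨c, h1, h2, -⟩ := P.exists_ring_bars hij
      have hmem : ∀ r, F.Adj (P.p i d) r → ∃ n < ℓ, c n = r := by
        intro r hr
        rcases eq_of_adj_interior (by omega) (by omega) hr with rfl | rfl
        · exact h2 _ (by omega)
        · exact h2 _ (by omega)
      exact ⟨c, h1, hmem s hs.symm, h2 d hd, hmem t ht⟩
    · exact exists_ring_path_sideA (Or.inr ⟨hA, rfl⟩) hs ht hne hst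
    · exact P.swap.exists_ring_path_sideA (Or.inr ⟨hB, rfl⟩) hs ht hne hst
  obtain ⟨c, hc, h1, h2, h3⟩ := this
  obtain ⟨q, hq, h4, h5, h6, -⟩ := hc.exists_start_three (by omega) h1 h2 h3 hs ht hne
  exact ⟨q, hq, h4, h5, h6⟩

theorem _root_.Set.three_le_encard_of_mem {S : Type*} {s : Set S} {a b c : S} (ha : a ∈ s)
    (hb : b ∈ s) (hc : c ∈ s) (hab : a ≠ b) (hac : a ≠ c) (hbc : b ≠ c) : 3 ≤ s.encard := by
  rw [← Set.encard_eq_three.2 ⟨a, b, c, hab, hac, hbc, rfl⟩]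
  refine Set.encard_le_encard ?_
  rintro x (rfl | rfl | rfl) <;> assumption

/-- A bar end in a triangle has two neighbours in `A⁺` besides its neighbour in the bar, and the
apex has `k ≥ 3` neighbours. Hence condition (iv) of blow-ups applies to every edge of a triangle.
-/
theorem three_le_degree_sideA {s m t : T} (hs : s ∈ P.sideA) (hsm : F.Adj s m) (hmt : F.Adj m t)
    (hst : F.Adj s t) : 3 ≤ (F.neighborSet s).encard := by
  rcases hs with ⟨i, rfl⟩ | ⟨hA, rfl⟩
  · have hi := P.two_le_len i
    have hnadj : ∀ r, r ∈ P.sideA → F.Adj (P.p i 0) r → ¬ F.Adj r (P.p i 1) := by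
      intro r hr hir h
      rcases P.eq_of_adj_sideA hr (by omega) h with h | ⟨-, h⟩
      · omega
      · exact hir.ne h.symm
    have h1 : P.p i 1 ∉ P.sideA := p_notMem_sideA (by omega) (by omega)
    rcases P.eq_of_adj_zero hsm with rfl | hm <;> rcases P.eq_of_adj_zero hst with rfl | ht
    · exact absurd hmt F.irrefl
    · exact absurd hmt.symm (hnadj t ht hst)
    · exact absurd hmt (hnadj m hm hsm)
    · exact Set.three_le_encard_of_mem (show m ∈ _ from hsm) (show t ∈ _ from hst)
        (show P.p i 1 ∈ _ from adj_bar (by omega)) hmt.ne (fun e => h1 (e ▸ hm))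
        (fun e => h1 (e ▸ ht))
  · have hk := P.three_le
    have hmem : ∀ i, P.p i 0 ∈ F.neighborSet P.α := fun i => (P.adj_α hA (Nat.zero_le _)).2 rfl
    have hne : ∀ i j : Fin k, i ≠ j → P.p i 0 ≠ P.p j 0 := fun i j hij h =>
      hij (P.p_inj (Nat.zero_le _) (Nat.zero_le _) h).1
    exact Set.three_le_encard_of_mem (hmem ⟨0, by omega⟩) (hmem ⟨1, by omega⟩)
      (hmem ⟨2, by omega⟩) (hne _ _ (by simp)) (hne _ _ (by simp)) (hne _ _ (by simp))

theorem three_le_degree (P : FramePresentation F k ℓ) {s m t : T} (hsm : F.Adj s m)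
    (hmt : F.Adj m t) (hst : F.Adj s t) : 3 ≤ (F.neighborSet s).encard := by
  rcases P.cover s with ⟨i, d, hd, rfl⟩ | ⟨hA, rfl⟩ | ⟨hB, rfl⟩
  · by_cases h0 : d = 0
    · subst h0
      exact three_le_degree_sideA (P.p_zero_mem i) hsm hmt hst
    by_cases hl : d = P.len i
    · subst hl
      exact P.swap.three_le_degree_sideA (P.p_len_mem i) hsm hmt hst
    have hno : ¬ F.Adj (P.p i (d - 1)) (P.p i (d + 1)) := by
      rw [P.adj_p (by omega) (by omega)]; omega
    rcases eq_of_adj_interior (by omega) (by omega) hsm with rfl | rfl <;>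
    rcases eq_of_adj_interior (by omega) (by omega) hst with rfl | rfl
    · exact absurd hmt F.irrefl
    · exact absurd hmt hno
    · exact absurd hmt.symm hno
    · exact absurd hmt F.irrefl
  · exact three_le_degree_sideA (Or.inr ⟨hA, rfl⟩) hsm hmt hst
  · exact P.swap.three_le_degree_sideA (Or.inr ⟨hB, rfl⟩) hsm hmt hst

/-! ### Spreading from two bars to the whole frame. -/

/-- The set `S` contains every `ℓ`-hole which meets it in two far vertices. -/
def IsFarClosed (F : SimpleGraph T) (ℓ : ℕ) (S : Set T) : Prop :=
  ∀ c, IsCyclePattern F ℓ c → ∀ s ∈ S, ∀ t ∈ S, (∃ n < ℓ, c n = s) → (∃ n < ℓ, c n = t) →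
    IsFar F s t → ∀ n < ℓ, c n ∈ S

/-- The set `S` contains the `i`-th bar. -/
def ContainsBar (P : FramePresentation F k ℓ) (S : Set T) (i : Fin k) : Prop :=
  ∀ d ≤ P.len i, P.p i d ∈ S

theorem ContainsBar.swap {S : Set T} {i : Fin k} (h : P.ContainsBar S i) :
    P.swap.ContainsBar S i := fun _ _ => h _ (Nat.sub_le _ _)

theorem ContainsBar.of_swap {S : Set T} {i : Fin k} (h : P.swap.ContainsBar S i) :
    P.ContainsBar S i := fun d hd => by
  rw [← P.swap_p_sub hd]; exact h _ (Nat.sub_le _ _)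

theorem containsBar_of_through {S : Set T} {c : ℕ → T} (h : ∀ n < ℓ, c n ∈ S) {i : Fin k}
    (hi : P.Through c i) : P.ContainsBar S i := by
  intro d hd
  obtain ⟨n, hn, h'⟩ := hi d hd
  exact h' ▸ h n hn

/-- The apex is far from the `B`-end of a bar in `S`, so every ring through both is absorbed. An
isolated vertex `e` of `A` serves as a relay from bar `i` to bar `e` to bar `j`. -/
theorem containsBar_of_α {S : Set T} (hS : IsFarClosed F ℓ S) (hA : P.hasA) (hα : P.α ∈ S)
    {i : Fin k} (hi : P.ContainsBar S i) (j : Fin k) : P.ContainsBar S j := by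
  have hstep : ∀ i j, ¬ P.A.Adj i j → P.ContainsBar S i → P.ContainsBar S j := by
    intro i j hadj hi
    by_cases hij : i = j
    · exact hij ▸ hi
    obtain ⟨c, hc, h1, h2, h3⟩ := exists_ring_linkA hij hadj (isLinkA_α hA i j)
    refine containsBar_of_through ?_ h2
    exact hS c hc _ hα _ (hi _ le_rfl) h3 (h1 _ le_rfl)
      (isFar_of_ne (Or.inr ⟨hA, rfl⟩) (P.p_ne_α hA i 0 (Nat.zero_le _)).symm)
  obtain ⟨e, he⟩ := P.isoA hA
  exact hstep e j (he j) (hstep i e (fun h => he i h.symm) hi)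

/-- Every link between the two bars is absorbed. If an apex is among them, it spreads to all bars.
If not, the link is the end of a dominating bar `d`, which is not adjacent to `i` on side `B`; the
ring through `i`, `d` and the apex of `B` is then absorbed, and that apex spreads. -/
theorem containsBar_of_not_adj {S : Set T} (hS : IsFarClosed F ℓ S) {i j : Fin k} (hij : i ≠ j)
    (hi : P.ContainsBar S i) (hj : P.ContainsBar S j) (hadj : ¬ P.A.Adj i j)
    (hshort : ∀ h, h ≠ i → ¬ P.A.Adj i h ∨ ¬ P.B.Adj i h) (h : Fin k) : P.ContainsBar S h := by
  have hfar : IsFar F (P.p i 0) (P.p j (P.len j)) := isFar_of_ne (P.p_zero_mem i)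
    fun e => hij (P.p_inj (Nat.zero_le _) (Nat.zero_le _) e).1
  have hlink : ∀ u, P.IsLinkA i j u → u ∈ S := by
    intro u hu
    obtain ⟨c, hc, h1, h2, n, hn, rfl⟩ := exists_ring_linkA hij hadj hu
    exact hS c hc _ (hi 0 (Nat.zero_le _)) _ (hj _ le_rfl) (h1 0 (Nat.zero_le _)) (h2 _ le_rfl)
      hfar n hn
  by_cases hA : P.hasA
  · exact containsBar_of_α hS hA (hlink _ (isLinkA_α hA i j)) hi h
  · obtain ⟨d, hdi, hd⟩ := P.domA hA i
    have hdj : d ≠ j := fun e => hadj (e ▸ hd i hdi.symm).symm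
    have hdS : P.p d 0 ∈ S := hlink _
      ⟨P.p_zero_mem d, adj_zero.2 (hd i hdi.symm), adj_zero.2 (hd j hdj.symm)⟩
    have hB : P.hasB := P.hasA_or_hasB.resolve_left hA
    have hidA : P.A.Adj i d := (hd i hdi.symm).symm
    have hid : ¬ P.B.Adj i d := (hshort d hdi).resolve_left fun h => h hidA
    obtain ⟨c, hc, h1, h2, n, hn, hβ⟩ :=
      P.swap.exists_ring_linkA hdi.symm hid (P.swap.isLinkA_α hB i d)
    have hfar' : IsFar F (P.p d 0) (P.p i (P.len i)) := isFar_of_ne (P.p_zero_mem d)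
      fun e => hdi (P.p_inj (Nat.zero_le _) (Nat.zero_le _) e).1
    have hcS := hS c hc _ hdS _ (hi _ le_rfl) (h2.of_swap 0 (Nat.zero_le _))
      (h1.of_swap _ le_rfl) hfar'
    exact (P.swap.containsBar_of_α hS hB (hβ ▸ hcS n hn) hi.swap h).of_swap

theorem α_mem_of_containsBar {S : Set T} (hS : IsFarClosed F ℓ S)
    (h : ∀ i, P.ContainsBar S i) (hA : P.hasA) : P.α ∈ S := by
  obtain ⟨e, he⟩ := P.isoA hA
  obtain ⟨j, hej⟩ := P.exists_ne_of_three_le e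
  obtain ⟨c, hc, h1, h2, n, hn, hα⟩ := exists_ring_linkA hej (he j) (isLinkA_α hA e j)
  rw [← hα]
  exact hS c hc _ (h e 0 (Nat.zero_le _)) _ (h j _ le_rfl) (h1 0 (Nat.zero_le _)) (h2 _ le_rfl)
    (isFar_of_ne (P.p_zero_mem e) fun e' =>
      hej (P.p_inj (Nat.zero_le _) (Nat.zero_le _) e').1) n hn

/-- A set which contains two bars and all holes which meet it in far vertices contains all
vertices. -/
theorem mem_of_isFarClosed {S : Set T} (hS : IsFarClosed F ℓ S) {i j : Fin k} (hij : i ≠ j)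
    (hi : P.ContainsBar S i) (hj : P.ContainsBar S j) (t : T) : t ∈ S := by
  have hall : ∀ h, P.ContainsBar S h := by
    intro h
    by_cases hih : i = h
    · exact hih ▸ hi
    -- The two ends of a bar of length at least three are far, so that bar alone absorbs every ring
    -- through it.
    rcases P.short i with h3 | h3
    · obtain ⟨c, hc, h1, h2⟩ := P.exists_ring_bars hih
      exact containsBar_of_through (hS c hc _ (hi 0 (Nat.zero_le _)) _ (hi _ le_rfl)
        (h1 0 (Nat.zero_le _)) (h1 _ le_rfl) (isFar_of_three_le h3)) h2
    · rcases h3 j hij.symm with h4 | h4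
      · exact containsBar_of_not_adj hS hij hi hj h4 h3 h
      · exact (P.swap.containsBar_of_not_adj hS hij hi.swap hj.swap h4
          (fun h h' => (h3 h h').symm) h).of_swap
  rcases P.cover t with ⟨i, d, hd, rfl⟩ | ⟨hA, rfl⟩ | ⟨hB, rfl⟩
  · exact hall i d hd
  · exact α_mem_of_containsBar hS hall hA
  · exact P.swap.α_mem_of_containsBar hS (fun i => (hall i).swap) hB

/-! ### Sets in which nonadjacent vertices have common neighbours. -/

/-- The set `S` consists of neighbours of the end `p i 0` of a bar, and possibly this end; it
contains a neighbour in the bar and a neighbour in `A⁺`. -/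
structure IsAttachedA (P : FramePresentation F k ℓ) (S : Set T) (i : Fin k) : Prop where
  mem : P.p i 1 ∈ S
  exists_side : ∃ t ∈ S, t ∈ P.sideA ∧ F.Adj (P.p i 0) t
  near : ∀ t ∈ S, t = P.p i 0 ∨ F.Adj (P.p i 0) t

/-- The set `S` consists of a vertex of degree two and its neighbours. -/
def IsStar (F : SimpleGraph T) (S : Set T) : Prop :=
  ∃ s m t, s ∈ S ∧ t ∈ S ∧ F.Adj s m ∧ F.Adj m t ∧ s ≠ t ∧ ¬ F.Adj s t ∧
    (∀ r, F.Adj m r → r = s ∨ r = t) ∧ ∀ r ∈ S, r = m ∨ F.Adj m r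

/-- The set `S` is contained in an edge. -/
def InEdge (F : SimpleGraph T) (S : Set T) : Prop :=
  ∃ s m, (s = m ∨ F.Adj s m) ∧ ∀ t ∈ S, t = s ∨ t = m

/-- All members lie around the predecessor of the interior vertex `p i c`. A third member is either
a neighbour in the bar, which gives a star, or lies in `A⁺` with `c = 1`, which gives attachment at
the bar end. -/
theorem shape_of_prev_mem {S : Set T} {i : Fin k} {c : ℕ} (hc0 : 0 < c) (hc : c < P.len i)
    (hpS : P.p i c ∈ S) (hprev : P.p i (c - 1) ∈ S)
    (hnear : ∀ t ∈ S, t = P.p i c ∨ t = P.p i (c - 1) ∨ F.Adj (P.p i (c - 1)) t) :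
    InEdge F S ∨ IsStar F S ∨ P.IsAttachedA S i := by
  have hadj : F.Adj (P.p i (c - 1)) (P.p i c) := by
    have := P.adj_bar (i := i) (c := c - 1) (by omega)
    rwa [show c - 1 + 1 = c by omega] at this
  by_cases h : ∃ t ∈ S, t ≠ P.p i c ∧ t ≠ P.p i (c - 1)
  · obtain ⟨t, htS, htp, htq⟩ := h
    have ht : F.Adj (P.p i (c - 1)) t := ((hnear t htS).resolve_left htp).resolve_left htq
    have hnear' : ∀ r ∈ S, r = P.p i (c - 1) ∨ F.Adj (P.p i (c - 1)) r := by
      intro r hr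
      rcases hnear r hr with rfl | h | h
      · exact Or.inr hadj
      · exact Or.inl h
      · exact Or.inr h
    by_cases hc1 : c = 1
    · subst hc1
      refine Or.inr (Or.inr ⟨hpS, ⟨t, htS, ?_, ht⟩, hnear'⟩)
      exact (P.eq_of_adj_zero ht).resolve_left htp
    · have hnb : ∀ r, F.Adj (P.p i (c - 1)) r → r = P.p i c ∨ r = P.p i (c - 2) := by
        intro r hr
        rcases eq_of_adj_interior (by omega) (by omega) hr with h | h
        · exact Or.inr h
        · rw [show c - 1 + 1 = c by omega] at h
          exact Or.inl h
      have ht2 := (hnb t ht).resolve_left htp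
      subst ht2
      refine Or.inr (Or.inl ⟨_, _, _, hpS, htS, hadj.symm, ht, htp.symm, ?_, hnb, hnear'⟩)
      rw [P.adj_p (by omega) (by omega)]; omega
  · push Not at h
    refine Or.inl ⟨_, _, Or.inr hadj, fun t ht => ?_⟩
    by_cases h' : t = P.p i c
    · exact Or.inr h'
    · exact Or.inl (h t ht h')

/-- No further vertices lie near three consecutive vertices of a bar. -/
theorem eq_of_adj_prev {i : Fin k} {c : ℕ} (hc0 : 0 < c) (hc : c < P.len i) {t : T}
    (ht : F.Adj (P.p i (c - 1)) t) (h : t = P.p i (c + 1) ∨ F.Adj t (P.p i (c + 1)) ∨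
      ∃ m, F.Adj t m ∧ F.Adj m (P.p i (c + 1))) : t = P.p i c := by
  have hadj : F.Adj (P.p i c) (P.p i (c + 1)) := P.adj_bar (by omega)
  by_contra htp
  have hlt : t ∈ P.sideA ∨ ∃ d, d + 2 = c ∧ t = P.p i d := by
    by_cases hc1 : c = 1
    · subst hc1
      exact Or.inl ((P.eq_of_adj_zero ht).resolve_left htp)
    · rcases eq_of_adj_interior (by omega) (by omega) ht with h | h
      · exact Or.inr ⟨c - 2, by omega, h⟩
      · rw [show c - 1 + 1 = c by omega] at h
        exact absurd h htp
  have hA : ∀ r, r = P.p i (c + 1) ∨ F.Adj r (P.p i (c + 1)) → r ≠ P.p i c →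
      r ∈ P.sideB ∨ ∃ d, c + 1 ≤ d ∧ d ≤ P.len i ∧ r = P.p i d := by
    rintro r (rfl | hr) hne
    · exact Or.inr ⟨c + 1, le_rfl, hc, rfl⟩
    · by_cases hl : c + 1 = P.len i
      · rw [hl] at hr
        rcases P.swap.eq_of_adj_zero (i := i) hr.symm with h | h
        · refine absurd (h.trans ?_) hne
          change P.p i (P.len i - 1) = _
          congr 1; omega
        · exact Or.inl h
      · rcases eq_of_adj_interior (by omega) (by omega) hr.symm with h | h
        · exact absurd h hne
        · exact Or.inr ⟨c + 2, by omega, by omega, h⟩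
  have hfar : ∀ r, (r ∈ P.sideB ∨ ∃ d, c + 1 ≤ d ∧ d ≤ P.len i ∧ r = P.p i d) →
      t ≠ r ∧ ¬ F.Adj t r := by
    intro r hr
    rcases hlt with ht' | ⟨d, hd, rfl⟩ <;> rcases hr with hr | ⟨e, he, he', rfl⟩
    · exact ⟨P.ne_of_sides ht' hr, P.not_adj_sides ht' hr⟩
    · refine ⟨fun h => p_notMem_sideA he' (by omega) (h ▸ ht'), fun h => ?_⟩
      have := P.eq_of_adj_sideA ht' he' h
      omega
    · refine ⟨?_, fun h => ?_⟩
      · rintro rfl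
        exact P.swap.p_notMem_sideA (i := i) (c := P.len i - d) (Nat.sub_le _ _) (by omega)
          (by rwa [P.swap_p_sub (by omega)])
      · have := P.eq_of_adj_sideB hr (by omega) h.symm
        omega
    · refine ⟨fun h => ?_, ?_⟩
      · have := (P.p_inj (by omega) he' h).2
        omega
      · rw [P.adj_p (by omega) he']
        have := P.B.irrefl (v := i)
        have := P.A.irrefl (v := i)
        omega
  rcases h with h | h | ⟨m, h, h'⟩
  · exact (hfar t (hA t (Or.inl h) htp)).1 rfl
  · exact (hfar t (hA t (Or.inr h) htp)).1 rfl
  · by_cases hm : m = P.p i c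
    · subst hm
      rcases eq_of_adj_interior hc0 hc h.symm with rfl | rfl
      · exact F.irrefl ht
      · exact (hfar _ (hA _ (Or.inl rfl) htp)).1 rfl
    · exact (hfar m (hA m (Or.inr h') hm)).2 h

/-- The possible sets of vertices in which any two nonadjacent vertices have a common neighbour. -/
theorem shape_of_common_neighbors {S : Set T}
    (hS : ∀ s ∈ S, ∀ t ∈ S, s = t ∨ F.Adj s t ∨ ∃ m ∈ S, F.Adj s m ∧ F.Adj m t) :
    S ⊆ P.sideA ∨ S ⊆ P.sideB ∨ InEdge F S ∨ IsStar F S ∨ (∃ i, P.IsAttachedA S i) ∨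
      ∃ i, P.swap.IsAttachedA S i := by
  by_cases hint : ∃ i c, 0 < c ∧ c < P.len i ∧ P.p i c ∈ S
  · obtain ⟨i, c, hc0, hc, hpS⟩ := hint
    right; right
    have hadj1 : F.Adj (P.p i (c - 1)) (P.p i c) := by
      have := P.adj_bar (i := i) (c := c - 1) (by omega)
      rwa [show c - 1 + 1 = c by omega] at this
    have hadj2 : F.Adj (P.p i c) (P.p i (c + 1)) := P.adj_bar (by omega)
    have hnear : ∀ t ∈ S, t = P.p i c ∨ t = P.p i (c - 1) ∨ t = P.p i (c + 1) ∨
        (P.p i (c - 1) ∈ S ∧ F.Adj (P.p i (c - 1)) t) ∨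
        (P.p i (c + 1) ∈ S ∧ F.Adj (P.p i (c + 1)) t) := by
      intro t ht
      rcases hS _ hpS t ht with h | h | ⟨m, hm, h1, h2⟩
      · exact Or.inl h.symm
      · rcases eq_of_adj_interior hc0 hc h with h | h
        · exact Or.inr (Or.inl h)
        · exact Or.inr (Or.inr (Or.inl h))
      · rcases eq_of_adj_interior hc0 hc h1 with rfl | rfl
        · exact Or.inr (Or.inr (Or.inr (Or.inl ⟨hm, h2⟩)))
        · exact Or.inr (Or.inr (Or.inr (Or.inr ⟨hm, h2⟩)))
    have hp1 : P.swap.p i (P.len i - c) = P.p i c := P.swap_p_sub hc.le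
    have hp2 : P.swap.p i (P.len i - c - 1) = P.p i (c + 1) := P.swap_p_sub hc
    have hp3 : P.swap.p i (P.len i - c + 1) = P.p i (c - 1) := by
      rw [show P.len i - c + 1 = P.len i - (c - 1) by omega]
      exact P.swap_p_sub (by omega)
    -- Depending on which bar-neighbours of the interior vertex belong to `S`, the set is centred at
    -- that vertex, at its predecessor or at its successor, or is a single vertex.
    by_cases h1 : P.p i (c - 1) ∈ S <;> by_cases h2 : P.p i (c + 1) ∈ S
    · right; left
      refine ⟨_, _, _, h1, h2, hadj1, hadj2, fun h => ?_, ?_, ?_, fun t ht => ?_⟩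
      · have := (P.p_inj (by omega) (by omega) h).2
        omega
      · rw [P.adj_p (by omega) (by omega)]; omega
      · exact fun r hr => eq_of_adj_interior hc0 hc hr
      · rcases hnear t ht with h | h | h | ⟨_, h⟩ | ⟨_, h⟩
        · exact Or.inl h
        · exact Or.inr (h ▸ hadj1.symm)
        · exact Or.inr (h ▸ hadj2)
        · refine Or.inl (eq_of_adj_prev hc0 hc h ?_)
          rcases hS t ht _ h2 with h3 | h3 | ⟨m, _, h3⟩
          · exact Or.inl h3
          · exact Or.inr (Or.inl h3)
          · exact Or.inr (Or.inr ⟨m, h3⟩)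
        · left
          rw [← hp1]
          refine P.swap.eq_of_adj_prev (i := i) (c := P.len i - c) (by omega)
            (show P.len i - c < P.len i by omega) (by rwa [hp2]) ?_
          rw [hp3]
          rcases hS t ht _ h1 with h3 | h3 | ⟨m, _, h3⟩
          · exact Or.inl h3
          · exact Or.inr (Or.inl h3)
          · exact Or.inr (Or.inr ⟨m, h3⟩)
    · rcases shape_of_prev_mem hc0 hc hpS h1 (fun t ht => by
        rcases hnear t ht with h | h | h | ⟨_, h⟩ | ⟨h, _⟩
        · exact Or.inl h
        · exact Or.inr (Or.inl h)
        · exact absurd (h ▸ ht) h2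
        · exact Or.inr (Or.inr h)
        · exact absurd h h2) with h | h | h
      · exact Or.inl h
      · exact Or.inr (Or.inl h)
      · exact Or.inr (Or.inr (Or.inl ⟨i, h⟩))
    · rcases P.swap.shape_of_prev_mem (S := S) (i := i) (c := P.len i - c) (by omega)
        (show P.len i - c < P.len i by omega) (by rwa [hp1]) (by rwa [hp2]) (fun t ht => by
        rw [hp1, hp2]
        rcases hnear t ht with h | h | h | ⟨h, _⟩ | ⟨_, h⟩
        · exact Or.inl h
        · exact absurd (h ▸ ht) h1
        · exact Or.inr (Or.inl h)
        · exact absurd h h1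
        · exact Or.inr (Or.inr h)) with h | h | h
      · exact Or.inl h
      · exact Or.inr (Or.inl h)
      · exact Or.inr (Or.inr (Or.inr ⟨i, h⟩))
    · refine Or.inl ⟨P.p i c, P.p i c, Or.inl rfl, fun t ht => ?_⟩
      rcases hnear t ht with h | h | h | ⟨h, _⟩ | ⟨h, _⟩
      · exact Or.inl h
      · exact absurd (h ▸ ht) h1
      · exact absurd (h ▸ ht) h2
      · exact absurd h h1
      · exact absurd h h2
  · have hsides : ∀ t ∈ S, t ∈ P.sideA ∨ t ∈ P.sideB := by
      intro t ht
      rcases P.cover t with ⟨i, d, hd, rfl⟩ | ⟨hA, rfl⟩ | ⟨hB, rfl⟩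
      · by_cases h0 : d = 0
        · exact Or.inl (h0 ▸ P.p_zero_mem i)
        by_cases hl : d = P.len i
        · exact Or.inr (hl ▸ P.p_len_mem i)
        exact absurd ⟨i, d, by omega, by omega, ht⟩ hint
      · exact Or.inl (Or.inr ⟨hA, rfl⟩)
      · exact Or.inr (Or.inr ⟨hB, rfl⟩)
    by_contra hcon
    simp only [not_or, Set.not_subset] at hcon
    obtain ⟨⟨v, hvS, hv⟩, ⟨u, huS, hu⟩, -⟩ := hcon
    have hu' := (hsides u huS).resolve_right hu
    have hv' := (hsides v hvS).resolve_left hv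
    -- Members on opposite sides could only have as common neighbour the middle of a bar of length
    -- two, which would be an interior vertex in `S`.
    rcases hS u huS v hvS with h | h | ⟨m, hm, h1, h2⟩
    · exact P.ne_of_sides hu' hv' h
    · exact P.not_adj_sides hu' hv' h
    · obtain ⟨i, h3, -, -, rfl⟩ := P.eq_of_common_neighbor hu' hv' h1 h2
      exact hint ⟨i, 1, by omega, by omega, hm⟩

end FramePresentation

theorem Set.not_three_le_encard_of_subset_pair {S : Type*} {s : Set S} {a b : S}
    (h : ∀ x ∈ s, x = a ∨ x = b) : ¬ 3 ≤ s.encard := by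
  intro h3
  have h1 : s.encard ≤ ({a, b} : Set S).encard := Set.encard_le_encard h
  have h2 := (h3.trans h1).trans (Set.encard_insert_le {b} a)
  rw [Set.encard_singleton] at h2
  norm_num at h2

/-! ### Outside vertices of a blow-up of a frame. -/

namespace IsAttachment

variable {T V : Type*} {F : SimpleGraph T} {G : SimpleGraph V} {k ℓ : ℕ} {X : T → Set V}
  {f : T → V} {x : V} {P : FramePresentation F k ℓ}

open FramePresentation

/-- This instantiates `complete_step` with a hole through `r'`, `p i 0`, `p i 1` in which `r` has no
neighbours other than `r'` and `p i 0`. -/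
theorem complete_step_side (H : IsAttachment F G ℓ X f x) {i : Fin k}
    (hS : P.IsAttachedA {t | Meets G X x t} i) {r r' : T} (hr : r ∈ P.sideA) (hr' : r' ∈ P.sideA)
    (hir : F.Adj (P.p i 0) r) (hir' : F.Adj (P.p i 0) r') (hrr' : F.Adj r r')
    (hmeet : Meets G X x r) : ∀ v ∈ X r', G.Adj x v := by
  have hℓ := P.seven_le
  have hi := P.two_le_len i
  have hcompl : ∀ u ∈ X r, ∀ v ∈ X r', G.Adj u v :=
    H.family.complete r r' hrr' (P.three_le_degree hir.symm hir' hrr')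
      (P.three_le_degree hir'.symm hir hrr'.symm)
  have hadj : F.Adj (P.p i 0) (P.p i 1) := P.adj_bar (by omega)
  have hr1 : r' ≠ P.p i 1 := fun e => p_notMem_sideA (by omega) (by omega) (e ▸ hr')
  have hmain : ∀ c, IsCyclePattern F ℓ c → P.Through c i → (∃ n < ℓ, c n = r') →
      (∀ n < ℓ, c n = P.p i 0 ∨ c n = r' ∨ (r ≠ c n ∧ ¬ F.Adj r (c n))) →
      ∀ v ∈ X r', G.Adj x v := by
    intro c hc h1 h2 h3
    obtain ⟨q, hq, hq0, hq1, hq2, hqc⟩ := hc.exists_start_three (by omega) h2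
      (h1 0 (by omega)) (h1 1 (by omega)) hir'.symm hadj hr1
    refine H.complete_step hS.near hS.mem hmeet hcompl hq hq0 hq1 hq2 fun n hn1 hn2 => ?_
    obtain ⟨n', hn', e⟩ := hqc n (by omega)
    rcases h3 n' hn' with h4 | h4 | h4
    · exact absurd (hq0.trans (e.trans h4).symm) (hq.ne (by omega) (by omega) (by omega))
    · exact absurd (hq2.trans (e.trans h4).symm).symm
        (hq.ne (by omega) (show n < ℓ - 1 by omega) (by omega))
    · rwa [e]
  have hbar : ∀ d ≤ P.len i, P.p i d = P.p i 0 ∨ (r ≠ P.p i d ∧ ¬ F.Adj r (P.p i d)) := by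
    intro d hd
    by_cases hd0 : d = 0
    · exact Or.inl (by rw [hd0])
    · refine Or.inr ⟨fun e => p_notMem_sideA hd hd0 (e ▸ hr), fun h => ?_⟩
      rcases P.eq_of_adj_sideA hr hd h with h | ⟨-, h⟩
      · exact hd0 h
      · exact hir.ne h.symm
  rcases hr' with ⟨h, rfl⟩ | ⟨hA, rfl⟩
  · have hih : P.A.Adj i h := adj_zero.1 hir'
    obtain ⟨c, hc, h1, h2, -, h3⟩ := exists_ring_link (u := r) hih.ne fun h' => absurd hih h'
    refine hmain c hc h1 (h2 0 (Nat.zero_le _)) fun n hn => ?_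
    rcases h3 n hn with ⟨d, hd, e⟩ | ⟨d, hd, e⟩ | ⟨h4, -⟩ | h4
    · rw [e]
      rcases hbar d hd with h4 | h4
      · exact Or.inl h4
      · exact Or.inr (Or.inr h4)
    · rw [e]
      by_cases hd0 : d = 0
      · exact Or.inr (Or.inl (by rw [hd0]))
      · refine Or.inr (Or.inr ⟨fun e => p_notMem_sideA hd hd0 (e ▸ hr), fun h => ?_⟩)
        rcases P.eq_of_adj_sideA hr hd h with h | ⟨-, h⟩
        · exact hd0 h
        · exact hrr'.ne h
    · exact absurd hih h4
    · exact Or.inr (Or.inr ⟨P.ne_of_sides hr h4, P.not_adj_sides hr h4⟩)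
  · obtain ⟨j, rfl⟩ := eq_of_adj_α hA hrr'.symm
    have hij : P.A.Adj i j := adj_zero.1 hir
    -- When `r'` is the apex, the ring returns through the bar of an isolated vertex `e`, whose end
    -- is not adjacent to `r`.
    obtain ⟨e, he⟩ := P.isoA hA
    have hie : i ≠ e := fun h => he j (h ▸ hij)
    have hje : j ≠ e := fun h => he i (h ▸ hij.symm)
    have hie' : ¬ P.A.Adj i e := fun h => he i h.symm
    obtain ⟨c, hc, h1, h2, h2', h3⟩ := exists_ring_link hie fun _ => isLinkA_α hA i e
    refine hmain c hc h1 (h2' hie') fun n hn => ?_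
    rcases h3 n hn with ⟨d, hd, e'⟩ | ⟨d, hd, e'⟩ | ⟨-, h4⟩ | h4
    · rw [e']
      rcases hbar d hd with h4 | h4
      · exact Or.inl h4
      · exact Or.inr (Or.inr h4)
    · rw [e']
      have hne : P.p j 0 ≠ P.p e 0 := fun h =>
        hje (P.p_inj (Nat.zero_le _) (Nat.zero_le _) h).1
      refine Or.inr (Or.inr ⟨fun h => hje (P.p_inj (Nat.zero_le _) hd h).1, fun h => ?_⟩)
      rcases P.eq_of_adj_sideA hr hd h with h' | ⟨-, h'⟩
      · subst h'
        exact he j (adj_zero.1 h).symm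
      · exact hne h'
    · exact Or.inr (Or.inl h4)
    · exact Or.inr (Or.inr ⟨P.ne_of_sides hr h4, P.not_adj_sides hr h4⟩)

open Classical in
-- Completeness passes from the one met bag in `A⁺` to that of a vertex `d` adjacent to all the rest
-- of `A⁺`, and from there to the bag of every other neighbour of the end. A second such neighbour
-- carries it back to the bag of `d`.
theorem isBlowUpFamily_insert_end (H : IsAttachment F G ℓ X f x) {i : Fin k}
    (hS : P.IsAttachedA {t | Meets G X x t} i) :
    IsBlowUpFamily F G (Function.update X (P.p i 0) (insert x (X (P.p i 0)))) := by
  have hi := P.two_le_len i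
  have hadj : F.Adj (P.p i 0) (P.p i 1) := P.adj_bar (by omega)
  have hmeet_of : ∀ r, (∀ v ∈ X r, G.Adj x v) → Meets G X x r := fun r h => by
    obtain ⟨v, hv⟩ := H.family.nonempty r
    exact ⟨v, hv, h v hv⟩
  obtain ⟨t, htS, ht, hit⟩ := hS.exists_side
  have hd : ∃ d ∈ P.sideA, F.Adj (P.p i 0) d ∧ ∀ r ∈ P.sideA, r ≠ d → F.Adj d r := by
    by_cases hA : P.hasA
    · refine ⟨P.α, Or.inr ⟨hA, rfl⟩, ((P.adj_α hA (Nat.zero_le _)).2 rfl).symm, ?_⟩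
      rintro r (⟨j, rfl⟩ | ⟨_, rfl⟩) hr
      · exact (P.adj_α hA (Nat.zero_le _)).2 rfl
      · exact absurd rfl hr
    · obtain ⟨d, hdi, hd⟩ := P.domA hA i
      refine ⟨P.p d 0, P.p_zero_mem d, (adj_zero.2 (hd i hdi.symm)).symm, ?_⟩
      rintro r (⟨j, rfl⟩ | ⟨hA', _⟩) hr
      · exact adj_zero.2 (hd j fun h => hr (by rw [h]))
      · exact absurd hA' hA
  obtain ⟨d, hd, hid, hdom⟩ := hd
  have hdS : Meets G X x d := by
    by_cases htd : t = d
    · exact htd ▸ htS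
    · exact hmeet_of d (H.complete_step_side hS ht hd hit hid (hdom t ht htd).symm htS)
  have key : ∀ r ∈ P.sideA, F.Adj (P.p i 0) r →
      (∃ r' ∈ P.sideA, F.Adj (P.p i 0) r' ∧ r' ≠ r) → ∀ v ∈ X r, G.Adj x v := by
    rintro r hr hir ⟨r', hr', hir', hne⟩
    by_cases hrd : r = d
    · subst hrd
      have h1 := hdom r' hr' hne
      exact H.complete_step_side hS hr' hr hir' hir h1.symm
        (hmeet_of r' (H.complete_step_side hS hr hr' hir hir' h1 hdS))
    · exact H.complete_step_side hS hd hr hid hir (hdom r hr hrd) hdS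
  refine H.isBlowUpFamily_insert (fun s m t h1 h2 h3 h4 => P.exists_hole_through_path h1 h2 h3 h4)
    (fun s m t h1 h2 h3 => P.three_le_degree h1 h2 h3) hS.near ?_ ?_ ?_
  · intro r hr
    rcases P.eq_of_adj_zero hr with rfl | hr'
    · exact hS.mem
    · by_cases hrt : r = t
      · exact hrt ▸ htS
      · exact hmeet_of r (key r hr' hr ⟨t, ht, hit, Ne.symm hrt⟩)
  · refine ⟨_, t, hadj.symm, hit, fun e => ?_, fun h => ?_⟩
    · exact p_notMem_sideA (by omega) (by omega) (e ▸ ht)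
    · rcases P.eq_of_adj_sideA ht (by omega) h.symm with h | ⟨-, h⟩
      · omega
      · exact hit.ne h.symm
  · intro r hr h3 h3'
    rcases P.eq_of_adj_zero hr with rfl | hr'
    · exact absurd h3' (Set.not_three_le_encard_of_subset_pair fun s hs =>
        eq_of_adj_interior (by omega) (by omega) hs)
    · refine key r hr' hr ?_
      by_contra hcon
      push Not at hcon
      refine Set.not_three_le_encard_of_subset_pair (a := P.p i 1) (b := r) (fun s hs => ?_) h3
      rcases P.eq_of_adj_zero hs with rfl | hs'
      · exact Or.inl rfl
      · exact Or.inr (hcon s hs' hs)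

open Classical in
-- The point is completeness to the bag of each `p j 0` of degree at least three. Such a `j` has an
-- `A`-neighbour `h`, and `complete_step` applies to a ring through the apex, bar `j` and the bar of
-- an isolated vertex, on which `p h 0` sees only the apex and `p j 0`.
theorem isBlowUpFamily_insert_apex (H : IsAttachment F G ℓ X f x) (hA : P.hasA)
    (hside : {t | Meets G X x t} ⊆ P.sideA) (hall : ∀ i, Meets G X x (P.p i 0)) :
    IsBlowUpFamily F G (Function.update X P.α (insert x (X P.α))) := by
  have hℓ := P.seven_le
  obtain ⟨e, he⟩ := P.isoA hA
  have hα : ∀ i, F.Adj P.α (P.p i 0) := fun i => (P.adj_α hA (Nat.zero_le _)).2 rfl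
  have hne : ∀ {i j}, i ≠ j → P.p i 0 ≠ P.p j 0 := fun hij h =>
    hij (P.p_inj (Nat.zero_le _) (Nat.zero_le _) h).1
  obtain ⟨j0, hj0⟩ := P.exists_ne_of_three_le e
  have hej0 : ¬ F.Adj (P.p e 0) (P.p j0 0) := fun h => he j0 (adj_zero.1 h)
  have hsupp : ∀ t, Meets G X x t → t = P.α ∨ F.Adj P.α t := by
    intro t ht
    rcases hside ht with ⟨i, rfl⟩ | ⟨-, rfl⟩
    · exact Or.inr (hα i)
    · exact Or.inl rfl
  refine H.isBlowUpFamily_insert (fun s m t h1 h2 h3 h4 => P.exists_hole_through_path h1 h2 h3 h4)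
    (fun s m t h1 h2 h3 => P.three_le_degree h1 h2 h3) hsupp ?_
    ⟨_, _, (hα e).symm, hα j0, hne hj0, hej0⟩ ?_
  · intro t ht
    obtain ⟨i, rfl⟩ := eq_of_adj_α hA ht
    exact hall i
  · intro r hr _ h3'
    obtain ⟨j, rfl⟩ := eq_of_adj_α hA hr
    have hh : ∃ h, P.A.Adj j h := by
      by_contra hcon
      push Not at hcon
      refine Set.not_three_le_encard_of_subset_pair (a := P.p j 1) (b := P.α) (fun s hs => ?_) h3'
      rcases P.eq_of_adj_zero hs with rfl | ⟨h, rfl⟩ | ⟨-, rfl⟩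
      · exact Or.inl rfl
      · exact absurd (adj_zero.1 hs) (hcon h)
      · exact Or.inr rfl
    obtain ⟨h, hjh⟩ := hh
    have hej : e ≠ j := fun h' => he h (h' ▸ hjh)
    have heh : e ≠ h := fun h' => he j (h' ▸ hjh.symm)
    have hhj : F.Adj (P.p h 0) (P.p j 0) := adj_zero.2 hjh.symm
    obtain ⟨c, hc, h1, h2, h4, h5⟩ := exists_ring_link hej fun _ => isLinkA_α hA e j
    obtain ⟨q, hq, hq0, hq1, hq2, hqc⟩ := hc.exists_start_three (by omega) (h2 0 (Nat.zero_le _))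
      (h4 (he j)) (h1 0 (Nat.zero_le _)) hr.symm (hα e) (hne hej.symm)
    refine H.complete_step hsupp (hall e) (hall h) ?_ hq hq0 hq1 hq2 fun n hn1 hn2 => ?_
    · exact H.family.complete _ _ hhj (P.three_le_degree (hα h).symm (hα j) hhj)
        (P.three_le_degree (hα j).symm (hα h) hhj.symm)
    obtain ⟨n', hn', e'⟩ := hqc n (by omega)
    have hnα : q n ≠ P.α := fun h' =>
      hq.ne (by omega) (show 0 < n by omega) (by omega) (hq0.trans h'.symm)
    have hnj : q n ≠ P.p j 0 := fun h' =>
      hq.ne (by omega) (show n < ℓ - 1 by omega) (by omega) (h'.trans hq2.symm)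
    rw [e'] at hnα hnj ⊢
    rcases h5 n' hn' with ⟨d, hd, h6⟩ | ⟨d, hd, h6⟩ | ⟨-, h6⟩ | h6
    · rw [h6]
      refine ⟨fun h7 => heh (P.p_inj (Nat.zero_le _) hd h7).1.symm, fun h7 => ?_⟩
      rcases P.eq_of_adj_sideA (P.p_zero_mem h) hd h7 with rfl | ⟨-, h8⟩
      · exact he h (adj_zero.1 h7).symm
      · exact hne heh h8.symm
    · rw [h6] at hnj ⊢
      refine ⟨fun h7 => hjh.ne (P.p_inj (Nat.zero_le _) hd h7).1.symm, fun h7 => ?_⟩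
      rcases P.eq_of_adj_sideA (P.p_zero_mem h) hd h7 with rfl | ⟨-, h8⟩
      · exact hnj rfl
      · exact hhj.ne h8
    · exact absurd h6 hnα
    · exact ⟨P.ne_of_sides (P.p_zero_mem h) h6, P.not_adj_sides (P.p_zero_mem h) h6⟩

open Classical in
/-- The neighbours of a vertex outside of a blow-up of a frame to which no vertex can be added. -/
theorem neighbors_of_maximal (H : IsAttachment F G ℓ X f x) (P : FramePresentation F k ℓ)
    (hmax : ∀ m, ¬ IsBlowUpFamily F G (Function.update X m (insert x (X m)))) :
    G.IsClique {y | G.Adj x y ∧ ∃ t, y ∈ X t} ∨ (∀ t, ∀ y ∈ X t, G.Adj x y) ∨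
      ((∀ t, Meets G X x t → t ∈ P.sideA) ∧ (P.hasA → ∃ i, ¬ Meets G X x (P.p i 0))) ∨
      ((∀ t, Meets G X x t → t ∈ P.sideB) ∧ (P.hasB → ∃ i, ¬ Meets G X x (P.p i (P.len i)))) := by
  have hℓ := P.seven_le
  by_cases hfull : ∃ c, P.IsRing c ∧ ∃ g, IsTransversal F G X g ∧ ∀ n < ℓ, G.Adj x (g (c n))
  · right; left
    obtain ⟨c, ⟨-, i, j, hij, hi, hj⟩, g, hg, hgx⟩ := hfull
    have hclosed : IsFarClosed F ℓ {t | G.Adj x (g t)} := by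
      rintro c' hc' s hs t ht ⟨a, ha, rfl⟩ ⟨b, hb, rfl⟩ hfar n hn
      exact H.full_of_far hc' hg ha hb hs ht hfar.1 hfar.2.1 hfar.2.2 n hn
    refine H.complete_of_transversal (fun t => ?_) hg
      (mem_of_isFarClosed hclosed hij (containsBar_of_through (c := c) hgx hi)
        (containsBar_of_through (c := c) hgx hj))
    obtain ⟨c, hc, h1, -⟩ := P.exists_ring_pair t t
    exact ⟨c, hc.1, h1⟩
  -- No ring has a copy in the neighbourhood of `x`, so `common_neighbor` applies to every pair of
  -- met bags, each pair lying in some ring.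
  · have hS : ∀ s ∈ {t | Meets G X x t}, ∀ t ∈ {t | Meets G X x t},
        s = t ∨ F.Adj s t ∨ ∃ m ∈ {t | Meets G X x t}, F.Adj s m ∧ F.Adj m t := by
      intro s hs t ht
      obtain ⟨c, hc, ⟨a, ha, rfl⟩, b, hb, rfl⟩ := P.exists_ring_pair s t
      exact H.common_neighbor hc.1 (fun g hg h => hfull ⟨c, hc, g, hg, h⟩) ha hb hs ht
    rcases P.shape_of_common_neighbors hS with h | h | ⟨s, m, h, h'⟩ | h | ⟨i, h⟩ | ⟨i, h⟩
    · right; right; left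
      refine ⟨fun t ht => h ht, fun hA => ?_⟩
      by_contra hcon
      push Not at hcon
      exact hmax _ (H.isBlowUpFamily_insert_apex hA h hcon)
    · right; right; right
      refine ⟨fun t ht => h ht, fun hB => ?_⟩
      by_contra hcon
      push Not at hcon
      exact hmax _ (H.isBlowUpFamily_insert_apex (P := P.swap) hB h hcon)
    · left
      refine H.isClique_of_meets_edge h' h fun hms => ?_
      obtain ⟨c, hc, h1, h2⟩ := P.exists_ring_pair m s
      obtain ⟨q, hq, hq0, hq1, -⟩ := hc.1.exists_start_two (by omega) h1 h2 hms
      exact ⟨q, hq, hq0, hq1⟩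
    · obtain ⟨s, m, t, hs, ht, hsm, hmt, hst, hst', hnb, hnear⟩ := h
      refine absurd (H.isBlowUpFamily_insert
        (fun s m t h1 h2 h3 h4 => P.exists_hole_through_path h1 h2 h3 h4)
        (fun s m t h1 h2 h3 => P.three_le_degree h1 h2 h3) hnear (fun r hr => ?_)
        ⟨s, t, hsm, hmt, hst, hst'⟩ fun r hr h3 _ => ?_) (hmax m)
      · rcases hnb r hr with rfl | rfl
        · exact hs
        · exact ht
      · exact absurd h3 (Set.not_three_le_encard_of_subset_pair hnb)
    · exact absurd (H.isBlowUpFamily_insert_end h) (hmax _)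
    · exact absurd (H.isBlowUpFamily_insert_end h) (hmax _)

end IsAttachment

/-! ### Threshold graphs: dominating and isolated vertices. -/

namespace IsThreshold

variable {V : Type*} {G : SimpleGraph V}

/-- Private neighbours `w` of `u` and `w'` of `v` would induce a four-cycle, a four-vertex path or a
two-edge matching, according to the adjacency of `u`, `v` and of `w`, `w'`. -/
theorem nested (h : IsThreshold G) (u v : V) :
    (∀ w, w ≠ v → G.Adj u w → G.Adj v w) ∨ (∀ w, w ≠ u → G.Adj v w → G.Adj u w) := by
  by_contra hcon
  push Not at hcon
  obtain ⟨⟨w, hwv, huw, hvw⟩, w', hwu, hvw', huw'⟩ := hcon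
  have huv : u ≠ v := by rintro rfl; exact hvw huw
  have hww : w ≠ w' := by rintro rfl; exact hvw hvw'
  have h1 := huw.ne
  have h2 := hvw'.ne
  have hpath : ∀ a b c d : V, G.Adj a b → G.Adj b c → G.Adj c d → ¬ G.Adj a c → ¬ G.Adj a d →
      ¬ G.Adj b d → a ≠ c → a ≠ d → b ≠ d → False := by
    intro a b c d hab hbc hcd hac had hbd nac nad nbd
    refine h.1 ⟨⟨⟨![a, b, c, d], ?_⟩, ?_⟩⟩
    · have := hab.ne
      have := hbc.ne
      have := hcd.ne
      intro i j
      fin_cases i <;> fin_cases j <;> simp_all [eq_comm]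
    · intro i j
      rw [SimpleGraph.pathGraph_adj]
      change G.Adj (![a, b, c, d] i) (![a, b, c, d] j) ↔ _
      fin_cases i <;> fin_cases j <;> simp_all [G.adj_comm]
  by_cases ha : G.Adj u v <;> by_cases hb : G.Adj w w'
  · exact h.2.1 (SimpleGraph.cycleGraph_four_isIndContained huw.symm ha hvw' hb.symm
      (fun e => hvw e.symm) huw' hwv hwu.symm)
  · exact hpath w u v w' huw.symm ha hvw' (fun e => hvw e.symm) hb huw' hwv hww hwu.symm
  · exact hpath u w w' v huw hb hvw'.symm huw' ha (fun e => hvw e.symm) hwu.symm huv hwv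
  · refine h.2.2 ?_
    obtain ⟨φ⟩ := SimpleGraph.cycleGraph_four_isIndContained (G := Gᶜ) ⟨huv, ha⟩ ⟨hwv.symm, hvw⟩ ⟨hww, hb⟩
      ⟨hwu, fun e => huw' e.symm⟩ (fun e => e.2 huw) (fun e => e.2 hvw') h1 h2
    have := SimpleGraph.Embedding.complEquiv φ
    rw [compl_compl] at this
    exact ⟨this⟩

/-- Choose `v` greatest in the neighbourhood preorder. If `v` misses some `w`, then `w` is isolated:
a neighbour of `w` is below `v`, which would make `w` adjacent to `v`. -/
theorem exists_dominating_or_isolated [Finite V] [Nonempty V] (h : IsThreshold G) :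
    ∃ v, (∀ w, w ≠ v → G.Adj v w) ∨ ∀ w, ¬ G.Adj v w := by
  let below : V → Set V := fun v => {u | ∀ w, w ≠ v → G.Adj u w → G.Adj v w}
  have htrans : ∀ u v t, u ∈ below v → v ∈ below t → u ∈ below t := by
    intro u v t huv hvt w hwt huw
    by_cases hwv : w = v
    · subst hwv
      by_cases hut : u = t
      · exact hut ▸ huw
      · have h1 : G.Adj t u := hvt u hut huw.symm
        exact (huv t hwt.symm h1.symm).symm
    · exact hvt w hwt (huv w hwv huw)
  obtain ⟨v, hv⟩ := Finite.exists_max fun v => (below v).ncard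
  have hmax : ∀ u, u ∈ below v := by
    intro u
    by_contra hu
    have hvu : v ∈ below u := (h.nested u v).resolve_left hu
    have hlt : below v ⊂ below u := by
      refine ⟨fun t ht => htrans t v u ht hvu, fun hsub => hu (hsub ?_)⟩
      exact fun _ _ h => h
    exact absurd (Set.ncard_lt_ncard hlt (Set.toFinite _)) (not_lt.2 (hv u))
  by_cases hdom : ∀ w, w ≠ v → G.Adj v w
  · exact ⟨v, Or.inl hdom⟩
  · push Not at hdom
    obtain ⟨w, hwv, hvw⟩ := hdom
    exact ⟨w, Or.inr fun u hwu => hvw (hmax u w hwv hwu.symm)⟩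

theorem induce (h : IsThreshold G) (s : Set V) : IsThreshold (G.induce s) := by
  have hs : (G.induce s).IsIndContained G := ⟨SimpleGraph.Embedding.induce s⟩
  exact ⟨fun h' => h.1 (h'.trans hs), fun h' => h.2.1 (h'.trans hs), fun h' => h.2.2 (h'.trans hs)⟩

end IsThreshold

theorem SimpleGraph.connected_of_dominating {V : Type*} {G : SimpleGraph V} {v : V}
    (h : ∀ w, w ≠ v → G.Adj v w) : G.Connected := by
  rw [SimpleGraph.connected_iff_exists_forall_reachable]
  refine ⟨v, fun w => ?_⟩
  by_cases hw : w = v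
  · exact hw ▸ SimpleGraph.Reachable.refl _
  · exact (h w hw).reachable

theorem IsThreshold.exists_isolated {k : ℕ} (hk : 3 ≤ k) {A : SimpleGraph (Fin k)}
    (h : IsThreshold A) (hA : ¬ A.Connected) : ∃ e, ∀ j, ¬ A.Adj e j := by
  have : Nonempty (Fin k) := ⟨⟨0, by omega⟩⟩
  obtain ⟨v, hv | hv⟩ := h.exists_dominating_or_isolated
  · exact absurd (SimpleGraph.connected_of_dominating hv) hA
  · exact ⟨v, hv⟩

/-- If the dominating vertex found is `i` itself, its deletion leaves a connected threshold graph,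
whose dominating vertex also dominates the original graph. -/
theorem IsThreshold.exists_ne_dominating {k : ℕ} (hk : 3 ≤ k) {A : SimpleGraph (Fin k)}
    (h : IsThreshold A) (h2 : IsTwoConnected A) (i : Fin k) :
    ∃ d, d ≠ i ∧ ∀ j, j ≠ d → A.Adj d j := by
  have : Nonempty (Fin k) := ⟨⟨0, by omega⟩⟩
  obtain ⟨v, hv | hv⟩ := h.exists_dominating_or_isolated
  · by_cases hvi : v = i
    · subst hvi
      have hconn := h2.2.2 v
      have := hconn.nonempty
      obtain ⟨d, hd | hd⟩ := (h.induce {v}ᶜ).exists_dominating_or_isolated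
      · refine ⟨d, d.2, fun j hj => ?_⟩
        by_cases hjv : j = v
        · exact hjv ▸ (hv d d.2).symm
        · exact hd ⟨j, hjv⟩ fun e => hj (congrArg Subtype.val e)
      · have hnt : Nontrivial ({v}ᶜ : Set (Fin k)) := by
          have hcard : ∃ a b : Fin k, a ≠ v ∧ b ≠ v ∧ a ≠ b := by
            by_cases h0 : v.val = 0
            · exact ⟨⟨1, by omega⟩, ⟨2, by omega⟩, by simp [Fin.ext_iff, h0],
                by simp [Fin.ext_iff, h0], by simp⟩
            · by_cases h1 : v.val = 1
              · exact ⟨⟨0, by omega⟩, ⟨2, by omega⟩, by simp [Fin.ext_iff, h1],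
                  by simp [Fin.ext_iff, h1], by simp⟩
              · exact ⟨⟨0, by omega⟩, ⟨1, by omega⟩, by simp [Fin.ext_iff]; omega,
                  by simp [Fin.ext_iff]; omega, by simp⟩
          obtain ⟨a, b, ha, hb, hab⟩ := hcard
          exact ⟨⟨a, ha⟩, ⟨b, hb⟩, fun e => hab (congrArg Subtype.val e)⟩
        obtain ⟨j, hj⟩ := hconn.preconnected.exists_adj_of_nontrivial d
        exact absurd hj (hd j)
    · exact ⟨v, hvi, hv⟩
  · exact absurd h2.2.1 (FrameData.not_connected_of_isolated hk A v hv)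

/-! ### Odd and even frames satisfy the presentation. -/

namespace FrameData

variable {k ℓ : ℕ}

/-- The properties of a frame which are needed for its presentation. -/
structure IsRegular (D : FrameData k) (ℓ : ℕ) : Prop where
  three_le : 3 ≤ k
  two_le_len : ∀ i, 2 ≤ D.len i
  length : ∀ i j, i ≠ j → ∀ u v : ℕ, (D.A.Adj i j ∧ u = 0) ∨ (¬ D.A.Adj i j ∧ u = 1) →
    (D.B.Adj i j ∧ v = 0) ∨ (¬ D.B.Adj i j ∧ v = 1) → D.len i + D.len j + 2 + u + v = ℓ
  domA : ¬ D.HasApexA → ∀ i, ∃ d, d ≠ i ∧ ∀ h, h ≠ d → D.A.Adj d h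
  domB : ¬ D.HasApexB → ∀ i, ∃ d, d ≠ i ∧ ∀ h, h ≠ d → D.B.Adj d h
  isoA : D.HasApexA → ∃ e, ∀ h, ¬ D.A.Adj e h
  isoB : D.HasApexB → ∃ e, ∀ h, ¬ D.B.Adj e h
  hasA_or_hasB : D.HasApexA ∨ D.HasApexB
  both : D.HasApexA → D.HasApexB → ∃ i j, i ≠ j ∧ ¬ D.A.Adj i j ∧ ¬ D.B.Adj i j
  short : ∀ i, 3 ≤ D.len i ∨ ∀ h, h ≠ i → ¬ D.A.Adj i h ∨ ¬ D.B.Adj i h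

/-- Here `A` and `B` are complementary: two bars need exactly one link, a dominating vertex of `A`
is isolated in `B`, and the two apexes never coexist, so `both` holds vacuously. -/
theorem IsOddFrame.isRegular {D : FrameData k} (h : D.IsOddFrame ℓ) (hℓ : 7 ≤ ℓ) :
    D.IsRegular ℓ where
  three_le := h.three_le
  two_le_len i := by have := h.len_eq i; omega
  length i j hij u v hu hv := by
    have h1 := h.len_eq i
    have h2 := h.len_eq j
    have h3 := h.adj_iff i j hij
    rcases hu with ⟨hu, rfl⟩ | ⟨hu, rfl⟩ <;> rcases hv with ⟨hv, rfl⟩ | ⟨hv, rfl⟩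
    · exact absurd hu (h3.1 hv)
    · omega
    · omega
    · exact absurd (h3.2 hu) hv
  domA hA i := h.thresholdA.exists_ne_dominating h.three_le
    (h.connA.resolve_left hA) i
  domB hB i := h.thresholdB.exists_ne_dominating h.three_le
    (h.connB.resolve_left hB) i
  isoA hA := h.thresholdA.exists_isolated h.three_le hA
  isoB hB := h.thresholdB.exists_isolated h.three_le hB
  hasA_or_hasB := by
    by_contra hcon
    rw [not_or] at hcon
    obtain ⟨d, -, hd⟩ := h.thresholdA.exists_ne_dominating h.three_le
      (h.connA.resolve_left hcon.1) ⟨0, by have := h.three_le; omega⟩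
    refine hcon.2 (not_connected_of_isolated h.three_le D.B d fun j hj => ?_)
    exact (h.adj_iff d j hj.ne).1 hj (hd j hj.ne')
  both hA hB := by
    obtain ⟨e, he⟩ := h.thresholdA.exists_isolated h.three_le hA
    exact absurd (SimpleGraph.connected_of_dominating fun w hw =>
      (h.adj_iff e w hw.symm).2 (he w)) hB
  short i := Or.inr fun j hj => by
    by_cases hA : D.A.Adj i j
    · exact Or.inr fun hB => (h.adj_iff i j hj.symm).1 hB hA
    · exact Or.inl hA

/-- Two short bars need two links, a short and a long bar one, two long bars none. As `ℓ ≥ 8`, long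
bars have length at least three. -/
theorem IsEvenFrameWith.isRegular {D : FrameData k} {I : Finset (Fin k)}
    (h : D.IsEvenFrameWith ℓ I) (hℓ : 7 ≤ ℓ) : D.IsRegular ℓ where
  three_le := h.three_le
  two_le_len i := by
    obtain ⟨r, hr⟩ := h.even
    by_cases hi : i ∈ I
    · have := h.len_short i hi; omega
    · have := h.len_long i hi; omega
  length i j hij u v hu hv := by
    by_cases hi : i ∈ I <;> by_cases hj : j ∈ I
    · have h1 := h.len_short i hi
      have h2 := h.len_short j hj
      have := h.stableA i hi j hj
      have := h.stableB i hi j hj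
      have : u = 1 := by tauto
      have : v = 1 := by tauto
      omega
    · have h1 := h.len_short i hi
      have h2 := h.len_long j hj
      have := h.adj_iff i hi j hj
      have : u + v = 1 := by
        rcases hu with ⟨hu, rfl⟩ | ⟨hu, rfl⟩ <;> rcases hv with ⟨hv, rfl⟩ | ⟨hv, rfl⟩ <;> tauto
      omega
    · have h1 := h.len_long i hi
      have h2 := h.len_short j hj
      have := h.adj_iff j hj i hi
      rw [D.A.adj_comm, D.B.adj_comm] at this
      have : u + v = 1 := by
        rcases hu with ⟨hu, rfl⟩ | ⟨hu, rfl⟩ <;> rcases hv with ⟨hv, rfl⟩ | ⟨hv, rfl⟩ <;> tauto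
      omega
    · have h1 := h.len_long i hi
      have h2 := h.len_long j hj
      have := h.cliqueA i hi j hj hij
      have := h.cliqueB i hi j hj hij
      have : u = 0 := by tauto
      have : v = 0 := by tauto
      omega
  domA hA := absurd h.hasApexes.1 hA
  domB hB := absurd h.hasApexes.2 hB
  isoA _ := by
    obtain ⟨i, -, hi⟩ := h.isolatedA
    exact ⟨i, hi⟩
  isoB _ := by
    obtain ⟨i, -, hi⟩ := h.isolatedB
    exact ⟨i, hi⟩
  hasA_or_hasB := Or.inl h.hasApexes.1
  both _ _ := by
    obtain ⟨i, hi, j, hj, hij⟩ := Finset.one_lt_card.1 h.two_le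
    exact ⟨i, j, hij, h.stableA i hi j hj, h.stableB i hi j hj⟩
  short i := by
    obtain ⟨r, hr⟩ := h.even
    by_cases hi : i ∈ I
    · refine Or.inr fun j _ => ?_
      by_cases hj : j ∈ I
      · exact Or.inl (h.stableA i hi j hj)
      · by_cases hA : D.A.Adj i j
        · exact Or.inr fun hB => (h.adj_iff i hi j hj).1 hB hA
        · exact Or.inl hA
    · have := h.len_long i hi
      exact Or.inl (by omega)

theorem IsFrame.isRegular {D : FrameData k} (h : D.IsFrame ℓ) (hℓ : 7 ≤ ℓ) : D.IsRegular ℓ := by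
  rcases h with h | ⟨I, h⟩
  · exact h.isRegular hℓ
  · exact h.isRegular hℓ

/-- The vertex in position `c` of the bar `P_i`, or its last vertex if there is no such position. -/
def barVertex (D : FrameData k) (i : Fin k) (c : ℕ) : D.Vertex :=
  .bar i ⟨min c (D.len i), Nat.lt_succ_of_le (min_le_right _ _)⟩

/-- The bar and the position of a vertex which is not an apex. -/
def barPosition (D : FrameData k) : D.Vertex → Option (Fin k × ℕ)
  | .bar i j => some (i, j)
  | .apexA _ => none
  | .apexB _ => none

variable {D : FrameData k}

theorem barPosition_barVertex {i : Fin k} {c : ℕ} (hc : c ≤ D.len i) :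
    D.barPosition (D.barVertex i c) = some (i, c) := by
  simp [barPosition, barVertex, hc]

theorem barVertex_val (i : Fin k) (j : Fin (D.len i + 1)) : D.barVertex i j = .bar i j := by
  have : min j.val (D.len i) = j.val := min_eq_left (by omega)
  simp [barVertex, this]

theorem barVertex_zero (i : Fin k) : D.barVertex i 0 = D.a i := barVertex_val i 0

theorem barVertex_len (i : Fin k) : D.barVertex i (D.len i) = D.b i := barVertex_val i (Fin.last _)

theorem barVertex_inj {i j : Fin k} {c d : ℕ} (hc : c ≤ D.len i) (hd : d ≤ D.len j)
    (h : D.barVertex i c = D.barVertex j d) : i = j ∧ c = d := by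
  have := congrArg D.barPosition h
  rw [barPosition_barVertex hc, barPosition_barVertex hd] at this
  simpa using this

theorem edge_barVertex {i j : Fin k} {c d : ℕ} (hc : c ≤ D.len i) (hd : d ≤ D.len j) :
    D.Edge (D.barVertex i c) (D.barVertex j d) ↔ (i = j ∧ d = c + 1) ∨
      (c = 0 ∧ d = 0 ∧ D.A.Adj i j) ∨ (c = D.len i ∧ d = D.len j ∧ D.B.Adj i j) := by
  constructor
  · intro h
    have h1 := barPosition_barVertex hc
    have h2 := barPosition_barVertex hd
    generalize D.barVertex i c = s at h h1
    generalize D.barVertex j d = t at h h2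
    cases h with
    | bar i' n =>
      simp only [barPosition, Option.some.injEq, Prod.mk.injEq] at h1 h2
      obtain ⟨rfl, rfl⟩ := h1
      obtain ⟨rfl, rfl⟩ := h2
      exact Or.inl ⟨rfl, by simp⟩
    | sideA i' j' h =>
      simp only [barPosition, FrameData.a, Option.some.injEq, Prod.mk.injEq] at h1 h2
      obtain ⟨rfl, rfl⟩ := h1
      obtain ⟨rfl, rfl⟩ := h2
      exact Or.inr (Or.inl ⟨by simp, by simp, h⟩)
    | sideB i' j' h =>
      simp only [barPosition, FrameData.b, Option.some.injEq, Prod.mk.injEq] at h1 h2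
      obtain ⟨rfl, rfl⟩ := h1
      obtain ⟨rfl, rfl⟩ := h2
      exact Or.inr (Or.inr ⟨by simp, by simp, h⟩)
    | apexA h i' => simp [barPosition] at h1
    | apexB h i' => simp [barPosition] at h1
  · rintro (⟨rfl, rfl⟩ | ⟨rfl, rfl, h⟩ | ⟨rfl, rfl, h⟩)
    · have := Edge.bar (D := D) i ⟨c, by omega⟩
      rw [← barVertex_val, ← barVertex_val] at this
      exact this
    · rw [barVertex_zero, barVertex_zero]; exact .sideA i j h
    · rw [barVertex_len, barVertex_len]; exact .sideB i j h

theorem apexedFrame_adj {s t : D.Vertex} :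
    D.apexedFrame.Adj s t ↔ s ≠ t ∧ (D.Edge s t ∨ D.Edge t s) := SimpleGraph.fromRel_adj _ _ _

theorem adj_barVertex {i j : Fin k} {c d : ℕ} (hc : c ≤ D.len i) (hd : d ≤ D.len j) :
    D.apexedFrame.Adj (D.barVertex i c) (D.barVertex j d) ↔
      (i = j ∧ (d = c + 1 ∨ c = d + 1)) ∨ (c = 0 ∧ d = 0 ∧ D.A.Adj i j) ∨
        (c = D.len i ∧ d = D.len j ∧ D.B.Adj i j) := by
  rw [apexedFrame_adj, edge_barVertex hc hd, edge_barVertex hd hc, D.A.adj_comm j i,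
    D.B.adj_comm j i]
  constructor
  · rintro ⟨-, (⟨rfl, h⟩ | ⟨h, h', h''⟩ | ⟨h, h', h''⟩) | (⟨rfl, h⟩ | ⟨h, h', h''⟩ | ⟨h, h', h''⟩)⟩
    · exact Or.inl ⟨rfl, Or.inl h⟩
    · exact Or.inr (Or.inl ⟨h, h', h''⟩)
    · exact Or.inr (Or.inr ⟨h, h', h''⟩)
    · exact Or.inl ⟨rfl, Or.inr h⟩
    · exact Or.inr (Or.inl ⟨h', h, h''⟩)
    · exact Or.inr (Or.inr ⟨h', h, h''⟩)
  · intro h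
    refine ⟨fun e => ?_, ?_⟩
    · obtain ⟨rfl, rfl⟩ := barVertex_inj hc hd e
      rcases h with ⟨-, h⟩ | ⟨-, -, h⟩ | ⟨-, -, h⟩
      · omega
      · exact h.ne rfl
      · exact h.ne rfl
    · rcases h with ⟨rfl, h | h⟩ | h | h
      · exact Or.inl (Or.inl ⟨rfl, h⟩)
      · exact Or.inr (Or.inl ⟨rfl, h⟩)
      · exact Or.inl (Or.inr (Or.inl h))
      · exact Or.inl (Or.inr (Or.inr h))

theorem adj_apexA (hA : D.HasApexA) {i : Fin k} {c : ℕ} (hc : c ≤ D.len i) :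
    D.apexedFrame.Adj (.apexA hA) (D.barVertex i c) ↔ c = 0 := by
  rw [apexedFrame_adj]
  constructor
  · rintro ⟨-, h⟩
    have h1 := barPosition_barVertex hc
    generalize D.barVertex i c = s at h h1
    rcases h with h | h
    · cases h with
      | apexA h i' =>
        simp only [barPosition, FrameData.a, Option.some.injEq, Prod.mk.injEq] at h1
        exact h1.2.symm
    · cases h
  · rintro rfl
    rw [barVertex_zero]
    exact ⟨by simp [FrameData.a], Or.inl (.apexA hA i)⟩

theorem adj_apexB (hB : D.HasApexB) {i : Fin k} {c : ℕ} (hc : c ≤ D.len i) :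
    D.apexedFrame.Adj (.apexB hB) (D.barVertex i c) ↔ c = D.len i := by
  rw [apexedFrame_adj]
  constructor
  · rintro ⟨-, h⟩
    have h1 := barPosition_barVertex hc
    generalize D.barVertex i c = s at h h1
    rcases h with h | h
    · cases h with
      | apexB h i' =>
        simp only [barPosition, FrameData.b, Option.some.injEq, Prod.mk.injEq] at h1
        obtain ⟨rfl, rfl⟩ := h1
        rfl
    · cases h
  · rintro rfl
    rw [barVertex_len]
    exact ⟨by simp [FrameData.b], Or.inl (.apexB hB i)⟩

theorem not_adj_apexes (hA : D.HasApexA) (hB : D.HasApexB) :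
    ¬ D.apexedFrame.Adj (.apexA hA) (.apexB hB) := by
  rw [apexedFrame_adj]
  rintro ⟨-, h | h⟩ <;> cases h

open Classical in
/-- The presentation of the apexed frame with data `D`. -/
noncomputable def presentation (D : FrameData k) (h : D.IsRegular ℓ) (hℓ : 7 ≤ ℓ) :
    FramePresentation D.apexedFrame k ℓ where
  len := D.len
  p := D.barVertex
  A := D.A
  B := D.B
  hasA := D.HasApexA
  hasB := D.HasApexB
  α := if hA : D.HasApexA then .apexA hA else D.a ⟨0, by have := h.three_le; omega⟩
  β := if hB : D.HasApexB then .apexB hB else D.a ⟨0, by have := h.three_le; omega⟩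
  three_le := h.three_le
  seven_le := hℓ
  two_le_len := h.two_le_len
  cover t := by
    cases t with
    | bar i j => exact Or.inl ⟨i, j, by omega, (barVertex_val i j).symm⟩
    | apexA hA => exact Or.inr (Or.inl ⟨hA, by simp [hA]⟩)
    | apexB hB => exact Or.inr (Or.inr ⟨hB, by simp [hB]⟩)
  p_inj := barVertex_inj
  p_ne_α hA i c _ := by simp [hA, barVertex]
  p_ne_β hB i c _ := by simp [hB, barVertex]
  α_ne_β hA hB := by simp [hA, hB]
  adj_p hc hd := adj_barVertex hc hd
  adj_α hA i c hc := by simpa [hA] using adj_apexA hA hc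
  adj_β hB i c hc := by simpa [hB] using adj_apexB hB hc
  not_adj_αβ hA hB := by simpa [hA, hB] using not_adj_apexes hA hB
  length := h.length
  domA := h.domA
  domB := h.domB
  isoA := h.isoA
  isoB := h.isoB
  hasA_or_hasB := h.hasA_or_hasB
  both := h.both
  short := h.short

theorem presentation_sideA (h : D.IsRegular ℓ) (hℓ : 7 ≤ ℓ) :
    (D.presentation h hℓ).sideA = D.sideAPlus := by
  ext t
  refine or_congr (exists_congr fun i => ?_) ⟨?_, ?_⟩
  · rw [← barVertex_zero]; rfl
  · rintro ⟨hA, rfl⟩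
    have hA' : D.HasApexA := hA
    exact ⟨hA', by simp [presentation, hA']⟩
  · rintro ⟨hA, rfl⟩
    exact ⟨hA, by simp [presentation, hA]⟩

theorem presentation_sideB (h : D.IsRegular ℓ) (hℓ : 7 ≤ ℓ) :
    (D.presentation h hℓ).sideB = D.sideBPlus := by
  ext t
  refine or_congr (exists_congr fun i => ?_) ⟨?_, ?_⟩
  · rw [← barVertex_len]; rfl
  · rintro ⟨hB, rfl⟩
    have hB' : D.HasApexB := hB
    exact ⟨hB', by simp [presentation, hB']⟩
  · rintro ⟨hB, rfl⟩
    exact ⟨hB, by simp [presentation, hB]⟩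

end FrameData

/-! ### The theorem, translated back to ordered bags. -/

theorem mainTheorem10 {k ℓ : ℕ} (hℓ : 7 ≤ ℓ)
    (D : FrameData k) (hD : D.IsFrame ℓ)
    {V : Type*} [Finite V] (G : SimpleGraph V) (hG : IsHoled ℓ G)
    (W : D.Vertex → List V) (hW : IsMaximalBlowUp D.apexedFrame G W)
    (x : V) (hx : x ∉ bagUnion W Set.univ) :
    G.IsClique (G.neighborSet x ∩ bagUnion W Set.univ) ∨
    bagUnion W Set.univ ⊆ G.neighborSet x ∨
    (G.neighborSet x ∩ bagUnion W Set.univ ⊆ bagUnion W D.sideAPlus ∧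
      (D.HasApexA → ∃ i : Fin k, Disjoint (G.neighborSet x) (bagUnion W {D.a i}))) ∨
    (G.neighborSet x ∩ bagUnion W Set.univ ⊆ bagUnion W D.sideBPlus ∧
      (D.HasApexB → ∃ i : Fin k, Disjoint (G.neighborSet x) (bagUnion W {D.b i}))) := by
  have hreg := hD.isRegular hℓ
  obtain ⟨f, hf, hfadj⟩ := hW.1.exists_first
  have H : IsAttachment D.apexedFrame G ℓ (fun t => {y | y ∈ W t}) f x :=
    ⟨hG, hℓ, hW.1.isBlowUpFamily, hf, hfadj, fun t ht => hx ⟨t, trivial, ht⟩⟩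
  have hdisj : ∀ t, ¬ Meets G (fun t => {y | y ∈ W t}) x t →
      Disjoint (G.neighborSet x) (bagUnion W {t}) := by
    intro t ht
    refine Set.disjoint_left.2 ?_
    rintro y hxy ⟨_, rfl, hy⟩
    exact ht ⟨y, hy, hxy⟩
  rcases H.neighbors_of_maximal (D.presentation hreg hℓ)
    (hW.not_isBlowUpFamily_insert hx) with h | h | ⟨h, h'⟩ | ⟨h, h'⟩
  · left
    refine h.subset ?_
    rintro y ⟨hxy, t, -, hy⟩
    exact ⟨hxy, t, hy⟩
  · right; left
    rintro y ⟨t, -, hy⟩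
    exact h t y hy
  · right; right; left
    refine ⟨?_, fun hA => ?_⟩
    · rintro y ⟨hxy, t, -, hy⟩
      exact ⟨t, D.presentation_sideA hreg hℓ ▸ h t ⟨y, hy, hxy⟩, hy⟩
    · obtain ⟨i, hi⟩ := h' hA
      exact ⟨i, FrameData.barVertex_zero (D := D) i ▸ hdisj _ hi⟩
  · right; right; right
    refine ⟨?_, fun hB => ?_⟩
    · rintro y ⟨hxy, t, -, hy⟩
      exact ⟨t, D.presentation_sideB hreg hℓ ▸ h t ⟨y, hy, hxy⟩, hy⟩
    · obtain ⟨i, hi⟩ := h' hB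
      exact ⟨i, FrameData.barVertex_len (D := D) i ▸ hdisj _ hi⟩
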